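/- **Proposition 2 (VE only captures $p$).** Let $\alpha,\beta\in C^2([0,1])$ not depend on $d$, with $\alpha_0=\beta_1=1$, $\alpha_1=\beta_0=0$ and $\dot\alpha_\tau<0<\dot\beta_\tau$ on $[0,1]$. Let $p\in[0,1]$, let $r=r_d\in\mathbb R^d$ with $|r|^2=d$, let $\sigma=\sigma_d>0$ with $\sigma_d^2=\Theta_d(1)$, and let $\mu=p\,\mathcal N(r,\sigma^2\mathrm{Id})+(1-p)\,\mathcal N(-r,\sigma^2\mathrm{Id})$. Let $I_\tau=\sqrt d\,\alpha_\tau z+\beta_\tau a$ with $z\sim\mathcal N(0,\mathrm{Id}_d)$ and $a\sim\mu$ independent (the variance exploding interpolant). Then $b_\tau(x)=\mathbb E[\dot I_\tau\mid I_\tau=x]$ has a version that is continuous in $x$ for each $\tau\in[0,1]$. Let $X^{\Delta\tau}_\tau$ be the Euler discretization of $\dot X_\tau=b_\tau(X_\tau)$, $X_0\sim\mathcal N(0,d\,\mathrm{Id}_d)$, with this $b$, on the uniform grid of step $\Delta\tau=1/N$ (with the drift frozen between grid points), and put $$M^{\Delta\tau,d}_\tau=\frac{r\cdot X^{\Delta\tau}_\tau}{d},\qquad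 X^\perp_\tau=X^{\Delta\tau}_\tau-M^{\Delta\tau,d}_\tau r .$$ (a) *Magnetization.* $M^{\Delta\tau,d}_0\sim\mathcal N(0,1)$ for every $d\ge1$, and the limit $M_\tau=\lim_{\Delta\tau\to0}\lim_{d\to\infty}M^{\Delta\tau,d}_\tau$ exists, both in distribution for each $\tau\in[0,1]$ and pointwise as a function of the initial value $M_0=m$ (for every $m$ if $\tau<1$, for almost every $m$ if $\tau=1$). It satisfies, for $\tau\in[0,1)$ and every $M_0=m$, the $d$-independent ODE $$\dot M_\tau=\frac{\dot\alpha_\tau}{\alpha_\tau}M_\tau+\frac{\alpha_\tau\dot\beta_\tau-\dot\alpha_\tau\beta_\tau}{\alpha_\tau}\tanh\Big(h+\frac{\beta_\tau M_\tau}{\alpha_\tau^2}\Big),\qquad \frac{e^h}{e^h+e^{-h}}=p,$$ where $\tanh(\cdot)$ is replaced by $1$ if $p=1$ and by $-1$ if $p=0$. Moreover $M_\tau\to M_1$ almost surely as $\tau\to1^-$, and $$M_1\sim p\,\delta_1+(1-p)\,\delta_{-1}.$$ (b) *Speciation time.* Let $s\in\{1,-1\}$ be the mode of $a$, that is, $\mathbb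 P(s=1)=p$ and $a\mid s\sim\mathcal N(sr,\sigma^2\mathrm{Id})$. For $0<\varepsilon<4p(1-p)=\mathrm{Var}(s)$ let the speciation time $\tau_s^{d}(\varepsilon)$ be the time after which the mode is determined up to $\varepsilon$: the infimum of the $\tau\in[0,1]$ with $\mathbb E\big[(s-\mathbb E[s\mid I_t])^2\big]\le\varepsilon$ for all $t\in[\tau,1]$. Then $\tau_s^{d}(\varepsilon)$ converges as $d\to\infty$ to a limit $\tau_s(\varepsilon)\in(0,1)$. (c) *Orthogonal part.* There are $\sigma^{\Delta\tau,d}_\tau\ge0$ such that at all grid points $\tau=\ell\Delta\tau\in[0,1]$ $$X^\perp_\tau\sim\mathcal N\big(0,(\sigma^{\Delta\tau,d}_\tau)^2\,\mathrm{Id}_{d-1}\big)\quad\text{on } r^\perp,$$ and, in units of the initial standard deviation $\sqrt d$, $$\lim_{\Delta\tau\to0}\lim_{d\to\infty}\frac{\sigma^{\Delta\tau,d}_1}{\sqrt d}=0 .$$ Without this normalization, for every fixed step $\Delta\tau$ the limit of $\sigma^{\Delta\tau,d}_1$ as $d\to\infty$ is either $0$ or $+\infty$, so that $\sigma^2$ is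 lost; it is $0$ for every $\Delta\tau$ if $\alpha_\tau=1-\tau$, and then $\lim_{\Delta\tau\to0}\lim_{d\to\infty}\sigma^{\Delta\tau,d}_1=0$. -/

import Mathlib

open MeasureTheory ProbabilityTheory Filter Topology Set Asymptotics
open scoped RealInnerProductSpace

noncomputable section

/-- The law `N(m, s² Id)` on `ℝ^d`: the law of `m + s g` with `g` standard Gaussian. -/
def gaussianIso {d : ℕ} (m : EuclideanSpace ℝ (Fin d)) (s : ℝ) :
    Measure (EuclideanSpace ℝ (Fin d)) :=
  (stdGaussian (EuclideanSpace ℝ (Fin d))).map (fun g => m + s • g)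

instance gaussianIso_isProbabilityMeasure {d : ℕ} (m : EuclideanSpace ℝ (Fin d)) (s : ℝ) :
    IsProbabilityMeasure (gaussianIso m s) :=
  Measure.isProbabilityMeasure_map (Measurable.aemeasurable (by fun_prop))

/-- The data law `μ = p N(r, σ² Id) + (1 - p) N(-r, σ² Id)`. -/
def gaussianMixture {d : ℕ} (p : ℝ) (r : EuclideanSpace ℝ (Fin d)) (σ : ℝ) :
    Measure (EuclideanSpace ℝ (Fin d)) :=
  ENNReal.ofReal p • gaussianIso r σ + ENNReal.ofReal (1 - p) • gaussianIso (-r) σ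

/-- The joint law of `(mode, a)`: the mode is `1` with probability `p` and `-1` with probability
`1 - p`, and given the mode, `a` has law `N(mode • r, σ² Id)`. Its second marginal is the
mixture `gaussianMixture p r σ`. -/
def labelledMixture {d : ℕ} (p : ℝ) (r : EuclideanSpace ℝ (Fin d)) (σ : ℝ) :
    Measure (ℝ × EuclideanSpace ℝ (Fin d)) :=
  ENNReal.ofReal p • (Measure.dirac (1 : ℝ)).prod (gaussianIso r σ)
    + ENNReal.ofReal (1 - p) • (Measure.dirac (-1 : ℝ)).prod (gaussianIso (-r) σ)

/-- The derivative of a function of time on `[0,1]` (one-sided at the end points). -/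
def timeDeriv {F : Type*} [NormedAddCommGroup F] [NormedSpace ℝ F] (f : ℝ → F) (τ : ℝ) : F :=
  derivWithin f (Icc 0 1) τ

/-- The interpolant `I_τ = c α_τ z + β_τ a`, as a function of the pair `(z, a)`. -/
def interpolant {d : ℕ} (c : ℝ) (α β : ℝ → ℝ) (τ : ℝ)
    (za : EuclideanSpace ℝ (Fin d) × EuclideanSpace ℝ (Fin d)) : EuclideanSpace ℝ (Fin d) :=
  (c * α τ) • za.1 + β τ • za.2

/-- `b` is the velocity field `b_τ(x) = E[İ_τ | I_τ = x]` of the probability flow ODE of the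
interpolant between `N(0, c² Id)` and `μ`, with `z ∼ N(0, Id)` and `a ∼ μ` independent:
for each `τ ∈ [0,1]` it is the continuous version of that conditional expectation. -/
def IsProbabilityFlowVelocity {d : ℕ} (c : ℝ) (α β : ℝ → ℝ)
    (μ : Measure (EuclideanSpace ℝ (Fin d)))
    (b : ℝ → EuclideanSpace ℝ (Fin d) → EuclideanSpace ℝ (Fin d)) : Prop :=
  ∀ τ ∈ Icc (0 : ℝ) 1, Continuous (b τ) ∧
    (fun za => b τ (interpolant c α β τ za))
      =ᵐ[(stdGaussian (EuclideanSpace ℝ (Fin d))).prod μ]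
    ((stdGaussian (EuclideanSpace ℝ (Fin d))).prod μ)[
      fun za => timeDeriv (fun t => interpolant c α β t za) τ
      | MeasurableSpace.comap (interpolant c α β τ) inferInstance]

/-- The Euler scheme for `Ẋ_τ = b_τ(X_τ)` on the uniform grid of step `1/N`: `eulerGrid b N k x`
is the state at time `k/N` when started from `x`. -/
def eulerGrid {d : ℕ} (b : ℝ → EuclideanSpace ℝ (Fin d) → EuclideanSpace ℝ (Fin d)) (N : ℕ) :
    ℕ → EuclideanSpace ℝ (Fin d) → EuclideanSpace ℝ (Fin d)
  | 0, x => x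
  | k + 1, x => eulerGrid b N k x + (1 / (N : ℝ)) • b ((k : ℝ) / N) (eulerGrid b N k x)

/-- The Euler scheme at an arbitrary time `τ`: from the last grid point before `τ`, one moves
with the velocity at that grid point. At a grid point this is the grid value. -/
def eulerPath {d : ℕ} (b : ℝ → EuclideanSpace ℝ (Fin d) → EuclideanSpace ℝ (Fin d)) (N : ℕ)
    (τ : ℝ) (x : EuclideanSpace ℝ (Fin d)) : EuclideanSpace ℝ (Fin d) :=
  eulerGrid b N ⌊τ * N⌋₊ x
    + (τ - (⌊τ * N⌋₊ : ℝ) / N) • b ((⌊τ * N⌋₊ : ℝ) / N) (eulerGrid b N ⌊τ * N⌋₊ x)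

/-- The magnetization `r · x / d`. -/
def magnetization {d : ℕ} (r x : EuclideanSpace ℝ (Fin d)) : ℝ := ⟪r, x⟫ / d

/-- The orthogonal part `x - (r · x / d) r`. -/
def orthPart {d : ℕ} (r x : EuclideanSpace ℝ (Fin d)) : EuclideanSpace ℝ (Fin d) :=
  x - magnetization r x • r

/-- The path `M` solves, on `[0,1)`, the equation
`Ṁ = (α̇/α) M + ((α β̇ - α̇ β)/α) T(β M / α²)`. -/
def SolvesLimitODE (α β : ℝ → ℝ) (T : ℝ → ℝ) (M : ℝ → ℝ) : Prop :=
  ∀ τ ∈ Ico (0 : ℝ) 1, HasDerivWithinAt M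
    (timeDeriv α τ / α τ * M τ
      + (α τ * timeDeriv β τ - timeDeriv α τ * β τ) / α τ * T (β τ * M τ / α τ ^ 2))
    (Ico 0 1) τ

/-- What is still undetermined at time `τ` about the mode (`1` or `-1`) of the sample: the mean
conditional variance `E[(mode - E[mode | I_τ])²]` of the mode given the state `I_τ`. -/
def modeUncertainty {d : ℕ} (c : ℝ) (α β : ℝ → ℝ) (p : ℝ) (r : EuclideanSpace ℝ (Fin d))
    (σ : ℝ) (τ : ℝ) : ℝ :=
  ∫ ω, (ω.2.1 -
      (((stdGaussian (EuclideanSpace ℝ (Fin d))).prod (labelledMixture p r σ))[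
        fun ω' => ω'.2.1
        | MeasurableSpace.comap (fun ω' => interpolant c α β τ (ω'.1, ω'.2.2))
            inferInstance]) ω) ^ 2
    ∂((stdGaussian (EuclideanSpace ℝ (Fin d))).prod (labelledMixture p r σ))

/-- The speciation time at tolerance `ε`: the time after which the mode of the sample is
determined, up to an uncertainty `ε`. -/
def speciationTime {d : ℕ} (c : ℝ) (α β : ℝ → ℝ) (p : ℝ) (r : EuclideanSpace ℝ (Fin d))
    (σ : ℝ) (ε : ℝ) : ℝ :=
  sInf {τ ∈ Icc (0 : ℝ) 1 | ∀ t ∈ Icc τ 1, modeUncertainty c α β p r σ t ≤ ε}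

end

/-! Given its mode s, the state I_τ is Gaussian with mean sβr and covariance V Id, where V = dα² +
β²σ². Regressing the velocity on the state leaves a Gaussian residual independent of the state plus
a multiple of s r. Hence b_τ(x) = A x + (β̇ − Aβ) E[s | I_τ = x] r, and by Bayes the posterior mean
is T(β r·x / V) with T = `mixtureTanh p` (`mixtureRegression_ae_eq_condExp`). The state has full
support, so this is the only continuous version (`eq_of_comp_interpolant_ae_eq`).

The coefficient of r depends on x only through r·x. So an Euler step acts on the magnetization by a
scalar scheme and multiplies the orthogonal part by a number. The dimension enters both only through
q = σ²/d, which tends to 0. At a fixed step the drift is used only at grid times before 1, where α >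
0, so the limit d → ∞ amounts to setting q = 0.

For q = 0, the substitution M = α y(β/α) turns the equation into dy/dρ = T(ρ y), whose flow carries
N(0,1) to the law of ρ s + g. On the line this is conservation of mass, p Φ(y − ρ) + (1 − p) Φ(y +
ρ) = Φ(m) (`mixtureTanh_flow_cdf`). It forces y/ρ → 1 if Φ(m) > 1 − p and y/ρ → −1 if Φ(m) < 1 − p.
As Φ(m) is uniform when m is Gaussian, the terminal law follows.

On [0,S] with S < 1 the Euler scheme converges by the Lipschitz theory. At time 1 the drift is
singular, with rate A ~ −1/(1 − τ). For small steps every factor 1 + Δτ A except the last lies in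
[0,1], and the last tends to 0. This removes the orthogonal part in units of √d. It also makes the
last step forget the state and return approximately T at a large argument, which is the right mode
because the scheme has kept its sign (`tendsto_scalarEulerGrid_last`). Without the normalization, √d
times a nonzero limiting product diverges, while a vanishing factor is of order q at finite d and √d
q → 0.

For the speciation time, the uncertainty of the mode is a fixed function of the signal ratio β/√(α²
+ qβ²). The time after which it stays below ε converges to the time at which β/α reaches the
supremum of the ratios where that function exceeds ε (`exists_tendsto_sInf`). -/

section GaussianFacts

variable {E : Type*} [NormedAddCommGroup E] [InnerProductSpace ℝ E] [FiniteDimensional ℝ E]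
  [MeasurableSpace E] [BorelSpace E]

theorem map_rotation_stdGaussian (θ : ℝ) :
    ((stdGaussian E).prod (stdGaussian E)).map (ContinuousLinearMap.rotation θ)
      = (stdGaussian E).prod (stdGaussian E) :=
  IsGaussian.map_rotation_eq_self_of_forall_strongDual_eq_zero integral_strongDual_stdGaussian θ

theorem map_inner_stdGaussian (u : E) :
    (stdGaussian E).map (fun g => ⟪u, g⟫) = gaussianReal 0 (‖u‖ ^ 2).toNNReal := by
  have h := IsGaussian.map_eq_gaussianReal (μ := stdGaussian E) (innerSL ℝ u)
  rw [variance_dual_stdGaussian, integral_strongDual_stdGaussian, innerSL_apply_norm] at h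
  exact h

end GaussianFacts

/-! ### Exponential tilts and projections of the standard Gaussian. -/

/-- The integral factorizes over coordinates. Tilt and frequency are kept together so that one
formula gives both characteristic functions compared in the Cameron–Martin formula. -/
theorem integral_cexp_inner_stdGaussian {d : ℕ} (u t : EuclideanSpace ℝ (Fin d)) :
    ∫ x, Complex.exp (⟪u, x⟫ + ⟪x, t⟫ * Complex.I) ∂(stdGaussian (EuclideanSpace ℝ (Fin d)))
      = Complex.exp (‖u‖ ^ 2 / 2 - ‖t‖ ^ 2 / 2 + ⟪u, t⟫ * Complex.I) := by
  rw [← map_pi_eq_stdGaussian, integral_map (by fun_prop)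
    (Measurable.aestronglyMeasurable (by fun_prop))]
  have h1 : ∀ x : Fin d → ℝ, Complex.exp ((⟪u, WithLp.toLp 2 x⟫ : ℝ)
      + (⟪WithLp.toLp 2 x, t⟫ : ℝ) * Complex.I)
      = ∏ i, Complex.exp (((u i : ℂ) + t i * Complex.I) * x i) := by
    intro x
    rw [← Complex.exp_sum]
    congr 1
    simp only [PiLp.inner_apply, RCLike.inner_apply, conj_trivial]
    push_cast
    rw [Finset.sum_mul, ← Finset.sum_add_distrib]
    exact Finset.sum_congr rfl fun i _ => by ring
  simp_rw [h1]
  rw [integral_fintype_prod_eq_prod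
    (f := fun i (x : ℝ) => Complex.exp (((u i : ℂ) + t i * Complex.I) * x))]
  have h2 : ∀ z : ℂ, ∫ x : ℝ, Complex.exp (z * x) ∂(gaussianReal 0 1) = Complex.exp (z ^ 2 / 2) := by
    intro z
    have := complexMGF_id_gaussianReal (μ := 0) (v := 1) z
    simpa [complexMGF] using this
  simp_rw [h2]
  rw [← Complex.exp_sum]
  congr 1
  rw [← Complex.ofReal_pow, ← Complex.ofReal_pow, EuclideanSpace.real_norm_sq_eq,
    EuclideanSpace.real_norm_sq_eq]
  simp only [PiLp.inner_apply, RCLike.inner_apply, conj_trivial]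
  push_cast
  rw [Finset.sum_mul, Finset.sum_div, Finset.sum_div, ← Finset.sum_sub_distrib,
    ← Finset.sum_add_distrib]
  refine Finset.sum_congr rfl fun i _ => ?_
  linear_combination (t i : ℂ) ^ 2 / 2 * Complex.I_sq

theorem integrable_exp_inner_stdGaussian {d : ℕ} (u : EuclideanSpace ℝ (Fin d)) :
    Integrable (fun x => Real.exp ⟪u, x⟫) (stdGaussian (EuclideanSpace ℝ (Fin d))) := by
  have h := integral_cexp_inner_stdGaussian u 0
  have h2 : Integrable (fun x => Complex.exp (⟪u, x⟫ + ⟪x, (0 : EuclideanSpace ℝ (Fin d))⟫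
      * Complex.I)) (stdGaussian (EuclideanSpace ℝ (Fin d))) := by
    -- The Bochner integral of a non-integrable function is 0, whereas the computed value is an
    -- exponential.
    by_contra hc
    rw [integral_undef hc] at h
    exact Complex.exp_ne_zero _ h.symm
  refine h2.norm.congr (ae_of_all _ fun x => ?_)
  simp [Complex.norm_exp]

/-- The Cameron–Martin formula for the standard Gaussian measure. -/
theorem stdGaussian_map_add {d : ℕ} (u : EuclideanSpace ℝ (Fin d)) :
    (stdGaussian (EuclideanSpace ℝ (Fin d))).map (fun g => g + u)
      = (stdGaussian (EuclideanSpace ℝ (Fin d))).withDensity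
          (fun g => ENNReal.ofReal (Real.exp (⟪u, g⟫ - ‖u‖ ^ 2 / 2))) := by
  have hint : Integrable (fun g => Real.exp (⟪u, g⟫ - ‖u‖ ^ 2 / 2))
      (stdGaussian (EuclideanSpace ℝ (Fin d))) := by
    simp_rw [Real.exp_sub]
    exact (integrable_exp_inner_stdGaussian u).div_const _
  have : IsFiniteMeasure ((stdGaussian (EuclideanSpace ℝ (Fin d))).withDensity
      (fun g => ENNReal.ofReal (Real.exp (⟪u, g⟫ - ‖u‖ ^ 2 / 2)))) :=
    isFiniteMeasure_withDensity_ofReal hint.2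
  apply Measure.ext_of_charFun
  ext t
  rw [charFun_apply, charFun_apply, integral_map (by fun_prop)
    (Measurable.aestronglyMeasurable (by fun_prop)),
    integral_withDensity_eq_integral_toReal_smul (by fun_prop) (by simp)]
  simp_rw [ENNReal.toReal_ofReal (Real.exp_pos _).le]
  have h1 : ∀ x : EuclideanSpace ℝ (Fin d), Complex.exp ((⟪x + u, t⟫ : ℝ) * Complex.I)
      = Complex.exp ((⟪u, t⟫ : ℝ) * Complex.I)
        * Complex.exp ((⟪(0 : EuclideanSpace ℝ (Fin d)), x⟫ : ℝ) + (⟪x, t⟫ : ℝ) * Complex.I) := by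
    intro x
    rw [← Complex.exp_add, inner_add_left, inner_zero_left]
    congr 1
    push_cast; ring
  have h2 : ∀ x : EuclideanSpace ℝ (Fin d),
      Real.exp (⟪u, x⟫ - ‖u‖ ^ 2 / 2) • Complex.exp ((⟪x, t⟫ : ℝ) * Complex.I)
      = Complex.exp (-(‖u‖ ^ 2 / 2))
        * Complex.exp ((⟪u, x⟫ : ℝ) + (⟪x, t⟫ : ℝ) * Complex.I) := by
    intro x
    rw [Complex.real_smul, Complex.ofReal_exp, ← Complex.exp_add, ← Complex.exp_add]
    congr 1
    push_cast; ring
  simp_rw [h1, h2, integral_const_mul, integral_cexp_inner_stdGaussian]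
  rw [← Complex.exp_add, ← Complex.exp_add]
  congr 1
  simp only [norm_zero, inner_zero_left]
  push_cast; ring

theorem integral_stdGaussian_add {d : ℕ} {F : Type*} [NormedAddCommGroup F] [NormedSpace ℝ F]
    (u : EuclideanSpace ℝ (Fin d)) {f : EuclideanSpace ℝ (Fin d) → F}
    (hf : StronglyMeasurable f) :
    ∫ g, f (g + u) ∂(stdGaussian (EuclideanSpace ℝ (Fin d)))
      = ∫ g, Real.exp (⟪u, g⟫ - ‖u‖ ^ 2 / 2) • f g
          ∂(stdGaussian (EuclideanSpace ℝ (Fin d))) := by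
  rw [← integral_map (φ := fun g => g + u) (by fun_prop) hf.aestronglyMeasurable,
    stdGaussian_map_add, integral_withDensity_eq_integral_toReal_smul (by fun_prop) (by simp)]
  simp_rw [ENNReal.toReal_ofReal (Real.exp_pos _).le]

/-- Full support is what upgrades almost everywhere equality of continuous velocity fields to
equality. -/
theorem isOpenPosMeasure_stdGaussian (d : ℕ) :
    (stdGaussian (EuclideanSpace ℝ (Fin d))).IsOpenPosMeasure := by
  have : (gaussianReal 0 1).IsOpenPosMeasure :=
    (gaussianReal_absolutelyContinuous' 0 one_ne_zero).isOpenPosMeasure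
  rw [← map_pi_eq_stdGaussian]
  exact (PiLp.continuous_toLp 2 _).isOpenPosMeasure_map (WithLp.toLp_surjective 2)

theorem map_magnetization_gaussianIso {d : ℕ} (hd : 1 ≤ d) {r : EuclideanSpace ℝ (Fin d)}
    (hr : ‖r‖ ^ 2 = d) :
    (gaussianIso (0 : EuclideanSpace ℝ (Fin d)) (√d)).map (magnetization r)
      = gaussianReal 0 1 := by
  have hd0 : (0 : ℝ) < d := by exact_mod_cast hd
  have hs : √(d : ℝ) ≠ 0 := (Real.sqrt_pos.2 hd0).ne'
  have hm : Measurable (magnetization r) := by unfold magnetization; fun_prop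
  rw [gaussianIso, Measure.map_map hm (by fun_prop)]
  have : magnetization r ∘ (fun g => (0 : EuclideanSpace ℝ (Fin d)) + √(d : ℝ) • g)
      = fun g => ⟪(√(d : ℝ))⁻¹ • r, g⟫ := by
    ext g
    simp only [Function.comp, magnetization, zero_add, real_inner_smul_left, real_inner_smul_right]
    rw [mul_comm, mul_div_assoc, mul_comm]
    congr 1
    rw [div_eq_iff hd0.ne', inv_mul_eq_div, eq_div_iff hs, Real.mul_self_sqrt hd0.le]
  rw [this, map_inner_stdGaussian, norm_smul, mul_pow, hr]
  congr
  rw [norm_inv, Real.norm_eq_abs, inv_pow, sq_abs, Real.sq_sqrt hd0.le, inv_mul_cancel₀ hd0.ne']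
  simp

theorem orthPart_eq_orthogonalProjectionOnto {d : ℕ} {r : EuclideanSpace ℝ (Fin d)} (hr : ‖r‖ ^ 2 = d)
    (x : EuclideanSpace ℝ (Fin d)) :
    orthPart r x = ((Submodule.span ℝ {r})ᗮ.orthogonalProjectionOnto x : EuclideanSpace ℝ (Fin d)) := by
  rw [← Submodule.starProjection_apply, Submodule.starProjection_orthogonal_val,
    Submodule.starProjection_singleton]
  simp [orthPart, magnetization, hr]

/-- Only the square of `s` is prescribed because a centred Gaussian is symmetric. This allows a
nonnegative standard deviation although the Euler factor `c` may be negative. -/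
theorem map_smul_orthPart_gaussianIso {d : ℕ} {r : EuclideanSpace ℝ (Fin d)} (hr : ‖r‖ ^ 2 = d)
    {c k s : ℝ} (hs : s ^ 2 = (c * k) ^ 2) :
    (gaussianIso (0 : EuclideanSpace ℝ (Fin d)) k).map (fun x => c • orthPart r x)
      = (stdGaussian ((Submodule.span ℝ {r})ᗮ)).map
          (fun w : (Submodule.span ℝ {r})ᗮ => s • (w : EuclideanSpace ℝ (Fin d))) := by
  simp_rw [orthPart_eq_orthogonalProjectionOnto hr]
  set K := (Submodule.span ℝ {r})ᗮ
  have hmeas : Measurable fun x : EuclideanSpace ℝ (Fin d) =>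
      c • (K.orthogonalProjectionOnto x : EuclideanSpace ℝ (Fin d)) := by fun_prop
  rw [gaussianIso, Measure.map_map hmeas (by fun_prop)]
  have : IsProbabilityMeasure ((stdGaussian (EuclideanSpace ℝ (Fin d))).map
      ((fun x => c • (K.orthogonalProjectionOnto x : EuclideanSpace ℝ (Fin d))) ∘
        fun g => (0 : EuclideanSpace ℝ (Fin d)) + k • g)) :=
    Measure.isProbabilityMeasure_map (hmeas.comp (by fun_prop)).aemeasurable
  have : IsProbabilityMeasure ((stdGaussian K).map
      (fun w : K => s • (w : EuclideanSpace ℝ (Fin d)))) :=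
    Measure.isProbabilityMeasure_map (Measurable.aemeasurable (by fun_prop))
  apply Measure.ext_of_charFun
  ext t
  rw [charFun_apply, charFun_apply, integral_map (hmeas.comp (by fun_prop)).aemeasurable
    (Measurable.aestronglyMeasurable (by fun_prop)), integral_map (by fun_prop)
    (Measurable.aestronglyMeasurable (by fun_prop))]
  have h1 : ∀ x : EuclideanSpace ℝ (Fin d),
      ⟪((fun x => c • (K.orthogonalProjectionOnto x : EuclideanSpace ℝ (Fin d))) ∘
        fun g => (0 : EuclideanSpace ℝ (Fin d)) + k • g) x, t⟫
      = ⟪x, (c * k) • (K.orthogonalProjectionOnto t : EuclideanSpace ℝ (Fin d))⟫ := by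
    intro x
    simp only [Function.comp, zero_add, map_smul, Submodule.coe_smul, real_inner_smul_left,
      real_inner_smul_right]
    rw [← Submodule.starProjection_apply, ← Submodule.starProjection_apply,
      Submodule.inner_starProjection_left_eq_right]
    ring
  have h2 : ∀ w : K, ⟪s • (w : EuclideanSpace ℝ (Fin d)), t⟫
      = ⟪w, s • K.orthogonalProjectionOnto t⟫ := by
    intro w
    rw [real_inner_smul_left, real_inner_smul_right,
      Submodule.inner_orthogonalProjectionOnto_eq_of_mem_left]
  simp_rw [h1, h2]
  rw [← charFun_apply, ← charFun_apply, charFun_stdGaussian, charFun_stdGaussian]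
  congr 4
  rw [norm_smul, norm_smul, Submodule.norm_coe, Real.norm_eq_abs, Real.norm_eq_abs,
    (sq_eq_sq_iff_abs_eq_abs s (c * k)).1 hs]

/-! ### The posterior mean of a sign, in a form that includes p = 0 and p = 1. -/

section MixtureTanh

/-- The conditional mean of a sign with prior `P(s = 1) = p` when the likelihood ratio of the two
signs is `exp (2 u)`; this is `tanh (h + u)` when `p = e^h / (e^h + e^{-h})`. -/
noncomputable def mixtureTanh (p u : ℝ) : ℝ :=
  (p * Real.exp u - (1 - p) * Real.exp (-u)) / (p * Real.exp u + (1 - p) * Real.exp (-u))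

variable {p : ℝ}

theorem mixtureTanh_denom_pos (hp : p ∈ Icc (0 : ℝ) 1) (u : ℝ) :
    0 < p * Real.exp u + (1 - p) * Real.exp (-u) := by
  obtain ⟨h0, h1⟩ := hp
  rcases h0.eq_or_lt with rfl | h0
  · simpa using Real.exp_pos _
  · have := Real.exp_pos u
    have := Real.exp_pos (-u)
    have : 0 ≤ (1 - p) * Real.exp (-u) := mul_nonneg (by linarith) (by positivity)
    positivity

/-- Up to the factor 2, this is the posterior probability of the sign −1. -/
theorem one_sub_mixtureTanh (hp : p ∈ Icc (0 : ℝ) 1) (u : ℝ) :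
    1 - mixtureTanh p u
      = 2 * ((1 - p) * Real.exp (-u)) / (p * Real.exp u + (1 - p) * Real.exp (-u)) := by
  have := (mixtureTanh_denom_pos hp u).ne'
  rw [mixtureTanh]
  field_simp
  ring

theorem one_add_mixtureTanh (hp : p ∈ Icc (0 : ℝ) 1) (u : ℝ) :
    1 + mixtureTanh p u
      = 2 * (p * Real.exp u) / (p * Real.exp u + (1 - p) * Real.exp (-u)) := by
  have := (mixtureTanh_denom_pos hp u).ne'
  rw [mixtureTanh]
  field_simp
  ring

theorem mixtureTanh_le_one (hp : p ∈ Icc (0 : ℝ) 1) (u : ℝ) : mixtureTanh p u ≤ 1 := by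
  have h := one_sub_mixtureTanh hp u
  have := mixtureTanh_denom_pos hp u
  have : 0 ≤ 2 * ((1 - p) * Real.exp (-u)) := by
    have : 0 ≤ 1 - p := by linarith [hp.2]
    positivity
  have : 0 ≤ 1 - mixtureTanh p u := by rw [h]; positivity
  linarith

/-- Exchanging the two modes reflects the argument and the value. Statements about the mode −1 are
deduced from those about 1 in this way. -/
theorem mixtureTanh_one_sub (u : ℝ) : mixtureTanh (1 - p) u = -mixtureTanh p (-u) := by
  simp only [mixtureTanh, neg_neg, ← neg_div]
  congr 1 <;> ring

theorem one_sub_mem_Icc (hp : p ∈ Icc (0 : ℝ) 1) : 1 - p ∈ Icc (0 : ℝ) 1 :=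
  ⟨by linarith [hp.2], by linarith [hp.1]⟩

theorem abs_mixtureTanh_le_one (hp : p ∈ Icc (0 : ℝ) 1) (u : ℝ) : |mixtureTanh p u| ≤ 1 := by
  have h := mixtureTanh_le_one (one_sub_mem_Icc hp) (-u)
  rw [mixtureTanh_one_sub, neg_neg] at h
  exact abs_le.2 ⟨by linarith, mixtureTanh_le_one hp u⟩

/-- The Riccati equation of tanh does not see the shift h, and it still holds for the constants ±1.
With values in [-1,1] it yields the Lipschitz constant 1. -/
theorem hasDerivAt_mixtureTanh (hp : p ∈ Icc (0 : ℝ) 1) (u : ℝ) :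
    HasDerivAt (mixtureTanh p) (1 - mixtureTanh p u ^ 2) u := by
  have hD := (mixtureTanh_denom_pos hp u).ne'
  have he : HasDerivAt (fun x : ℝ => (1 - p) * Real.exp (-x)) ((1 - p) * (Real.exp (-u) * -1)) u :=
    ((hasDerivAt_neg u).exp).const_mul _
  have he' := (Real.hasDerivAt_exp u).const_mul p
  have h := (he'.sub he).div (he'.add he) hD
  refine h.congr_deriv ?_
  simp only [Pi.add_apply, Pi.sub_apply]
  rw [mixtureTanh]
  field_simp
  ring

theorem continuous_mixtureTanh (hp : p ∈ Icc (0 : ℝ) 1) : Continuous (mixtureTanh p) :=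
  continuous_iff_continuousAt.2 fun u => (hasDerivAt_mixtureTanh hp u).continuousAt

theorem lipschitz_mixtureTanh (hp : p ∈ Icc (0 : ℝ) 1) (u v : ℝ) :
    |mixtureTanh p u - mixtureTanh p v| ≤ |u - v| := by
  have h := Convex.norm_image_sub_le_of_norm_hasDerivWithin_le (f := mixtureTanh p) (C := 1)
    (s := univ) (x := v) (y := u) (fun x _ => (hasDerivAt_mixtureTanh hp x).hasDerivWithinAt)
    (fun x _ => by
      have := abs_le.1 (abs_mixtureTanh_le_one hp x)
      rw [Real.norm_eq_abs, abs_le]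
      constructor <;> nlinarith) convex_univ (mem_univ _) (mem_univ _)
  simpa using h

theorem tendsto_mixtureTanh_atTop (hp0 : 0 < p) :
    Tendsto (mixtureTanh p) atTop (𝓝 1) := by
  have h : ∀ u, mixtureTanh p u
      = (p - (1 - p) * Real.exp (-(2 * u))) / (p + (1 - p) * Real.exp (-(2 * u))) := by
    intro u
    have : Real.exp (-(2 * u)) = Real.exp (-u) / Real.exp u := by
      rw [← Real.exp_sub]; congr 1; ring
    rw [this, mixtureTanh]
    have := Real.exp_pos u
    rw [← mul_div_mul_right _ (p + (1 - p) * (Real.exp (-u) / Real.exp u)) this.ne']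
    congr 1 <;> field_simp
  have he : Tendsto (fun u : ℝ => Real.exp (-(2 * u))) atTop (𝓝 0) :=
    Real.tendsto_exp_neg_atTop_nhds_zero.comp (tendsto_id.const_mul_atTop two_pos)
  have := ((tendsto_const_nhds (x := p)).sub (he.const_mul (1 - p))).div
    ((tendsto_const_nhds (x := p)).add (he.const_mul (1 - p))) (by simpa using hp0.ne')
  simp only [mul_zero, sub_zero, add_zero, div_self hp0.ne'] at this
  exact this.congr fun u => (h u).symm

theorem mixtureTanh_one (u : ℝ) : mixtureTanh 1 u = 1 := by
  simp [mixtureTanh]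

theorem mixtureTanh_zero (u : ℝ) : mixtureTanh 0 u = -1 := by
  simp [mixtureTanh]

theorem mixtureTanh_eq_tanh {h : ℝ} (hh : Real.exp h / (Real.exp h + Real.exp (-h)) = p) (u : ℝ) :
    mixtureTanh p u = Real.tanh (h + u) := by
  have h1 := Real.exp_pos h
  have h2 := Real.exp_pos (-h)
  have h3 : 1 - p = Real.exp (-h) / (Real.exp h + Real.exp (-h)) := by
    rw [← hh]; field_simp; ring
  rw [mixtureTanh, h3, ← hh, Real.tanh_eq_sinh_div_cosh, Real.sinh_eq, Real.cosh_eq, neg_add,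
    Real.exp_add, Real.exp_add]
  have := Real.exp_pos u
  have := Real.exp_pos (-u)
  field_simp

end MixtureTanh

/-! ### Bayes' rule for the sign, and regression for Gaussian pairs. -/

section Posterior

variable {d : ℕ} {p : ℝ}

/-- Weighted by the prior, the posterior mean of the sign is unbiased on every event. -/
theorem weighted_integral_sign_sub_mixtureTanh (hp : p ∈ Icc (0 : ℝ) 1)
    (m : EuclideanSpace ℝ (Fin d)) {v : ℝ} (hv : v ≠ 0) {f : EuclideanSpace ℝ (Fin d) → ℝ}
    (hf : Measurable f) :
    p * (∫ g, f (m + v • g) * (mixtureTanh p (⟪m, m + v • g⟫ / v ^ 2) - 1)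
        ∂(stdGaussian (EuclideanSpace ℝ (Fin d))))
      + (1 - p) * (∫ g, f (-m + v • g) * (mixtureTanh p (⟪m, -m + v • g⟫ / v ^ 2) - (-1))
        ∂(stdGaussian (EuclideanSpace ℝ (Fin d)))) = 0 := by
  have hT := (continuous_mixtureTanh hp).measurable
  -- Cameron–Martin moves the mean `c • m` into a density, so that both components are integrated
  -- against the same centred Gaussian. The hypothesis on `c` means c = ±1.
  have key : ∀ (c s : ℝ), c * c = 1 → ∫ g, f (c • m + v • g)
      * (mixtureTanh p (⟪m, c • m + v • g⟫ / v ^ 2) - s) ∂(stdGaussian (EuclideanSpace ℝ (Fin d)))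
      = ∫ g, Real.exp (c * (⟪m, g⟫ / v) - ‖v⁻¹ • m‖ ^ 2 / 2)
          * (f (v • g) * (mixtureTanh p (⟪m, g⟫ / v) - s))
          ∂(stdGaussian (EuclideanSpace ℝ (Fin d))) := by
    intro c s hc
    have hm : StronglyMeasurable
        fun g => f (v • g) * (mixtureTanh p (⟪m, g⟫ / v) - s) := by
      apply Measurable.stronglyMeasurable; fun_prop
    have h := integral_stdGaussian_add (c • v⁻¹ • m) hm
    convert h using 2
    · ext g
      have e1 : v • (g + c • v⁻¹ • m) = c • m + v • g := by
        rw [smul_add, smul_comm v c, smul_smul v, mul_inv_cancel₀ hv, one_smul, add_comm]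
      rw [e1, ← e1, real_inner_smul_right]
      congr 3
      field_simp
    · ext g
      have e2 : ‖c • v⁻¹ • m‖ ^ 2 = ‖v⁻¹ • m‖ ^ 2 := by
        rw [norm_smul, mul_pow, Real.norm_eq_abs, sq_abs, sq, hc, one_mul]
      rw [e2, real_inner_smul_left, real_inner_smul_left, smul_eq_mul, inv_mul_eq_div]
  have k1 := key 1 1 (by norm_num)
  have k2 := key (-1) (-1) (by norm_num)
  rw [one_smul] at k1
  rw [neg_one_smul] at k2
  rw [k1, k2, ← integral_const_mul, ← integral_const_mul, add_eq_zero_iff_eq_neg, ← integral_neg]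
  congr 1
  ext g
  -- The cancellation is now pointwise: prior times tilt is the numerator of the posterior weight of
  -- each sign.
  have h1 := one_sub_mixtureTanh hp (⟪m, g⟫ / v)
  have h2 := one_add_mixtureTanh hp (⟪m, g⟫ / v)
  have e1 : mixtureTanh p (⟪m, g⟫ / v) - 1 = -(1 - mixtureTanh p (⟪m, g⟫ / v)) := by ring
  have e2 : mixtureTanh p (⟪m, g⟫ / v) - (-1) = 1 + mixtureTanh p (⟪m, g⟫ / v) := by ring
  rw [e1, e2, h1, h2, Real.exp_sub, Real.exp_sub, one_mul, neg_one_mul]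
  ring

theorem exists_rotation_angle {a b v : ℝ} (hv : 0 < v) (h : a ^ 2 + b ^ 2 = v ^ 2) :
    ∃ θ : ℝ, a = v * Real.cos θ ∧ b = v * Real.sin θ := by
  have hn : ‖(⟨a, b⟩ : ℂ)‖ = v := by
    rw [Complex.norm_def, Complex.normSq_mk, ← sq, ← sq, h, Real.sqrt_sq hv.le]
  refine ⟨Complex.arg ⟨a, b⟩, ?_, ?_⟩
  · rw [← hn, Complex.norm_mul_cos_arg]
  · rw [← hn, Complex.norm_mul_sin_arg]

variable {F : Type*} [NormedAddCommGroup F] [NormedSpace ℝ F]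

/-- Expectations of a pair consisting of a linear combination of two independent standard Gaussian
vectors and of an uncorrelated one. -/
theorem integral_gaussian_pair {a b a' b' v : ℝ} (hv : 0 < v) (h : a ^ 2 + b ^ 2 = v ^ 2)
    {f : EuclideanSpace ℝ (Fin d) × EuclideanSpace ℝ (Fin d) → F} (hf : StronglyMeasurable f) :
    ∫ w, f (a • w.1 + b • w.2,
        a' • w.1 + b' • w.2 - ((a * a' + b * b') / v ^ 2) • (a • w.1 + b • w.2))
        ∂((stdGaussian (EuclideanSpace ℝ (Fin d))).prod (stdGaussian (EuclideanSpace ℝ (Fin d))))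
      = ∫ w, f (v • w.1, ((a * b' - b * a') / v) • w.2)
        ∂((stdGaussian (EuclideanSpace ℝ (Fin d))).prod
          (stdGaussian (EuclideanSpace ℝ (Fin d)))) := by
  -- Writing (a, b) = v (cos θ, sin θ), the state is v times the first coordinate of the rotated
  -- pair and the regression residual is a multiple of the second. The rotated pair has the same
  -- law.
  obtain ⟨θ, ha, hb⟩ := exists_rotation_angle hv h
  conv_rhs => rw [← map_rotation_stdGaussian θ]
  rw [integral_map (f := fun w : EuclideanSpace ℝ (Fin d) × EuclideanSpace ℝ (Fin d) =>
    f (v • w.1, ((a * b' - b * a') / v) • w.2)) (by fun_prop)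
    (hf.comp_measurable (by fun_prop)).aestronglyMeasurable]
  congr 1
  ext w
  congr 1
  rw [ContinuousLinearMap.rotation_apply]
  have hcs := Real.cos_sq_add_sin_sq θ
  ext1
  · simp only [smul_add, smul_smul, ha, hb]
  · have e1 : a' - (a * a' + b * b') / v ^ 2 * a = (a * b' - b * a') / v * -Real.sin θ := by
      rw [ha, hb]
      field_simp
      linear_combination (-a') * hcs
    have e2 : b' - (a * a' + b * b') / v ^ 2 * b = (a * b' - b * a') / v * Real.cos θ := by
      rw [ha, hb]
      field_simp
      linear_combination (-b') * hcs
    simp only [smul_add, smul_smul]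
    rw [← e1, ← e2, sub_smul, sub_smul]
    abel

theorem integral_gaussian_comb {a b v : ℝ} (hv : 0 < v) (h : a ^ 2 + b ^ 2 = v ^ 2)
    {f : EuclideanSpace ℝ (Fin d) → F} (hf : StronglyMeasurable f) :
    ∫ w, f (a • w.1 + b • w.2)
        ∂((stdGaussian (EuclideanSpace ℝ (Fin d))).prod (stdGaussian (EuclideanSpace ℝ (Fin d))))
      = ∫ x, f (v • x) ∂(stdGaussian (EuclideanSpace ℝ (Fin d))) := by
  rw [integral_gaussian_pair (a' := 0) (b' := 0) hv h (f := fun y => f y.1)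
    (hf.comp_measurable measurable_fst),
    integral_fun_fst (μ := stdGaussian (EuclideanSpace ℝ (Fin d)))
      (ν := stdGaussian (EuclideanSpace ℝ (Fin d))) (fun x => f (v • x))]
  simp

/-- The residual of the regression is independent of the state and centred. -/
theorem setIntegral_gaussian_residual {a b a' b' v : ℝ} (hv : 0 < v) (h : a ^ 2 + b ^ 2 = v ^ 2)
    {f : EuclideanSpace ℝ (Fin d) → ℝ} (hf : Measurable f) :
    ∫ w, f (a • w.1 + b • w.2) •
        (a' • w.1 + b' • w.2 - ((a * a' + b * b') / v ^ 2) • (a • w.1 + b • w.2))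
        ∂((stdGaussian (EuclideanSpace ℝ (Fin d))).prod (stdGaussian (EuclideanSpace ℝ (Fin d))))
      = 0 := by
  rw [integral_gaussian_pair hv h (f := fun y => f y.1 • y.2)
    ((hf.comp measurable_fst).stronglyMeasurable.smul measurable_snd.stronglyMeasurable)]
  rw [integral_prod_smul (fun x => f (v • x))
    (fun y : EuclideanSpace ℝ (Fin d) => ((a * b' - b * a') / v) • y), integral_smul]
  have := integral_id_stdGaussian (E := EuclideanSpace ℝ (Fin d))
  rw [this, smul_zero, smul_zero]

end Posterior

/-! ### Integration against a mixture of two images of one measure. -/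

section TwoPointMixture

variable {Ω Ω' : Type*} [MeasurableSpace Ω] [MeasurableSpace Ω'] {p : ℝ}
  {F : Type*} [NormedAddCommGroup F]

theorem integrable_two_point_mixture {Q : Measure Ω} {Ψ₁ Ψ₂ : Ω → Ω'} (h₁ : Measurable Ψ₁)
    (h₂ : Measurable Ψ₂) {f : Ω' → F} (hf : StronglyMeasurable f)
    (hf₁ : Integrable (fun ω => f (Ψ₁ ω)) Q) (hf₂ : Integrable (fun ω => f (Ψ₂ ω)) Q) :
    Integrable f (ENNReal.ofReal p • Q.map Ψ₁ + ENNReal.ofReal (1 - p) • Q.map Ψ₂) := by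
  refine Integrable.add_measure (Integrable.smul_measure ?_ ENNReal.ofReal_ne_top)
    (Integrable.smul_measure ?_ ENNReal.ofReal_ne_top)
  · exact (integrable_map_measure hf.aestronglyMeasurable h₁.aemeasurable).2 hf₁
  · exact (integrable_map_measure hf.aestronglyMeasurable h₂.aemeasurable).2 hf₂

theorem integral_two_point_mixture [NormedSpace ℝ F] (hp : p ∈ Icc (0 : ℝ) 1) {Q : Measure Ω} {Ψ₁ Ψ₂ : Ω → Ω'}
    (h₁ : Measurable Ψ₁) (h₂ : Measurable Ψ₂) {f : Ω' → F} (hf : StronglyMeasurable f)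
    (hf₁ : Integrable (fun ω => f (Ψ₁ ω)) Q) (hf₂ : Integrable (fun ω => f (Ψ₂ ω)) Q) :
    ∫ ω, f ω ∂(ENNReal.ofReal p • Q.map Ψ₁ + ENNReal.ofReal (1 - p) • Q.map Ψ₂)
      = p • ∫ ω, f (Ψ₁ ω) ∂Q + (1 - p) • ∫ ω, f (Ψ₂ ω) ∂Q := by
  rw [integral_add_measure, integral_smul_measure, integral_smul_measure,
    integral_map h₁.aemeasurable hf.aestronglyMeasurable,
    integral_map h₂.aemeasurable hf.aestronglyMeasurable, ENNReal.toReal_ofReal hp.1,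
    ENNReal.toReal_ofReal (by linarith [hp.2])]
  · exact Integrable.smul_measure ((integrable_map_measure hf.aestronglyMeasurable
      h₁.aemeasurable).2 hf₁) ENNReal.ofReal_ne_top
  · exact Integrable.smul_measure ((integrable_map_measure hf.aestronglyMeasurable
      h₂.aemeasurable).2 hf₂) ENNReal.ofReal_ne_top

end TwoPointMixture

/-! ### Both modes as images of the same pair of independent Gaussian vectors. -/

section MixtureLaws

variable {d : ℕ} {p : ℝ}

theorem prod_gaussianMixture (ν : Measure (EuclideanSpace ℝ (Fin d))) [SFinite ν] (p : ℝ)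
    (r : EuclideanSpace ℝ (Fin d)) (σ : ℝ) :
    ν.prod (gaussianMixture p r σ)
      = ENNReal.ofReal p • (ν.prod (stdGaussian (EuclideanSpace ℝ (Fin d)))).map
            (fun w => (w.1, r + σ • w.2))
        + ENNReal.ofReal (1 - p) • (ν.prod (stdGaussian (EuclideanSpace ℝ (Fin d)))).map
            (fun w => (w.1, -r + σ • w.2)) := by
  have h : ∀ m : EuclideanSpace ℝ (Fin d), ν.prod (gaussianIso m σ)
      = (ν.prod (stdGaussian (EuclideanSpace ℝ (Fin d)))).map (fun w => (w.1, m + σ • w.2)) := by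
    intro m
    have := Measure.map_prod_map ν (stdGaussian (EuclideanSpace ℝ (Fin d)))
      measurable_id (g := fun g => m + σ • g) (by fun_prop)
    rw [Measure.map_id] at this
    exact this
  rw [gaussianMixture, Measure.prod_add, Measure.prod_smul_right, Measure.prod_smul_right, h, h]

theorem prod_labelledMixture (ν : Measure (EuclideanSpace ℝ (Fin d))) [SFinite ν] (p : ℝ)
    (r : EuclideanSpace ℝ (Fin d)) (σ : ℝ) :
    ν.prod (labelledMixture p r σ)
      = ENNReal.ofReal p • (ν.prod (stdGaussian (EuclideanSpace ℝ (Fin d)))).map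
            (fun w => (w.1, ((1 : ℝ), r + σ • w.2)))
        + ENNReal.ofReal (1 - p) • (ν.prod (stdGaussian (EuclideanSpace ℝ (Fin d)))).map
            (fun w => (w.1, ((-1 : ℝ), -r + σ • w.2))) := by
  have h : ∀ (s : ℝ) (m : EuclideanSpace ℝ (Fin d)),
      ν.prod ((Measure.dirac s).prod (gaussianIso m σ))
      = (ν.prod (stdGaussian (EuclideanSpace ℝ (Fin d)))).map
          (fun w => (w.1, (s, m + σ • w.2))) := by
    intro s m
    have := Measure.map_prod_map ν (stdGaussian (EuclideanSpace ℝ (Fin d)))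
      measurable_id (g := fun g => (s, m + σ • g)) (by fun_prop)
    rw [Measure.map_id] at this
    rw [Measure.dirac_prod, gaussianIso, Measure.map_map (by fun_prop) (by fun_prop)]
    exact this
  rw [labelledMixture, Measure.prod_add, Measure.prod_smul_right, Measure.prod_smul_right, h, h]

theorem ofReal_add_ofReal_one_sub (hp : p ∈ Icc (0 : ℝ) 1) :
    ENNReal.ofReal p + ENNReal.ofReal (1 - p) = 1 := by
  rw [← ENNReal.ofReal_add hp.1 (by linarith [hp.2])]
  simp

theorem isProbabilityMeasure_gaussianMixture (hp : p ∈ Icc (0 : ℝ) 1)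
    (r : EuclideanSpace ℝ (Fin d)) (σ : ℝ) : IsProbabilityMeasure (gaussianMixture p r σ) :=
  ⟨by simp [gaussianMixture, ofReal_add_ofReal_one_sub hp]⟩

theorem isProbabilityMeasure_labelledMixture (hp : p ∈ Icc (0 : ℝ) 1)
    (r : EuclideanSpace ℝ (Fin d)) (σ : ℝ) : IsProbabilityMeasure (labelledMixture p r σ) :=
  ⟨by simp [labelledMixture, ofReal_add_ofReal_one_sub hp]⟩

end MixtureLaws

/-! ### The conditional expectations of the velocity and of the mode. -/

section Velocity

variable {d : ℕ} {p : ℝ}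

theorem integrable_linear_comb_stdGaussian (a b : ℝ) :
    Integrable (fun w : EuclideanSpace ℝ (Fin d) × EuclideanSpace ℝ (Fin d) => a • w.1 + b • w.2)
      ((stdGaussian (EuclideanSpace ℝ (Fin d))).prod
        (stdGaussian (EuclideanSpace ℝ (Fin d)))) := by
  have h : Integrable (fun x : EuclideanSpace ℝ (Fin d) => x)
      (stdGaussian (EuclideanSpace ℝ (Fin d))) := IsGaussian.integrable_id
  exact ((h.comp_fst _).smul a).add ((h.comp_snd _).smul b)

theorem integrable_bounded_sign_defect (hp : p ∈ Icc (0 : ℝ) 1) {Ω : Type*} [MeasurableSpace Ω]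
    {Q : Measure Ω} [IsFiniteMeasure Q] {f u : Ω → ℝ} (hf : Measurable f) (hfb : ∀ ω, |f ω| ≤ 1)
    (hu : Measurable u) (s : ℝ) :
    Integrable (fun ω => f ω * (mixtureTanh p (u ω) - s)) Q := by
  have hT := (continuous_mixtureTanh hp).measurable
  refine Integrable.of_bound (Measurable.aestronglyMeasurable (by fun_prop)) (1 * (1 + |s|))
    (ae_of_all _ fun ω => ?_)
  rw [norm_mul, Real.norm_eq_abs, Real.norm_eq_abs]
  refine mul_le_mul (hfb ω) ?_ (abs_nonneg _) zero_le_one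
  exact (abs_sub _ _).trans (by linarith [abs_mixtureTanh_le_one hp (u ω)])

/-- The regression coefficient of the velocity `a' z + b' y` on the state `a z + b y`, when `z` is
standard Gaussian and `y` has variance `σ²` given its mode. -/
noncomputable def regressionCoeff (a b a' b' σ : ℝ) : ℝ :=
  (a * a' + (b * σ) * (b' * σ)) / (a ^ 2 + (b * σ) ^ 2)

/-- The conditional mean of `a' z + b' y` given `a z + b y`, when `z` is standard Gaussian and `y` is
a two-component Gaussian mixture. -/
noncomputable def mixtureRegression (p : ℝ) (r : EuclideanSpace ℝ (Fin d)) (a b a' b' σ : ℝ)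
    (x : EuclideanSpace ℝ (Fin d)) : EuclideanSpace ℝ (Fin d) :=
  regressionCoeff a b a' b' σ • x
    + ((b' - regressionCoeff a b a' b' σ * b)
        * mixtureTanh p (⟪b • r, x⟫ / (a ^ 2 + (b * σ) ^ 2))) • r

theorem continuous_mixtureRegression (hp : p ∈ Icc (0 : ℝ) 1) (r : EuclideanSpace ℝ (Fin d))
    (a b a' b' σ : ℝ) : Continuous (mixtureRegression p r a b a' b' σ) := by
  have hT := continuous_mixtureTanh hp
  unfold mixtureRegression
  fun_prop

theorem measurable_indicator_one {X : Type*} [MeasurableSpace X] {B : Set X}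
    (hB : MeasurableSet B) : Measurable (B.indicator (1 : X → ℝ)) :=
  measurable_one.indicator hB

theorem abs_indicator_one_le {X : Type*} (B : Set X) (x : X) :
    |B.indicator (1 : X → ℝ) x| ≤ 1 := by
  by_cases h : x ∈ B <;> simp [h]

/-- Given the mode s, the velocity minus A times the state is (b' − A b) s r plus a Gaussian
residual. Tested against an event of the state, the residual integrates to zero on each component.
Replacing s by its posterior mean leaves errors that cancel between the two components. -/
theorem mixtureRegression_ae_eq_condExp (hp : p ∈ Icc (0 : ℝ) 1) (r : EuclideanSpace ℝ (Fin d))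
    {a b σ : ℝ} (a' b' : ℝ) (hV : 0 < a ^ 2 + (b * σ) ^ 2) :
    (fun za : EuclideanSpace ℝ (Fin d) × EuclideanSpace ℝ (Fin d) =>
        mixtureRegression p r a b a' b' σ (a • za.1 + b • za.2))
      =ᵐ[(stdGaussian (EuclideanSpace ℝ (Fin d))).prod (gaussianMixture p r σ)]
    ((stdGaussian (EuclideanSpace ℝ (Fin d))).prod (gaussianMixture p r σ))[
      fun za => a' • za.1 + b' • za.2
      | MeasurableSpace.comap (fun za : EuclideanSpace ℝ (Fin d) × EuclideanSpace ℝ (Fin d) =>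
          a • za.1 + b • za.2) inferInstance] := by
  have hprob := isProbabilityMeasure_gaussianMixture hp r σ
  have hT := (continuous_mixtureTanh hp).measurable
  set ν := stdGaussian (EuclideanSpace ℝ (Fin d)) with hν
  set I : EuclideanSpace ℝ (Fin d) × EuclideanSpace ℝ (Fin d) → EuclideanSpace ℝ (Fin d) :=
    fun za => a • za.1 + b • za.2 with hI
  set J : EuclideanSpace ℝ (Fin d) × EuclideanSpace ℝ (Fin d) → EuclideanSpace ℝ (Fin d) :=
    fun za => a' • za.1 + b' • za.2 with hJ
  set A := regressionCoeff a b a' b' σ with hA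
  set v := √(a ^ 2 + (b * σ) ^ 2) with hvdef
  have hv : 0 < v := Real.sqrt_pos.2 hV
  have hv2 : v ^ 2 = a ^ 2 + (b * σ) ^ 2 := Real.sq_sqrt hV.le
  have hImeas : Measurable I := by fun_prop
  have hJmeas : Measurable J := by fun_prop
  have hbmeas : Measurable (mixtureRegression p r a b a' b' σ) :=
    (continuous_mixtureRegression hp r a b a' b' σ).measurable
  -- the defect of the regression, on each component of the mixture
  have hD : ∀ (s : ℝ) (w : EuclideanSpace ℝ (Fin d) × EuclideanSpace ℝ (Fin d)),
      mixtureRegression p r a b a' b' σ (I (w.1, s • r + σ • w.2)) - J (w.1, s • r + σ • w.2)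
      = ((b' - A * b) * (mixtureTanh p (⟪b • r, s • b • r + (a • w.1 + (b * σ) • w.2)⟫ / v ^ 2)
            - s)) • r
        - (a' • w.1 + (b' * σ) • w.2
            - ((a * a' + (b * σ) * (b' * σ)) / v ^ 2) • (a • w.1 + (b * σ) • w.2)) := by
    intro s w
    have e : I (w.1, s • r + σ • w.2) = s • b • r + (a • w.1 + (b * σ) • w.2) := by
      simp only [hI]; module
    rw [e, mixtureRegression, ← hA, hv2]
    change _ = _ - (_ - A • _)
    simp only [hJ]
    module
  have hres : Integrable (fun w : EuclideanSpace ℝ (Fin d) × EuclideanSpace ℝ (Fin d) =>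
      a' • w.1 + (b' * σ) • w.2
            - ((a * a' + (b * σ) * (b' * σ)) / v ^ 2) • (a • w.1 + (b * σ) • w.2))
      (ν.prod ν) :=
    (integrable_linear_comb_stdGaussian _ _).sub ((integrable_linear_comb_stdGaussian _ _).fun_smul _)
  have hcomp : ∀ (s : ℝ) (f : EuclideanSpace ℝ (Fin d) → ℝ), Measurable f → (∀ x, |f x| ≤ 1) →
      Integrable (fun w : EuclideanSpace ℝ (Fin d) × EuclideanSpace ℝ (Fin d) =>
        f (I (w.1, s • r + σ • w.2)) • (mixtureRegression p r a b a' b' σ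
          (I (w.1, s • r + σ • w.2)) - J (w.1, s • r + σ • w.2))) (ν.prod ν) ∧
      ∫ w, f (I (w.1, s • r + σ • w.2)) • (mixtureRegression p r a b a' b' σ
          (I (w.1, s • r + σ • w.2)) - J (w.1, s • r + σ • w.2)) ∂(ν.prod ν)
      = ((b' - A * b) * ∫ g, f (s • b • r + v • g)
          * (mixtureTanh p (⟪b • r, s • b • r + v • g⟫ / v ^ 2) - s) ∂ν) • r := by
    intro s f hf hfb
    have e : ∀ w : EuclideanSpace ℝ (Fin d) × EuclideanSpace ℝ (Fin d),
        I (w.1, s • r + σ • w.2) = s • b • r + (a • w.1 + (b * σ) • w.2) := by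
      intro w; simp only [hI]; module
    have i1 : Integrable (fun w : EuclideanSpace ℝ (Fin d) × EuclideanSpace ℝ (Fin d) =>
        f (s • b • r + (a • w.1 + (b * σ) • w.2))
          * (mixtureTanh p (⟪b • r, s • b • r + (a • w.1 + (b * σ) • w.2)⟫ / v ^ 2) - s))
        (ν.prod ν) :=
      integrable_bounded_sign_defect hp (by fun_prop) (fun _ => hfb _) (by fun_prop) s
    have i2 : Integrable (fun w : EuclideanSpace ℝ (Fin d) × EuclideanSpace ℝ (Fin d) =>
        f (s • b • r + (a • w.1 + (b * σ) • w.2)) • (a' • w.1 + (b' * σ) • w.2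
            - ((a * a' + (b * σ) * (b' * σ)) / v ^ 2) • (a • w.1 + (b * σ) • w.2)))
        (ν.prod ν) :=
      Integrable.bdd_smul (φ := fun w : EuclideanSpace ℝ (Fin d) × EuclideanSpace ℝ (Fin d) =>
        f (s • b • r + (a • w.1 + (b * σ) • w.2))) hres 1
        (Measurable.aestronglyMeasurable (by fun_prop)) (ae_of_all _ fun w => hfb _)
    have i1' := (i1.const_mul (b' - A * b)).smul_const r
    have hfun : (fun w : EuclideanSpace ℝ (Fin d) × EuclideanSpace ℝ (Fin d) =>
        f (I (w.1, s • r + σ • w.2)) • (mixtureRegression p r a b a' b' σ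
          (I (w.1, s • r + σ • w.2)) - J (w.1, s • r + σ • w.2)))
        = fun w => ((b' - A * b) * (f (s • b • r + (a • w.1 + (b * σ) • w.2))
          * (mixtureTanh p (⟪b • r, s • b • r + (a • w.1 + (b * σ) • w.2)⟫ / v ^ 2) - s))) • r
          - f (s • b • r + (a • w.1 + (b * σ) • w.2)) • (a' • w.1 + (b' * σ) • w.2
            - ((a * a' + (b * σ) * (b' * σ)) / v ^ 2) • (a • w.1 + (b * σ) • w.2)) := by
      ext1 w
      rw [hD, e, smul_sub, smul_smul]
      congr 2
      ring
    rw [hfun]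
    refine ⟨i1'.sub i2, ?_⟩
    rw [integral_sub i1' i2, integral_smul_const, integral_const_mul,
      setIntegral_gaussian_residual hv hv2.symm (f := fun y => f (s • b • r + y)) (by fun_prop),
      sub_zero, integral_gaussian_comb hv hv2.symm (f := fun y => f (s • b • r + y)
        * (mixtureTanh p (⟪b • r, s • b • r + y⟫ / v ^ 2) - s))
        (Measurable.stronglyMeasurable (by fun_prop))]
  have hΨ₁ : Measurable fun w : EuclideanSpace ℝ (Fin d) × EuclideanSpace ℝ (Fin d) =>
      (w.1, (1 : ℝ) • r + σ • w.2) := by fun_prop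
  have hΨ₂ : Measurable fun w : EuclideanSpace ℝ (Fin d) × EuclideanSpace ℝ (Fin d) =>
      (w.1, (-1 : ℝ) • r + σ • w.2) := by fun_prop
  have hP := prod_gaussianMixture ν p r σ
  rw [← neg_one_smul ℝ r] at hP
  nth_rewrite 2 [← one_smul ℝ r] at hP
  have hmain : ∀ f : EuclideanSpace ℝ (Fin d) → ℝ, Measurable f → (∀ x, |f x| ≤ 1) →
      Integrable (fun za => f (I za) • (mixtureRegression p r a b a' b' σ (I za) - J za))
        (ν.prod (gaussianMixture p r σ)) ∧
      ∫ za, f (I za) • (mixtureRegression p r a b a' b' σ (I za) - J za)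
        ∂(ν.prod (gaussianMixture p r σ)) = 0 := by
    intro f hf hfb
    have hsm : StronglyMeasurable
        fun za => f (I za) • (mixtureRegression p r a b a' b' σ (I za) - J za) :=
      Measurable.stronglyMeasurable (by fun_prop)
    have c1 := hcomp 1 f hf hfb
    have c2 := hcomp (-1) f hf hfb
    rw [hP]
    refine ⟨integrable_two_point_mixture hΨ₁ hΨ₂ hsm c1.1 c2.1, ?_⟩
    rw [integral_two_point_mixture hp hΨ₁ hΨ₂ hsm c1.1 c2.1, c1.2, c2.2]
    have hb := weighted_integral_sign_sub_mixtureTanh hp (b • r) hv.ne' hf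
    rw [one_smul ℝ (b • r), neg_one_smul ℝ (b • r), smul_smul, smul_smul, ← add_smul]
    convert zero_smul ℝ r using 2
    linear_combination (b' - A * b) * hb
  have hJint : Integrable J (ν.prod (gaussianMixture p r σ)) := by
    rw [hP]
    have : ∀ s : ℝ, Integrable (fun w : EuclideanSpace ℝ (Fin d) × EuclideanSpace ℝ (Fin d) =>
        J (w.1, s • r + σ • w.2)) (ν.prod ν) := by
      intro s
      have h := (integrable_const (μ := ν.prod ν) (b' • s • r)).add
        (integrable_linear_comb_stdGaussian (d := d) a' (b' * σ))
      refine h.congr (ae_of_all _ fun w => ?_)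
      simp only [hJ, Pi.add_apply]
      module
    exact integrable_two_point_mixture hΨ₁ hΨ₂ hJmeas.stronglyMeasurable (this 1) (this (-1))
  have hbint : Integrable (fun za => mixtureRegression p r a b a' b' σ (I za))
      (ν.prod (gaussianMixture p r σ)) := by
    -- Integrability of the regression comes from that of its defect, with the constant test
    -- function, and of the velocity.
    have := (hmain (fun _ => 1) measurable_const (fun _ => by simp)).1.add hJint
    refine this.congr (ae_of_all _ fun za => ?_)
    simp
  have hm : MeasurableSpace.comap I inferInstance ≤ (inferInstance : MeasurableSpace
      (EuclideanSpace ℝ (Fin d) × EuclideanSpace ℝ (Fin d))) := hImeas.comap_le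
  refine ae_eq_condExp_of_forall_setIntegral_eq hm hJint (fun s _ _ => hbint.integrableOn) ?_ ?_
  · rintro _ ⟨B, hB, rfl⟩ -
    rw [← sub_eq_zero, ← integral_sub hbint.integrableOn hJint.integrableOn,
      ← integral_indicator (hImeas hB)]
    rw [← (hmain _ (measurable_indicator_one hB) (abs_indicator_one_le B)).2]
    congr 1
    ext1 za
    by_cases h : I za ∈ B
    · simp [h]
    · simp [h]
  · exact (hbmeas.comp (comap_measurable I)).stronglyMeasurable.aestronglyMeasurable

/-- The posterior mean of the mode given the interpolant. -/
theorem mixtureTanh_ae_eq_condExp (hp : p ∈ Icc (0 : ℝ) 1) (r : EuclideanSpace ℝ (Fin d))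
    {a b σ : ℝ} (hV : 0 < a ^ 2 + (b * σ) ^ 2) :
    (fun ω : EuclideanSpace ℝ (Fin d) × (ℝ × EuclideanSpace ℝ (Fin d)) =>
        mixtureTanh p (⟪b • r, a • ω.1 + b • ω.2.2⟫ / (a ^ 2 + (b * σ) ^ 2)))
      =ᵐ[(stdGaussian (EuclideanSpace ℝ (Fin d))).prod (labelledMixture p r σ)]
    ((stdGaussian (EuclideanSpace ℝ (Fin d))).prod (labelledMixture p r σ))[
      fun ω => ω.2.1
      | MeasurableSpace.comap (fun ω : EuclideanSpace ℝ (Fin d) × (ℝ × EuclideanSpace ℝ (Fin d)) =>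
          a • ω.1 + b • ω.2.2) inferInstance] := by
  have hprob := isProbabilityMeasure_labelledMixture hp r σ
  have hT := (continuous_mixtureTanh hp).measurable
  set ν := stdGaussian (EuclideanSpace ℝ (Fin d)) with hν
  set I : EuclideanSpace ℝ (Fin d) × (ℝ × EuclideanSpace ℝ (Fin d)) → EuclideanSpace ℝ (Fin d) :=
    fun ω => a • ω.1 + b • ω.2.2 with hI
  set v := √(a ^ 2 + (b * σ) ^ 2) with hvdef
  have hv : 0 < v := Real.sqrt_pos.2 hV
  have hv2 : v ^ 2 = a ^ 2 + (b * σ) ^ 2 := Real.sq_sqrt hV.le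
  have hImeas : Measurable I := by fun_prop
  rw [← hv2]
  have e : ∀ (s : ℝ) (w : EuclideanSpace ℝ (Fin d) × EuclideanSpace ℝ (Fin d)),
      I (w.1, (s, s • r + σ • w.2)) = s • b • r + (a • w.1 + (b * σ) • w.2) := by
    intro s w; simp only [hI]; module
  have hcomp : ∀ (s : ℝ) (f : EuclideanSpace ℝ (Fin d) → ℝ), Measurable f → (∀ x, |f x| ≤ 1) →
      Integrable (fun w : EuclideanSpace ℝ (Fin d) × EuclideanSpace ℝ (Fin d) =>
        f (I (w.1, (s, s • r + σ • w.2)))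
          * (mixtureTanh p (⟪b • r, I (w.1, (s, s • r + σ • w.2))⟫ / v ^ 2) - s)) (ν.prod ν) ∧
      ∫ w, f (I (w.1, (s, s • r + σ • w.2)))
          * (mixtureTanh p (⟪b • r, I (w.1, (s, s • r + σ • w.2))⟫ / v ^ 2) - s) ∂(ν.prod ν)
      = ∫ g, f (s • b • r + v • g)
          * (mixtureTanh p (⟪b • r, s • b • r + v • g⟫ / v ^ 2) - s) ∂ν := by
    intro s f hf hfb
    simp_rw [e]
    refine ⟨integrable_bounded_sign_defect hp (by fun_prop) (fun _ => hfb _) (by fun_prop) s, ?_⟩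
    rw [integral_gaussian_comb hv hv2.symm (f := fun y => f (s • b • r + y)
        * (mixtureTanh p (⟪b • r, s • b • r + y⟫ / v ^ 2) - s))
        (Measurable.stronglyMeasurable (by fun_prop))]
  have hΨ₁ : Measurable fun w : EuclideanSpace ℝ (Fin d) × EuclideanSpace ℝ (Fin d) =>
      (w.1, ((1 : ℝ), (1 : ℝ) • r + σ • w.2)) := by fun_prop
  have hΨ₂ : Measurable fun w : EuclideanSpace ℝ (Fin d) × EuclideanSpace ℝ (Fin d) =>
      (w.1, ((-1 : ℝ), (-1 : ℝ) • r + σ • w.2)) := by fun_prop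
  have hP := prod_labelledMixture ν p r σ
  rw [← neg_one_smul ℝ r] at hP
  nth_rewrite 2 [← one_smul ℝ r] at hP
  have hmain : ∀ f : EuclideanSpace ℝ (Fin d) → ℝ, Measurable f → (∀ x, |f x| ≤ 1) →
      ∫ ω, f (I ω) * (mixtureTanh p (⟪b • r, I ω⟫ / v ^ 2) - ω.2.1)
        ∂(ν.prod (labelledMixture p r σ)) = 0 := by
    intro f hf hfb
    have hsm : StronglyMeasurable
        fun ω => f (I ω) * (mixtureTanh p (⟪b • r, I ω⟫ / v ^ 2) - ω.2.1) :=
      Measurable.stronglyMeasurable (by fun_prop)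
    have c1 := hcomp 1 f hf hfb
    have c2 := hcomp (-1) f hf hfb
    rw [hP, integral_two_point_mixture hp hΨ₁ hΨ₂ hsm c1.1 c2.1, c1.2, c2.2]
    have hb := weighted_integral_sign_sub_mixtureTanh hp (b • r) hv.ne' hf
    rw [one_smul ℝ (b • r), neg_one_smul ℝ (b • r)]
    exact hb
  have hsint : Integrable (fun ω : EuclideanSpace ℝ (Fin d) × (ℝ × EuclideanSpace ℝ (Fin d)) =>
      ω.2.1) (ν.prod (labelledMixture p r σ)) := by
    rw [hP]
    exact integrable_two_point_mixture hΨ₁ hΨ₂ (Measurable.stronglyMeasurable (by fun_prop))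
      (integrable_const _) (integrable_const _)
  have hbint : Integrable (fun ω => mixtureTanh p (⟪b • r, I ω⟫ / v ^ 2))
      (ν.prod (labelledMixture p r σ)) :=
    Integrable.of_bound (Measurable.aestronglyMeasurable (by fun_prop)) 1
      (ae_of_all _ fun ω => abs_mixtureTanh_le_one hp _)
  have hm : MeasurableSpace.comap I inferInstance ≤ (inferInstance : MeasurableSpace
      (EuclideanSpace ℝ (Fin d) × (ℝ × EuclideanSpace ℝ (Fin d)))) := hImeas.comap_le
  refine ae_eq_condExp_of_forall_setIntegral_eq hm hsint (fun s _ _ => hbint.integrableOn) ?_ ?_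
  · rintro _ ⟨B, hB, rfl⟩ -
    rw [← sub_eq_zero, ← integral_sub hbint.integrableOn hsint.integrableOn,
      ← integral_indicator (hImeas hB)]
    rw [← hmain _ (measurable_indicator_one hB) (abs_indicator_one_le B)]
    congr 1
    ext1 ω
    by_cases h : I ω ∈ B
    · simp [h]
    · simp [h]
  · have hb : Measurable fun x : EuclideanSpace ℝ (Fin d) =>
        mixtureTanh p (⟪b • r, x⟫ / v ^ 2) := by fun_prop
    exact (hb.comp (comap_measurable I)).stronglyMeasurable.aestronglyMeasurable

end Velocity

/-- A schedule of an interpolant: `α` decreases from `1` to `0` and `β` increases from `0` to `1`. -/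
structure IsSchedule (α β : ℝ → ℝ) : Prop where
  contDiffOn_fst : ContDiffOn ℝ 2 α (Icc 0 1)
  contDiffOn_snd : ContDiffOn ℝ 2 β (Icc 0 1)
  fst_zero : α 0 = 1
  fst_one : α 1 = 0
  snd_zero : β 0 = 0
  snd_one : β 1 = 1
  timeDeriv_fst_neg : ∀ τ ∈ Icc (0 : ℝ) 1, timeDeriv α τ < 0
  timeDeriv_snd_pos : ∀ τ ∈ Icc (0 : ℝ) 1, 0 < timeDeriv β τ

theorem hasDerivWithinAt_timeDeriv {f : ℝ → ℝ} (hf : ContDiffOn ℝ 2 f (Icc 0 1)) {τ : ℝ}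
    (hτ : τ ∈ Icc (0 : ℝ) 1) : HasDerivWithinAt f (timeDeriv f τ) (Icc 0 1) τ :=
  ((hf.differentiableOn (by norm_num)) τ hτ).hasDerivWithinAt

theorem continuousOn_timeDeriv {f : ℝ → ℝ} (hf : ContDiffOn ℝ 2 f (Icc 0 1)) :
    ContinuousOn (timeDeriv f) (Icc 0 1) :=
  hf.continuousOn_derivWithin (uniqueDiffOn_Icc zero_lt_one) (by norm_num)

theorem deriv_eq_timeDeriv {f : ℝ → ℝ} {τ : ℝ} (hτ : τ ∈ Ioo (0 : ℝ) 1) :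
    deriv f τ = timeDeriv f τ :=
  (derivWithin_of_mem_nhds (Icc_mem_nhds hτ.1 hτ.2)).symm

/-! ### Elementary properties of schedules. -/

namespace IsSchedule

variable {α β : ℝ → ℝ}

theorem strictAntiOn (h : IsSchedule α β) : StrictAntiOn α (Icc 0 1) := by
  refine strictAntiOn_of_deriv_neg (convex_Icc 0 1) h.contDiffOn_fst.continuousOn fun x hx => ?_
  rw [interior_Icc] at hx
  rw [deriv_eq_timeDeriv hx]
  exact h.timeDeriv_fst_neg x (Ioo_subset_Icc_self hx)

theorem strictMonoOn (h : IsSchedule α β) : StrictMonoOn β (Icc 0 1) := by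
  refine strictMonoOn_of_deriv_pos (convex_Icc 0 1) h.contDiffOn_snd.continuousOn fun x hx => ?_
  rw [interior_Icc] at hx
  rw [deriv_eq_timeDeriv hx]
  exact h.timeDeriv_snd_pos x (Ioo_subset_Icc_self hx)

theorem fst_pos (h : IsSchedule α β) {τ : ℝ} (hτ : τ ∈ Ico (0 : ℝ) 1) : 0 < α τ := by
  rw [← h.fst_one]
  exact h.strictAntiOn (Ico_subset_Icc_self hτ) (by simp) hτ.2

theorem fst_nonneg (h : IsSchedule α β) {τ : ℝ} (hτ : τ ∈ Icc (0 : ℝ) 1) : 0 ≤ α τ := by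
  rw [← h.fst_one]
  exact h.strictAntiOn.antitoneOn hτ (by simp) hτ.2

theorem snd_pos (h : IsSchedule α β) {τ : ℝ} (hτ : τ ∈ Ioc (0 : ℝ) 1) : 0 < β τ := by
  rw [← h.snd_zero]
  exact h.strictMonoOn (by simp) (Ioc_subset_Icc_self hτ) hτ.1

theorem snd_nonneg (h : IsSchedule α β) {τ : ℝ} (hτ : τ ∈ Icc (0 : ℝ) 1) : 0 ≤ β τ := by
  rw [← h.snd_zero]
  exact h.strictMonoOn.monotoneOn (by simp) hτ hτ.1

theorem snd_le_one (h : IsSchedule α β) {τ : ℝ} (hτ : τ ∈ Icc (0 : ℝ) 1) : β τ ≤ 1 := by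
  rw [← h.snd_one]
  exact h.strictMonoOn.monotoneOn hτ (by simp) hτ.2

theorem var_pos (h : IsSchedule α β) {q : ℝ} (hq : 0 < q) {τ : ℝ} (hτ : τ ∈ Icc (0 : ℝ) 1) :
    0 < α τ ^ 2 + q * β τ ^ 2 := by
  rcases hτ.1.eq_or_lt with rfl | h0
  · rw [h.fst_zero, h.snd_zero]; norm_num
  · have := h.snd_pos ⟨h0, hτ.2⟩
    positivity

theorem timeDeriv_interpolant (h : IsSchedule α β) {d : ℕ} (c : ℝ) {τ : ℝ}
    (hτ : τ ∈ Icc (0 : ℝ) 1) (za : EuclideanSpace ℝ (Fin d) × EuclideanSpace ℝ (Fin d)) :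
    timeDeriv (fun t => interpolant c α β t za) τ
      = (c * timeDeriv α τ) • za.1 + timeDeriv β τ • za.2 := by
  have h1 := ((hasDerivWithinAt_timeDeriv h.contDiffOn_fst hτ).const_mul c).smul_const za.1
  have h2 := (hasDerivWithinAt_timeDeriv h.contDiffOn_snd hτ).smul_const za.2
  exact (h1.add h2).derivWithin (uniqueDiffOn_Icc zero_lt_one τ hτ)

end IsSchedule

/-! ### Existence and uniqueness of the continuous velocity field. -/

section FlowVelocity

variable {d : ℕ} {p : ℝ} {α β : ℝ → ℝ}

/-- On a component of positive weight the state is a continuous surjective function of two Gaussian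
vectors with full support. -/
theorem eq_of_comp_interpolant_ae_eq (hp : p ∈ Icc (0 : ℝ) 1) {r : EuclideanSpace ℝ (Fin d)}
    {a b σ : ℝ} (hV : 0 < a ^ 2 + (b * σ) ^ 2)
    {f g : EuclideanSpace ℝ (Fin d) → EuclideanSpace ℝ (Fin d)} (hf : Continuous f)
    (hg : Continuous g)
    (h : (fun za : EuclideanSpace ℝ (Fin d) × EuclideanSpace ℝ (Fin d) => f (a • za.1 + b • za.2))
      =ᵐ[(stdGaussian (EuclideanSpace ℝ (Fin d))).prod (gaussianMixture p r σ)]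
        fun za => g (a • za.1 + b • za.2)) : f = g := by
  have hν := isOpenPosMeasure_stdGaussian d
  rw [prod_gaussianMixture] at h
  have key : ∀ (m : EuclideanSpace ℝ (Fin d)),
      (fun za : EuclideanSpace ℝ (Fin d) × EuclideanSpace ℝ (Fin d) => f (a • za.1 + b • za.2))
      =ᵐ[((stdGaussian (EuclideanSpace ℝ (Fin d))).prod
          (stdGaussian (EuclideanSpace ℝ (Fin d)))).map (fun w => (w.1, m + σ • w.2))]
        (fun za => g (a • za.1 + b • za.2)) → f = g := by
    intro m hm
    have h1 := ae_of_ae_map (Measurable.aemeasurable (by fun_prop)) hm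
    have h2 := Continuous.ae_eq_iff_eq ((stdGaussian (EuclideanSpace ℝ (Fin d))).prod
      (stdGaussian (EuclideanSpace ℝ (Fin d)))) (f := fun w => f (a • w.1 + b • (m + σ • w.2)))
      (g := fun w => g (a • w.1 + b • (m + σ • w.2))) (by fun_prop) (by fun_prop)
    have h3 := h2.1 h1
    ext1 y
    -- The chosen noise is the least-norm solution (z, g) of a z + bσ g = y − b m. It exists even if
    -- one of the two coefficients vanishes, as happens at the end times.
    have h4 := congrFun h3 ((a / (a ^ 2 + (b * σ) ^ 2)) • (y - b • m),
      (b * σ / (a ^ 2 + (b * σ) ^ 2)) • (y - b • m))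
    have e : a • (a / (a ^ 2 + (b * σ) ^ 2)) • (y - b • m)
        + b • (m + σ • (b * σ / (a ^ 2 + (b * σ) ^ 2)) • (y - b • m)) = y := by
      have : a * (a / (a ^ 2 + (b * σ) ^ 2)) + b * (σ * (b * σ / (a ^ 2 + (b * σ) ^ 2))) = 1 := by
        calc _ = (a ^ 2 + (b * σ) ^ 2) / (a ^ 2 + (b * σ) ^ 2) := by ring
          _ = 1 := div_self hV.ne'
      calc _ = (a * (a / (a ^ 2 + (b * σ) ^ 2)) + b * (σ * (b * σ / (a ^ 2 + (b * σ) ^ 2))))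
            • (y - b • m) + b • m := by module
        _ = y := by rw [this]; module
    simpa only [e] using h4
  rw [Filter.EventuallyEq, ae_add_measure_iff] at h
  -- One component of positive weight suffices; the second is needed only when p = 0.
  rcases hp.1.eq_or_lt with h0 | h0
  · refine key _ ((Measure.ae_ennreal_smul_measure_iff ?_).1 h.2)
    simp [← h0]
  · refine key _ ((Measure.ae_ennreal_smul_measure_iff ?_).1 h.1)
    simpa using h0

/-- The explicit velocity field of the interpolant towards a two-component mixture. -/
noncomputable def mixtureVelocity (p : ℝ) (r : EuclideanSpace ℝ (Fin d)) (c : ℝ) (α β : ℝ → ℝ)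
    (σ τ : ℝ) : EuclideanSpace ℝ (Fin d) → EuclideanSpace ℝ (Fin d) :=
  mixtureRegression p r (c * α τ) (β τ) (c * timeDeriv α τ) (timeDeriv β τ) σ

theorem IsSchedule.state_var_pos (h : IsSchedule α β) {c σ : ℝ} (hc : 0 < c) (hσ : 0 < σ) {τ : ℝ}
    (hτ : τ ∈ Icc (0 : ℝ) 1) : 0 < (c * α τ) ^ 2 + (β τ * σ) ^ 2 := by
  have h1 := h.var_pos (q := σ ^ 2 / c ^ 2) (by positivity) hτ
  have : (c * α τ) ^ 2 + (β τ * σ) ^ 2 = c ^ 2 * (α τ ^ 2 + σ ^ 2 / c ^ 2 * β τ ^ 2) := by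
    field_simp
  rw [this]
  positivity

theorem isProbabilityFlowVelocity_mixtureVelocity (h : IsSchedule α β) (hp : p ∈ Icc (0 : ℝ) 1)
    (r : EuclideanSpace ℝ (Fin d)) {c σ : ℝ} (hc : 0 < c) (hσ : 0 < σ) :
    IsProbabilityFlowVelocity c α β (gaussianMixture p r σ) (mixtureVelocity p r c α β σ) := by
  intro τ hτ
  refine ⟨continuous_mixtureRegression hp r _ _ _ _ _, ?_⟩
  simp_rw [h.timeDeriv_interpolant c hτ]
  exact mixtureRegression_ae_eq_condExp hp r _ _ (h.state_var_pos hc hσ hτ)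

theorem IsProbabilityFlowVelocity.eq_mixtureVelocity (h : IsSchedule α β)
    (hp : p ∈ Icc (0 : ℝ) 1) {r : EuclideanSpace ℝ (Fin d)} {c σ : ℝ} (hc : 0 < c) (hσ : 0 < σ)
    {b : ℝ → EuclideanSpace ℝ (Fin d) → EuclideanSpace ℝ (Fin d)}
    (hb : IsProbabilityFlowVelocity c α β (gaussianMixture p r σ) b) {τ : ℝ}
    (hτ : τ ∈ Icc (0 : ℝ) 1) : b τ = mixtureVelocity p r c α β σ τ := by
  have h1 := hb τ hτ
  have h2 := isProbabilityFlowVelocity_mixtureVelocity h hp r hc hσ τ hτ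
  exact eq_of_comp_interpolant_ae_eq hp (h.state_var_pos hc hσ hτ) h1.1 h2.1
    (h1.2.trans h2.2.symm)

/-- This covers dimension 0, where the noise scale √d vanishes and the explicit formula is not
available. -/
theorem exists_isProbabilityFlowVelocity_of_subsingleton
    [Subsingleton (EuclideanSpace ℝ (Fin d))] (c : ℝ) (α β : ℝ → ℝ)
    (μ : Measure (EuclideanSpace ℝ (Fin d))) :
    ∃ b, IsProbabilityFlowVelocity c α β μ b :=
  ⟨fun _ _ => 0, fun _ _ => ⟨continuous_const, ae_of_all _ fun _ => Subsingleton.elim _ _⟩⟩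

end FlowVelocity

/-! ### Decoupling of the Euler scheme into magnetization and orthogonal part. -/

section Drift

/-- The contraction rate orthogonally to the modes; `q` is the variance of a mode relative to the
squared distance of the modes. -/
noncomputable def orthRate (α β : ℝ → ℝ) (q τ : ℝ) : ℝ :=
  (α τ * timeDeriv α τ + q * (β τ * timeDeriv β τ)) / (α τ ^ 2 + q * β τ ^ 2)

/-- The velocity of the magnetization. -/
noncomputable def magDrift (α β T : ℝ → ℝ) (q τ m : ℝ) : ℝ :=
  orthRate α β q τ * m
    + (timeDeriv β τ - orthRate α β q τ * β τ) * T (β τ * m / (α τ ^ 2 + q * β τ ^ 2))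

/-- The Euler scheme on the line, at grid points. -/
noncomputable def scalarEulerGrid (w : ℝ → ℝ → ℝ) (N : ℕ) : ℕ → ℝ → ℝ
  | 0, m => m
  | k + 1, m => scalarEulerGrid w N k m + (1 / (N : ℝ)) * w ((k : ℝ) / N) (scalarEulerGrid w N k m)

/-- The Euler scheme on the line, at an arbitrary time. -/
noncomputable def scalarEulerPath (w : ℝ → ℝ → ℝ) (N : ℕ) (τ m : ℝ) : ℝ :=
  scalarEulerGrid w N ⌊τ * N⌋₊ m
    + (τ - (⌊τ * N⌋₊ : ℝ) / N) * w ((⌊τ * N⌋₊ : ℝ) / N) (scalarEulerGrid w N ⌊τ * N⌋₊ m)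

variable {d : ℕ} {p : ℝ} {α β : ℝ → ℝ}

/-- With noise of variance d, a factor d cancels between covariance and variance, and only σ²/d
remains. The same scaling in the argument of the posterior mean makes the limit equation free of d.
-/
theorem orthRate_eq_regressionCoeff (hd : 1 ≤ d) (α β : ℝ → ℝ) (σ τ : ℝ) :
    regressionCoeff (√(d : ℝ) * α τ) (β τ) (√(d : ℝ) * timeDeriv α τ) (timeDeriv β τ) σ
      = orthRate α β (σ ^ 2 / d) τ := by
  have hd0 : (0 : ℝ) < d := by exact_mod_cast hd
  have hs := Real.sq_sqrt hd0.le
  have e1 : √(d : ℝ) * α τ * (√(d : ℝ) * timeDeriv α τ) + (β τ * σ) * (timeDeriv β τ * σ)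
      = d * (α τ * timeDeriv α τ + σ ^ 2 / d * (β τ * timeDeriv β τ)) := by
    field_simp
    linear_combination (α τ * timeDeriv α τ) * hs
  have e2 : (√(d : ℝ) * α τ) ^ 2 + (β τ * σ) ^ 2 = d * (α τ ^ 2 + σ ^ 2 / d * β τ ^ 2) := by
    field_simp
    linear_combination (α τ ^ 2) * hs
  rw [regressionCoeff, orthRate, e1, e2, mul_div_mul_left _ _ hd0.ne']

theorem mixtureVelocity_eq (hd : 1 ≤ d) (p : ℝ) (r : EuclideanSpace ℝ (Fin d)) (α β : ℝ → ℝ)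
    (σ τ : ℝ) (x : EuclideanSpace ℝ (Fin d)) :
    mixtureVelocity p r (√d) α β σ τ x
      = orthRate α β (σ ^ 2 / d) τ • x
        + ((timeDeriv β τ - orthRate α β (σ ^ 2 / d) τ * β τ)
          * mixtureTanh p (β τ * magnetization r x / (α τ ^ 2 + σ ^ 2 / d * β τ ^ 2))) • r := by
  have hd0 : (0 : ℝ) < d := by exact_mod_cast hd
  have hs := Real.sq_sqrt hd0.le
  have e2 : (√(d : ℝ) * α τ) ^ 2 + (β τ * σ) ^ 2 = d * (α τ ^ 2 + σ ^ 2 / d * β τ ^ 2) := by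
    field_simp
    linear_combination (α τ ^ 2) * hs
  rw [mixtureVelocity, mixtureRegression, orthRate_eq_regressionCoeff hd, e2, magnetization,
    real_inner_smul_left, ← mul_div_assoc, div_div]

theorem magnetization_add (r x y : EuclideanSpace ℝ (Fin d)) :
    magnetization r (x + y) = magnetization r x + magnetization r y := by
  simp [magnetization, inner_add_right, add_div]

theorem magnetization_smul (r : EuclideanSpace ℝ (Fin d)) (c : ℝ) (x : EuclideanSpace ℝ (Fin d)) :
    magnetization r (c • x) = c * magnetization r x := by
  simp [magnetization, real_inner_smul_right, mul_div_assoc]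

theorem magnetization_self (hd : 1 ≤ d) {r : EuclideanSpace ℝ (Fin d)} (hr : ‖r‖ ^ 2 = d) :
    magnetization r r = 1 := by
  have hd0 : (d : ℝ) ≠ 0 := by exact_mod_cast (by omega : d ≠ 0)
  rw [magnetization, real_inner_self_eq_norm_sq, hr, div_self hd0]

theorem continuous_magnetization (r : EuclideanSpace ℝ (Fin d)) :
    Continuous (magnetization r) := by
  unfold magnetization; fun_prop

theorem orthPart_add (r x y : EuclideanSpace ℝ (Fin d)) :
    orthPart r (x + y) = orthPart r x + orthPart r y := by
  simp only [orthPart, magnetization_add]; module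

theorem orthPart_smul (r : EuclideanSpace ℝ (Fin d)) (c : ℝ) (x : EuclideanSpace ℝ (Fin d)) :
    orthPart r (c • x) = c • orthPart r x := by
  simp only [orthPart, magnetization_smul]; module

theorem orthPart_self (hd : 1 ≤ d) {r : EuclideanSpace ℝ (Fin d)} (hr : ‖r‖ ^ 2 = d) :
    orthPart r r = 0 := by
  rw [orthPart, magnetization_self hd hr, one_smul, sub_self]

/-- The velocity is a combination of x and r whose coefficients depend on x only through r·x, so the
magnetization evolves on its own. -/
theorem magnetization_mixtureVelocity (hd : 1 ≤ d) {r : EuclideanSpace ℝ (Fin d)}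
    (hr : ‖r‖ ^ 2 = d) (p : ℝ) (α β : ℝ → ℝ) (σ τ : ℝ) (x : EuclideanSpace ℝ (Fin d)) :
    magnetization r (mixtureVelocity p r (√d) α β σ τ x)
      = magDrift α β (mixtureTanh p) (σ ^ 2 / d) τ (magnetization r x) := by
  rw [mixtureVelocity_eq hd, magnetization_add, magnetization_smul, magnetization_smul,
    magnetization_self hd hr, mul_one, magDrift]

theorem orthPart_mixtureVelocity (hd : 1 ≤ d) {r : EuclideanSpace ℝ (Fin d)}
    (hr : ‖r‖ ^ 2 = d) (p : ℝ) (α β : ℝ → ℝ) (σ τ : ℝ) (x : EuclideanSpace ℝ (Fin d)) :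
    orthPart r (mixtureVelocity p r (√d) α β σ τ x)
      = orthRate α β (σ ^ 2 / d) τ • orthPart r x := by
  rw [mixtureVelocity_eq hd, orthPart_add, orthPart_smul, orthPart_smul, orthPart_self hd hr,
    smul_zero, add_zero]

theorem natCast_div_mem_Icc {k N : ℕ} (hk : k ≤ N) : (k : ℝ) / N ∈ Icc (0 : ℝ) 1 :=
  ⟨by positivity, div_le_one_of_le₀ (by exact_mod_cast hk) (by positivity)⟩

theorem floor_mul_le {N : ℕ} {τ : ℝ} (hτ : τ ≤ 1) : ⌊τ * N⌋₊ ≤ N := by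
  refine Nat.floor_le_of_le ?_
  nlinarith [(Nat.cast_nonneg N : (0 : ℝ) ≤ N)]

theorem magnetization_eulerGrid (hd : 1 ≤ d) {r : EuclideanSpace ℝ (Fin d)} (hr : ‖r‖ ^ 2 = d)
    {σ : ℝ} {b : ℝ → EuclideanSpace ℝ (Fin d) → EuclideanSpace ℝ (Fin d)}
    (hb : ∀ τ ∈ Icc (0 : ℝ) 1, b τ = mixtureVelocity p r (√d) α β σ τ) (N : ℕ)
    (x : EuclideanSpace ℝ (Fin d)) {k : ℕ} (hk : k ≤ N) :
    magnetization r (eulerGrid b N k x)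
      = scalarEulerGrid (magDrift α β (mixtureTanh p) (σ ^ 2 / d)) N k (magnetization r x) := by
  induction k with
  | zero => rfl
  | succ k ih =>
    rw [eulerGrid, scalarEulerGrid, magnetization_add, magnetization_smul,
      hb _ (natCast_div_mem_Icc (by omega)), magnetization_mixtureVelocity hd hr, ih (by omega)]

theorem magnetization_eulerPath (hd : 1 ≤ d) {r : EuclideanSpace ℝ (Fin d)} (hr : ‖r‖ ^ 2 = d)
    {σ : ℝ} {b : ℝ → EuclideanSpace ℝ (Fin d) → EuclideanSpace ℝ (Fin d)}
    (hb : ∀ τ ∈ Icc (0 : ℝ) 1, b τ = mixtureVelocity p r (√d) α β σ τ) (N : ℕ)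
    {τ : ℝ} (hτ : τ ∈ Icc (0 : ℝ) 1) (x : EuclideanSpace ℝ (Fin d)) :
    magnetization r (eulerPath b N τ x)
      = scalarEulerPath (magDrift α β (mixtureTanh p) (σ ^ 2 / d)) N τ (magnetization r x) := by
  rw [eulerPath, scalarEulerPath, magnetization_add, magnetization_smul,
    hb _ (natCast_div_mem_Icc (floor_mul_le hτ.2)), magnetization_mixtureVelocity hd hr,
    magnetization_eulerGrid hd hr hb N x (floor_mul_le hτ.2)]

theorem eulerPath_natCast_div {N : ℕ} (hN : 1 ≤ N)
    (b : ℝ → EuclideanSpace ℝ (Fin d) → EuclideanSpace ℝ (Fin d)) (k : ℕ)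
    (x : EuclideanSpace ℝ (Fin d)) : eulerPath b N ((k : ℝ) / N) x = eulerGrid b N k x := by
  have hN0 : (N : ℝ) ≠ 0 := by exact_mod_cast (by omega : N ≠ 0)
  rw [eulerPath, div_mul_cancel₀ _ hN0, Nat.floor_natCast, sub_self, zero_smul, add_zero]

theorem scalarEulerPath_natCast_div {N : ℕ} (hN : 1 ≤ N) (w : ℝ → ℝ → ℝ) (k : ℕ) (m : ℝ) :
    scalarEulerPath w N ((k : ℝ) / N) m = scalarEulerGrid w N k m := by
  have hN0 : (N : ℝ) ≠ 0 := by exact_mod_cast (by omega : N ≠ 0)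
  rw [scalarEulerPath, div_mul_cancel₀ _ hN0, Nat.floor_natCast, sub_self, zero_mul, add_zero]

/-- The factor by which the Euler scheme multiplies the orthogonal part in the first `k` steps. -/
noncomputable def orthFactor (α β : ℝ → ℝ) (q : ℝ) (N k : ℕ) : ℝ :=
  ∏ i ∈ Finset.range k, (1 + 1 / (N : ℝ) * orthRate α β q ((i : ℝ) / N))

theorem orthPart_eulerGrid (hd : 1 ≤ d) {r : EuclideanSpace ℝ (Fin d)} (hr : ‖r‖ ^ 2 = d)
    {σ : ℝ} {b : ℝ → EuclideanSpace ℝ (Fin d) → EuclideanSpace ℝ (Fin d)}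
    (hb : ∀ τ ∈ Icc (0 : ℝ) 1, b τ = mixtureVelocity p r (√d) α β σ τ) (N : ℕ)
    (x : EuclideanSpace ℝ (Fin d)) {k : ℕ} (hk : k ≤ N) :
    orthPart r (eulerGrid b N k x) = orthFactor α β (σ ^ 2 / d) N k • orthPart r x := by
  induction k with
  | zero => simp [orthFactor, eulerGrid]
  | succ k ih =>
    rw [eulerGrid, orthPart_add, orthPart_smul, hb _ (natCast_div_mem_Icc (by omega)),
      orthPart_mixtureVelocity hd hr, ih (by omega), orthFactor, orthFactor,
      Finset.prod_range_succ]
    module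

end Drift

/-! ### The Gaussian distribution function Φ. -/

section GaussianCdf

theorem cdf_gaussianReal_eq_integral (x : ℝ) :
    cdf (gaussianReal 0 1) x = ∫ y in Iic x, gaussianPDFReal 0 1 y := by
  rw [cdf_eq_real, measureReal_def, gaussianReal_apply_eq_integral _ one_ne_zero,
    ENNReal.toReal_ofReal]
  exact integral_nonneg fun y => gaussianPDFReal_nonneg _ _ _

theorem continuous_gaussianPDFReal : Continuous (gaussianPDFReal 0 1) := by
  rw [gaussianPDFReal_def]
  fun_prop

theorem hasDerivAt_cdf_gaussianReal (x : ℝ) :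
    HasDerivAt (cdf (gaussianReal 0 1)) (gaussianPDFReal 0 1 x) x := by
  have hi := integrable_gaussianPDFReal 0 1
  have h : ∀ y, cdf (gaussianReal 0 1) y
      = cdf (gaussianReal 0 1) 0 + ∫ t in (0 : ℝ)..y, gaussianPDFReal 0 1 t := by
    intro y
    rw [cdf_gaussianReal_eq_integral, cdf_gaussianReal_eq_integral,
      ← intervalIntegral.integral_Iic_sub_Iic hi.integrableOn hi.integrableOn]
    ring
  rw [funext h]
  exact (intervalIntegral.integral_hasDerivAt_right hi.intervalIntegrable
    (continuous_gaussianPDFReal.stronglyMeasurableAtFilter _ _)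
    continuous_gaussianPDFReal.continuousAt).const_add _

theorem strictMono_cdf_gaussianReal : StrictMono (cdf (gaussianReal 0 1)) :=
  strictMono_of_hasDerivAt_pos hasDerivAt_cdf_gaussianReal
    fun _ => gaussianPDFReal_pos _ _ _ one_ne_zero

theorem continuous_cdf_gaussianReal : Continuous (cdf (gaussianReal 0 1)) :=
  continuous_iff_continuousAt.2 fun x => (hasDerivAt_cdf_gaussianReal x).continuousAt

theorem cdf_gaussianReal_pos (x : ℝ) : 0 < cdf (gaussianReal 0 1) x :=
  (cdf_nonneg _ (x - 1)).trans_lt (strictMono_cdf_gaussianReal (by linarith))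

theorem cdf_gaussianReal_lt_one (x : ℝ) : cdf (gaussianReal 0 1) x < 1 :=
  (strictMono_cdf_gaussianReal (by linarith : x < x + 1)).trans_le (cdf_le_one _ _)

theorem exists_cdf_gaussianReal_eq {q : ℝ} (hq : q ∈ Ioo (0 : ℝ) 1) :
    ∃ x, cdf (gaussianReal 0 1) x = q := by
  obtain ⟨a, ha⟩ := ((tendsto_cdf_atBot (gaussianReal 0 1)).eventually_lt_const hq.1).exists
  obtain ⟨b, hb⟩ := ((tendsto_cdf_atTop (gaussianReal 0 1)).eventually_const_lt hq.2).exists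
  exact mem_range_of_exists_le_of_exists_ge continuous_cdf_gaussianReal ⟨a, ha.le⟩ ⟨b, hb.le⟩

/-- This expresses that Φ(m) is uniform when m is Gaussian. The end values of p are separate because
Φ does not attain 0 and 1. -/
theorem gaussianReal_setOf_lt_cdf {p : ℝ} (hp : p ∈ Icc (0 : ℝ) 1) :
    gaussianReal 0 1 {m | 1 - p < cdf (gaussianReal 0 1) m} = ENNReal.ofReal p := by
  rcases hp.1.eq_or_lt with rfl | h0
  · have : {m | 1 - (0 : ℝ) < cdf (gaussianReal 0 1) m} = ∅ := by
      ext m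
      simpa using (cdf_le_one (gaussianReal 0 1) m)
    rw [this]; simp
  rcases hp.2.eq_or_lt with rfl | h1
  · have : {m | 1 - (1 : ℝ) < cdf (gaussianReal 0 1) m} = univ := by
      ext m
      simpa using cdf_gaussianReal_pos m
    rw [this]; simp
  obtain ⟨x, hx⟩ := exists_cdf_gaussianReal_eq (q := 1 - p) ⟨by linarith, by linarith⟩
  have : {m | 1 - p < cdf (gaussianReal 0 1) m} = (Iic x)ᶜ := by
    ext m
    rw [mem_ofPred_eq, ← hx, strictMono_cdf_gaussianReal.lt_iff_lt]
    simp
  rw [this, prob_compl_eq_one_sub measurableSet_Iic, ← ofReal_cdf, hx, ← ENNReal.ofReal_one,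
    ← ENNReal.ofReal_sub _ (by linarith)]
  congr 1; ring

theorem ae_cdf_gaussianReal_ne (q : ℝ) :
    ∀ᵐ m ∂(gaussianReal 0 1), cdf (gaussianReal 0 1) m ≠ q := by
  have hs : {m | cdf (gaussianReal 0 1) m = q}.Subsingleton := fun a ha b hb =>
    strictMono_cdf_gaussianReal.injective (ha.trans hb.symm)
  have h0 := (gaussianReal_absolutelyContinuous 0 one_ne_zero) (hs.measure_zero volume)
  rw [ae_iff]
  simpa using h0

end GaussianCdf

/-! ### The flow of dy/dρ = T(ρ y) and its conserved quantity. -/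

section LimitFlow

variable {p : ℝ}

/-- Picard–Lindelöf with speed at most 1: during a time n + 1 the solution stays within n + 1 of its
start, and there the field has Lipschitz constant n + 1. Time runs both ways so that 0 is an
interior point. -/
theorem exists_mixtureTanh_flow_Icc (hp : p ∈ Icc (0 : ℝ) 1) (m : ℝ) (n : ℕ) :
    ∃ y : ℝ → ℝ, y 0 = m ∧ ∀ t ∈ Icc (-(n + 1 : ℝ)) (n + 1),
      HasDerivWithinAt y (mixtureTanh p (t * y t)) (Icc (-(n + 1 : ℝ)) (n + 1)) t := by
  have hn : (0 : ℝ) ≤ n + 1 := by positivity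
  have hpl : IsPicardLindelof (fun t y => mixtureTanh p (t * y)) (tmin := -(n + 1 : ℝ))
      (tmax := n + 1) ⟨0, by constructor <;> linarith⟩ m (n + 1 : NNReal) 0 1 (n + 1 : NNReal) :=
    { lipschitzOnWith := fun t ht => by
        refine LipschitzOnWith.of_dist_le_mul fun x _ y _ => ?_
        rw [Real.dist_eq, Real.dist_eq]
        refine (lipschitz_mixtureTanh hp _ _).trans ?_
        rw [← mul_sub, abs_mul]
        have : |t| ≤ n + 1 := abs_le.2 ht
        push_cast
        gcongr
      continuousOn := fun x _ => by
        have := continuous_mixtureTanh hp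
        fun_prop
      norm_le := fun t _ x _ => by
        simpa using abs_mixtureTanh_le_one hp (t * x)
      mul_max_le := by simp }
  exact hpl.exists_eq_forall_mem_Icc_hasDerivWithinAt₀

theorem mixtureTanh_flow_eqOn (hp : p ∈ Icc (0 : ℝ) 1) {a : ℝ} (ha : 0 < a) {y z : ℝ → ℝ}
    (h0 : y 0 = z 0)
    (hy : ∀ t ∈ Icc (-a) a, HasDerivWithinAt y (mixtureTanh p (t * y t)) (Icc (-a) a) t)
    (hz : ∀ t ∈ Icc (-a) a, HasDerivWithinAt z (mixtureTanh p (t * z t)) (Icc (-a) a) t) :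
    EqOn y z (Icc (-a) a) := by
  refine ODE_solution_unique_of_mem_Icc (v := fun t x => mixtureTanh p (t * x))
    (s := fun _ => univ) (K := ⟨a, ha.le⟩) (t₀ := 0) (fun t ht => ?_) ⟨by linarith, ha⟩
    (fun t ht => (hy t ht).continuousWithinAt)
    (fun t ht => (hy t (Ioo_subset_Icc_self ht)).hasDerivAt (Icc_mem_nhds ht.1 ht.2))
    (fun _ _ => mem_univ _) (fun t ht => (hz t ht).continuousWithinAt)
    (fun t ht => (hz t (Ioo_subset_Icc_self ht)).hasDerivAt (Icc_mem_nhds ht.1 ht.2))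
    (fun _ _ => mem_univ _) h0
  refine LipschitzOnWith.of_dist_le_mul fun x _ y _ => ?_
  rw [Real.dist_eq, Real.dist_eq]
  refine (lipschitz_mixtureTanh hp _ _).trans ?_
  rw [← mul_sub, abs_mul]
  have : |t| ≤ a := abs_le.2 ⟨ht.1.le, ht.2.le⟩
  change _ ≤ a * _
  gcongr

theorem exists_mixtureTanh_flow (hp : p ∈ Icc (0 : ℝ) 1) (m : ℝ) :
    ∃ y : ℝ → ℝ, y 0 = m ∧ ∀ t, HasDerivAt y (mixtureTanh p (t * y t)) t := by
  choose y hy0 hy using exists_mixtureTanh_flow_Icc hp m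
  have hmono : ∀ n k : ℕ, n ≤ k → EqOn (y n) (y k) (Icc (-(n + 1 : ℝ)) (n + 1)) := by
    intro n k hnk
    have hle : (n : ℝ) ≤ k := by exact_mod_cast hnk
    have hsub : Icc (-(n + 1 : ℝ)) (n + 1) ⊆ Icc (-(k + 1 : ℝ)) (k + 1) :=
      Icc_subset_Icc (by linarith) (by linarith)
    exact mixtureTanh_flow_eqOn hp (by positivity) ((hy0 n).trans (hy0 k).symm) (hy n)
      fun t ht => (hy k t (hsub ht)).mono hsub
  have heq : ∀ (n : ℕ) (t : ℝ), |t| ≤ n → y ⌈|t|⌉₊ t = y n t := by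
    intro n t ht
    refine hmono _ _ (Nat.ceil_le.2 ht) ?_
    have := Nat.le_ceil |t|
    rw [mem_Icc, ← abs_le]
    linarith
  -- The local solutions agree by uniqueness, and the index ⌈|t|⌉ puts t inside the interval of its
  -- solution.
  refine ⟨fun t => y ⌈|t|⌉₊ t, by simp [hy0], fun t => ?_⟩
  obtain ⟨n, hn⟩ := exists_nat_gt |t|
  have ht : |t| ≤ n := hn.le
  have ht' := abs_lt.1 hn
  have h1 : HasDerivAt (y n) (mixtureTanh p (t * y n t)) t :=
    (hy n t ⟨by linarith, by linarith⟩).hasDerivAt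
      (Icc_mem_nhds (by linarith) (by linarith))
  simp only
  rw [heq n t ht]
  refine h1.congr_of_eventuallyEq ?_
  filter_upwards [continuous_abs.continuousAt.eventually_lt_const hn] with s hs
  exact heq n s (le_of_lt hs)

/-- The flow transports the standard Gaussian to the law of `ρ s + g`, where the sign `s` is `1`
with probability `p` and `g` is standard Gaussian. -/
theorem mixtureTanh_flow_cdf (hp : p ∈ Icc (0 : ℝ) 1) {y : ℝ → ℝ}
    (hy : ∀ t, HasDerivAt y (mixtureTanh p (t * y t)) t) (t : ℝ) :
    p * cdf (gaussianReal 0 1) (y t - t) + (1 - p) * cdf (gaussianReal 0 1) (y t + t)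
      = cdf (gaussianReal 0 1) (y 0) := by
  -- This is the continuity equation, integrated once. The densities at y ∓ t are a common factor
  -- times exp(± t y), so the weighted velocities relative to the two centres cancel by the formula
  -- for T.
  have hd : ∀ t, HasDerivAt (fun t => p * cdf (gaussianReal 0 1) (y t - t)
      + (1 - p) * cdf (gaussianReal 0 1) (y t + t)) 0 t := by
    intro t
    have a1 : HasDerivAt (fun t => y t - t) (mixtureTanh p (t * y t) - 1) t :=
      (hy t).sub (hasDerivAt_id t)
    have a2 : HasDerivAt (fun t => y t + t) (mixtureTanh p (t * y t) + 1) t :=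
      (hy t).add (hasDerivAt_id t)
    have h1 := (HasDerivAt.comp (h := fun t => y t - t) t (hasDerivAt_cdf_gaussianReal _) a1).const_mul p
    have h2 := (HasDerivAt.comp (h := fun t => y t + t) t (hasDerivAt_cdf_gaussianReal _) a2).const_mul (1 - p)
    refine (h1.add h2).congr_deriv ?_
    have e1 : gaussianPDFReal 0 1 (y t - t)
        = (√(2 * Real.pi))⁻¹ * Real.exp (-(y t ^ 2 + t ^ 2) / 2) * Real.exp (t * y t) := by
      rw [mul_assoc (√(2 * Real.pi))⁻¹, ← Real.exp_add, gaussianPDFReal]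
      congr 2
      · simp
      · simp; ring
    have e2 : gaussianPDFReal 0 1 (y t + t)
        = (√(2 * Real.pi))⁻¹ * Real.exp (-(y t ^ 2 + t ^ 2) / 2) * Real.exp (-(t * y t)) := by
      rw [mul_assoc (√(2 * Real.pi))⁻¹, ← Real.exp_add, gaussianPDFReal]
      congr 2
      · simp
      · simp; ring
    rw [e1, e2, mixtureTanh]
    have := (mixtureTanh_denom_pos hp (t * y t)).ne'
    generalize Real.exp (t * y t) = u at *
    generalize Real.exp (-(t * y t)) = v at *
    field_simp
    ring
  have h := is_const_of_deriv_eq_zero (fun t => (hd t).differentiableAt) (fun t => (hd t).deriv) t 0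
  simp only [sub_zero, add_zero] at h
  rw [h]
  ring

theorem abs_mixtureTanh_flow_sub_le (hp : p ∈ Icc (0 : ℝ) 1) {y : ℝ → ℝ}
    (hy : ∀ t, HasDerivAt y (mixtureTanh p (t * y t)) t) (t : ℝ) : |y t - y 0| ≤ |t| := by
  have h := Convex.norm_image_sub_le_of_norm_hasDerivWithin_le (f := y) (C := 1)
    (s := univ) (x := 0) (y := t) (fun x _ => (hy x).hasDerivWithinAt)
    (fun x _ => by simpa using abs_mixtureTanh_le_one hp _) convex_univ (mem_univ _) (mem_univ _)
  simpa using h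

/-- If y − t became very negative, the first term of the conserved quantity would be negligible and
the second is at most 1 − p, contradicting the initial value. Hence y − t is bounded below, and the
speed bound gives the matching upper estimate. -/
theorem tendsto_mixtureTanh_flow_div (hp : p ∈ Icc (0 : ℝ) 1) {y : ℝ → ℝ}
    (hy : ∀ t, HasDerivAt y (mixtureTanh p (t * y t)) t)
    (h0 : 1 - p < cdf (gaussianReal 0 1) (y 0)) :
    Tendsto (fun t => y t / t) atTop (𝓝 1) := by
  have hp0 : 0 < p := by linarith [cdf_le_one (gaussianReal 0 1) (y 0)]
  -- Conservation forces Φ(y − t) ≥ q, so any `c` with Φ(c) < q bounds y − t below.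
  set q := (cdf (gaussianReal 0 1) (y 0) - (1 - p)) / p with hq
  have hq0 : 0 < q := div_pos (by linarith) hp0
  obtain ⟨c, hc⟩ := ((tendsto_cdf_atBot (gaussianReal 0 1)).eventually_lt_const hq0).exists
  have hlow : ∀ t, c ≤ y t - t := by
    intro t
    by_contra! hlt
    have h1 := mixtureTanh_flow_cdf hp hy t
    have h2 := (strictMono_cdf_gaussianReal hlt).trans hc
    rw [hq, lt_div_iff₀ hp0] at h2
    have h3 : (1 - p) * cdf (gaussianReal 0 1) (y t + t) ≤ (1 - p) * 1 :=
      mul_le_mul_of_nonneg_left (cdf_le_one _ _) (by linarith [hp.2])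
    linarith
  have e1 : Tendsto (fun t : ℝ => 1 + c / t) atTop (𝓝 1) := by
    simpa using (tendsto_const_nhds (x := (1 : ℝ))).add
      ((tendsto_const_nhds (x := c)).div_atTop tendsto_id)
  have e2 : Tendsto (fun t : ℝ => 1 + y 0 / t) atTop (𝓝 1) := by
    simpa using (tendsto_const_nhds (x := (1 : ℝ))).add
      ((tendsto_const_nhds (x := y 0)).div_atTop tendsto_id)
  refine tendsto_of_tendsto_of_tendsto_of_le_of_le' e1 e2 ?_ ?_
  · filter_upwards [eventually_gt_atTop 0] with t ht
    rw [le_div_iff₀ ht, add_mul, div_mul_cancel₀ _ ht.ne']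
    linarith [hlow t]
  · filter_upwards [eventually_gt_atTop 0] with t ht
    rw [div_le_iff₀ ht, add_mul, div_mul_cancel₀ _ ht.ne']
    have := (abs_le.1 (abs_mixtureTanh_flow_sub_le hp hy t)).2
    rw [abs_of_pos ht] at this
    linarith

/-- By evenness of the density the sum Φ(−x) + Φ(x) is constant, and at infinity it equals 1. -/
theorem cdf_gaussianReal_neg (x : ℝ) :
    cdf (gaussianReal 0 1) (-x) = 1 - cdf (gaussianReal 0 1) x := by
  have hd : ∀ t, HasDerivAt (fun t => cdf (gaussianReal 0 1) (-t) + cdf (gaussianReal 0 1) t) 0 t := by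
    intro t
    have h1 := (hasDerivAt_cdf_gaussianReal (-t)).comp t (hasDerivAt_neg t)
    refine (h1.add (hasDerivAt_cdf_gaussianReal t)).congr_deriv ?_
    simp [gaussianPDFReal]
  have hconst : ∀ x, cdf (gaussianReal 0 1) (-x) + cdf (gaussianReal 0 1) x
      = cdf (gaussianReal 0 1) (-0) + cdf (gaussianReal 0 1) 0 := fun x => is_const_of_deriv_eq_zero (fun t => (hd t).differentiableAt)
    (fun t => (hd t).deriv) x 0
  have hlim : Tendsto (fun t => cdf (gaussianReal 0 1) (-t) + cdf (gaussianReal 0 1) t) atTop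
      (𝓝 (0 + 1)) :=
    ((tendsto_cdf_atBot (gaussianReal 0 1)).comp tendsto_neg_atTop_atBot).add
      (tendsto_cdf_atTop (gaussianReal 0 1))
  have h2 := tendsto_nhds_unique hlim
    (tendsto_const_nhds.congr fun t => (hconst t).symm)
  have h3 := hconst x
  linarith

theorem mixtureTanh_flow_neg {y : ℝ → ℝ}
    (hy : ∀ t, HasDerivAt y (mixtureTanh p (t * y t)) t) (t : ℝ) :
    HasDerivAt (fun t => -y t) (mixtureTanh (1 - p) (t * -y t)) t := by
  rw [mixtureTanh_one_sub, mul_neg, neg_neg]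
  exact (hy t).neg

theorem tendsto_mixtureTanh_flow_div_neg (hp : p ∈ Icc (0 : ℝ) 1) {y : ℝ → ℝ}
    (hy : ∀ t, HasDerivAt y (mixtureTanh p (t * y t)) t)
    (h0 : cdf (gaussianReal 0 1) (y 0) < 1 - p) :
    Tendsto (fun t => y t / t) atTop (𝓝 (-1)) := by
  have h := tendsto_mixtureTanh_flow_div (one_sub_mem_Icc hp) (mixtureTanh_flow_neg hy)
    (by rw [cdf_gaussianReal_neg]; linarith)
  refine h.neg.congr fun t => ?_
  rw [neg_div, neg_neg]

end LimitFlow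

/-! ### Convergence of the Euler scheme for a Lipschitz drift. -/

section EulerConvergence

/-- The local error is at most ε h, by the modulus of continuity of the drift along the solution.
The previous error grows by at most 1 + L h ≤ exp(L h), so the bound ε t exp(L t) propagates. -/
theorem euler_step_error {f : ℝ → ℝ → ℝ} {S L : ℝ} (hL : 0 ≤ L)
    (hLip : ∀ t ∈ Icc (0 : ℝ) S, ∀ x y, |f t x - f t y| ≤ L * |x - y|) {M : ℝ → ℝ}
    (hM : ∀ t ∈ Icc (0 : ℝ) S, HasDerivWithinAt M (f t (M t)) (Icc 0 S) t) {ε δ : ℝ} (hε : 0 ≤ ε)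
    (hδ : ∀ s ∈ Icc (0 : ℝ) S, ∀ t ∈ Icc (0 : ℝ) S, |s - t| < δ → |f s (M s) - f t (M t)| ≤ ε)
    {t h X : ℝ} (ht : 0 ≤ t) (hh : 0 ≤ h) (hhδ : h < δ) (hS : t + h ≤ S)
    (hX : |X - M t| ≤ ε * t * Real.exp (L * t)) :
    |X + h * f t X - M (t + h)| ≤ ε * (t + h) * Real.exp (L * (t + h)) := by
  have htS : t ∈ Icc (0 : ℝ) S := ⟨ht, by linarith⟩
  have hsub : Icc t (t + h) ⊆ Icc 0 S := Icc_subset_Icc ht hS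
  have h1 : |M (t + h) - M t - h * f t (M t)| ≤ ε * h := by
    -- Mean value inequality for the solution minus its tangent at time t.
    have h2 := Convex.norm_image_sub_le_of_norm_hasDerivWithin_le
      (f := fun s => M s - s * f t (M t)) (f' := fun s => f s (M s) - 1 * f t (M t)) (C := ε)
      (s := Icc t (t + h)) (x := t) (y := t + h)
      (fun s hs => ((hM s (hsub hs)).mono hsub).sub
        ((hasDerivWithinAt_id s _).mul_const (f t (M t))))
      (fun s hs => by
        rw [one_mul]
        refine hδ s (hsub hs) t htS ?_
        rw [abs_of_nonneg (by linarith [hs.1])]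
        linarith [hs.2])
      (convex_Icc _ _) ⟨le_rfl, by linarith⟩ ⟨by linarith, le_rfl⟩
    rw [Real.norm_eq_abs, Real.norm_eq_abs] at h2
    have e1 : M (t + h) - (t + h) * f t (M t) - (M t - t * f t (M t))
        = M (t + h) - M t - h * f t (M t) := by ring
    have e2 : t + h - t = h := by ring
    rwa [e1, e2, abs_of_nonneg hh] at h2
  have h2 := hLip t htS X (M t)
  have e : X + h * f t X - M (t + h)
      = (X - M t) + h * (f t X - f t (M t)) - (M (t + h) - M t - h * f t (M t)) := by ring
  have h3 : |X + h * f t X - M (t + h)| ≤ (1 + L * h) * |X - M t| + ε * h := by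
    rw [e]
    refine (abs_sub _ _).trans (add_le_add ((abs_add_le _ _).trans ?_) h1)
    rw [abs_mul, abs_of_nonneg hh]
    nlinarith
  have h4 : 1 + L * h ≤ Real.exp (L * h) := by linarith [Real.add_one_le_exp (L * h)]
  have h5 : 1 ≤ Real.exp (L * (t + h)) := Real.one_le_exp (by positivity)
  calc |X + h * f t X - M (t + h)| ≤ (1 + L * h) * |X - M t| + ε * h := h3
    _ ≤ Real.exp (L * h) * (ε * t * Real.exp (L * t)) + ε * h * Real.exp (L * (t + h)) := by
        refine add_le_add (mul_le_mul h4 hX (abs_nonneg _) (Real.exp_pos _).le) ?_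
        exact le_mul_of_one_le_right (by positivity) h5
    _ = ε * (t + h) * Real.exp (L * (t + h)) := by
        rw [mul_add L, Real.exp_add]; ring

/-- Uniform convergence of the Euler scheme of a Lipschitz equation. -/
theorem scalarEulerPath_uniform {f : ℝ → ℝ → ℝ} {S L : ℝ} (hS : 0 ≤ S) (hL : 0 ≤ L)
    (hLip : ∀ t ∈ Icc (0 : ℝ) S, ∀ x y, |f t x - f t y| ≤ L * |x - y|) {M : ℝ → ℝ}
    (hM : ∀ t ∈ Icc (0 : ℝ) S, HasDerivWithinAt M (f t (M t)) (Icc 0 S) t)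
    (hc : ContinuousOn (fun t => f t (M t)) (Icc 0 S)) {ε : ℝ} (hε : 0 < ε) :
    ∀ᶠ N : ℕ in atTop, ∀ t ∈ Icc (0 : ℝ) S, |scalarEulerPath f N t (M 0) - M t| ≤ ε := by
  -- Chosen so that the accumulated error η S exp(L S) is at most ε; the summand 1 keeps the
  -- denominator positive when S = 0.
  set η := ε / (S * Real.exp (L * S) + 1) with hη
  have hη0 : 0 < η := by positivity
  obtain ⟨δ, hδ0, hδ⟩ := Metric.uniformContinuousOn_iff_le.1
    (isCompact_Icc.uniformContinuousOn_of_continuous hc) η hη0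
  have hδ' : ∀ s ∈ Icc (0 : ℝ) S, ∀ t ∈ Icc (0 : ℝ) S, |s - t| < δ →
      |f s (M s) - f t (M t)| ≤ η := fun s hs t ht h => hδ s hs t ht (le_of_lt h)
  have hsmall : ∀ᶠ N : ℕ in atTop, 1 / (N : ℝ) < δ :=
    tendsto_one_div_atTop_nhds_zero_nat.eventually_lt_const hδ0
  filter_upwards [hsmall, eventually_ge_atTop 1] with N hN hN1
  have hN0 : (0 : ℝ) < N := by exact_mod_cast hN1
  have hgrid : ∀ k : ℕ, (k : ℝ) / N ≤ S → |scalarEulerGrid f N k (M 0) - M ((k : ℝ) / N)|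
      ≤ η * ((k : ℝ) / N) * Real.exp (L * ((k : ℝ) / N)) := by
    intro k
    induction k with
    | zero => intro _; simp [scalarEulerGrid]
    | succ k ih =>
      intro hk
      have e : ((k + 1 : ℕ) : ℝ) / N = (k : ℝ) / N + 1 / N := by push_cast; ring
      rw [e] at hk ⊢
      have h1 : (0 : ℝ) < 1 / N := by positivity
      exact euler_step_error hL hLip hM hη0.le hδ' (by positivity) h1.le hN hk
        (ih (by linarith))
  intro t ht
  set k := ⌊t * N⌋₊ with hk
  have hk1 : (k : ℝ) / N ≤ t := by
    rw [div_le_iff₀ hN0]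
    exact Nat.floor_le (mul_nonneg ht.1 hN0.le)
  have hk2 : t < (k : ℝ) / N + 1 / N := by
    rw [← add_div, lt_div_iff₀ hN0]
    exact Nat.lt_floor_add_one _
  -- Between grid points the frozen drift is one further Euler step, of length t − k/N.
  have h1 := euler_step_error hL hLip hM hη0.le hδ' (t := (k : ℝ) / N) (h := t - (k : ℝ) / N)
    (X := scalarEulerGrid f N k (M 0)) (by positivity) (by linarith) (by linarith)
    (by linarith [ht.2]) (hgrid k (hk1.trans ht.2))
  rw [add_sub_cancel] at h1
  refine h1.trans ?_
  have h2 : t * Real.exp (L * t) ≤ S * Real.exp (L * S) :=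
    mul_le_mul ht.2 (Real.exp_le_exp.2 (mul_le_mul_of_nonneg_left ht.2 hL)) (Real.exp_pos _).le hS
  calc η * t * Real.exp (L * t) = η * (t * Real.exp (L * t)) := by ring
    _ ≤ η * (S * Real.exp (L * S) + 1) := by
        refine mul_le_mul_of_nonneg_left (by linarith) hη0.le
    _ = ε := div_mul_cancel₀ _ (by positivity)

end EulerConvergence

/-! ### The drift at q = 0 and its singularity at the final time. -/

section LimitDrift

variable {α β : ℝ → ℝ}

theorem orthRate_zero {τ : ℝ} (hτ : α τ ≠ 0) : orthRate α β 0 τ = timeDeriv α τ / α τ := by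
  rw [orthRate, zero_mul, zero_mul, add_zero, add_zero]
  field_simp

theorem magDrift_zero (T : ℝ → ℝ) {τ : ℝ} (hτ : α τ ≠ 0) (m : ℝ) :
    magDrift α β T 0 τ m = timeDeriv α τ / α τ * m
      + (α τ * timeDeriv β τ - timeDeriv α τ * β τ) / α τ * T (β τ * m / α τ ^ 2) := by
  rw [magDrift, orthRate_zero hτ, zero_mul, add_zero]
  congr 2
  field_simp

namespace IsSchedule

theorem continuousOn_orthRate (h : IsSchedule α β) {S : ℝ} (hS : S < 1) :
    ContinuousOn (orthRate α β 0) (Icc 0 S) := by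
  have hsub : Icc 0 S ⊆ Icc (0 : ℝ) 1 := Icc_subset_Icc_right hS.le
  have h1 := h.contDiffOn_fst.continuousOn.mono hsub
  have h2 := h.contDiffOn_snd.continuousOn.mono hsub
  have h3 := (continuousOn_timeDeriv h.contDiffOn_fst).mono hsub
  have h4 := (continuousOn_timeDeriv h.contDiffOn_snd).mono hsub
  have hne : ∀ t ∈ Icc 0 S, α t ^ 2 + 0 * β t ^ 2 ≠ 0 := fun t ht => by
    have := h.fst_pos ⟨ht.1, ht.2.trans_lt hS⟩
    positivity
  unfold orthRate
  fun_prop (disch := assumption)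

theorem continuousOn_drift_coeff (h : IsSchedule α β) {S : ℝ} (hS : S < 1) :
    ContinuousOn (fun t => timeDeriv β t - orthRate α β 0 t * β t) (Icc 0 S) := by
  have hsub : Icc 0 S ⊆ Icc (0 : ℝ) 1 := Icc_subset_Icc_right hS.le
  have h2 := h.contDiffOn_snd.continuousOn.mono hsub
  have h4 := (continuousOn_timeDeriv h.contDiffOn_snd).mono hsub
  have h5 := h.continuousOn_orthRate hS
  fun_prop

theorem continuousOn_signal (h : IsSchedule α β) {S : ℝ} (hS : S < 1) :
    ContinuousOn (fun t => β t / (α t ^ 2 + 0 * β t ^ 2)) (Icc 0 S) := by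
  have hsub : Icc 0 S ⊆ Icc (0 : ℝ) 1 := Icc_subset_Icc_right hS.le
  have h1 := h.contDiffOn_fst.continuousOn.mono hsub
  have h2 := h.contDiffOn_snd.continuousOn.mono hsub
  have hne : ∀ t ∈ Icc 0 S, α t ^ 2 + 0 * β t ^ 2 ≠ 0 := fun t ht => by
    have := h.fst_pos ⟨ht.1, ht.2.trans_lt hS⟩
    positivity
  fun_prop (disch := assumption)

theorem exists_lipschitz_magDrift (h : IsSchedule α β) {T : ℝ → ℝ}
    (hT : ∀ u v, |T u - T v| ≤ |u - v|) {S : ℝ} (hS : S < 1) :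
    ∃ L : ℝ, 0 ≤ L ∧ ∀ t ∈ Icc 0 S, ∀ x y,
      |magDrift α β T 0 t x - magDrift α β T 0 t y| ≤ L * |x - y| := by
  obtain ⟨C₁, h₁⟩ := isCompact_Icc.exists_bound_of_continuousOn (h.continuousOn_orthRate hS)
  obtain ⟨C₂, h₂⟩ := isCompact_Icc.exists_bound_of_continuousOn (h.continuousOn_drift_coeff hS)
  obtain ⟨C₃, h₃⟩ := isCompact_Icc.exists_bound_of_continuousOn (h.continuousOn_signal hS)
  refine ⟨|C₁| + |C₂| * |C₃|, by positivity, fun t ht x y => ?_⟩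
  have g₁ := (h₁ t ht).trans (le_abs_self C₁)
  have g₂ := (h₂ t ht).trans (le_abs_self C₂)
  have g₃ := (h₃ t ht).trans (le_abs_self C₃)
  rw [Real.norm_eq_abs] at g₁ g₂ g₃
  have hTt : |T (β t * x / (α t ^ 2 + 0 * β t ^ 2)) - T (β t * y / (α t ^ 2 + 0 * β t ^ 2))|
      ≤ |C₃| * |x - y| := by
    refine (hT _ _).trans ?_
    have e : β t * x / (α t ^ 2 + 0 * β t ^ 2) - β t * y / (α t ^ 2 + 0 * β t ^ 2)
      = β t / (α t ^ 2 + 0 * β t ^ 2) * (x - y) := by ring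
    rw [e, abs_mul]
    gcongr
  have e : magDrift α β T 0 t x - magDrift α β T 0 t y
      = orthRate α β 0 t * (x - y) + (timeDeriv β t - orthRate α β 0 t * β t)
        * (T (β t * x / (α t ^ 2 + 0 * β t ^ 2)) - T (β t * y / (α t ^ 2 + 0 * β t ^ 2))) := by
    simp only [magDrift]; ring
  rw [e, add_mul]
  refine (abs_add_le _ _).trans (add_le_add ?_ ?_)
  · rw [abs_mul]; gcongr
  · rw [abs_mul, mul_assoc]; gcongr

theorem continuousOn_magDrift_comp (h : IsSchedule α β) {T : ℝ → ℝ} (hT : Continuous T) {S : ℝ}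
    (hS : S < 1) {M : ℝ → ℝ} (hM : ContinuousOn M (Icc 0 S)) :
    ContinuousOn (fun t => magDrift α β T 0 t (M t)) (Icc 0 S) := by
  have h5 := h.continuousOn_orthRate hS
  have h6 := h.continuousOn_drift_coeff hS
  have h7 := hT.comp_continuousOn ((h.continuousOn_signal hS).mul hM)
  refine ((h5.mul hM).add (h6.mul h7)).congr fun t _ => ?_
  simp only [magDrift, Pi.add_apply, Pi.mul_apply, Function.comp]
  congr 3
  ring

/-- Near the final time, the contraction rate is `-1 / (1 - τ)`. -/
theorem tendsto_one_sub_mul_orthRate (h : IsSchedule α β) :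
    Tendsto (fun t => (1 - t) * orthRate α β 0 t) (𝓝[<] 1) (𝓝 (-1)) := by
  have h1 : (1 : ℝ) ∈ Icc (0 : ℝ) 1 := by simp
  have hne := (h.timeDeriv_fst_neg 1 h1).ne
  have hle : 𝓝[<] (1 : ℝ) ≤ 𝓝[Icc 0 1 \ {1}] 1 := by
    rw [Icc_sdiff_right, nhdsWithin_Ico_eq_nhdsLT zero_lt_one]
  -- The difference quotient α(t)/(t − 1) and the derivative α̇(t) have the same nonzero limit
  -- α̇(1), and (1 − t) α̇/α is minus their ratio.
  have hsl : Tendsto (slope α 1) (𝓝[<] 1) (𝓝 (timeDeriv α 1)) :=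
    (hasDerivWithinAt_iff_tendsto_slope.1
      (hasDerivWithinAt_timeDeriv h.contDiffOn_fst h1)).mono_left hle
  have hd : Tendsto (timeDeriv α) (𝓝[<] 1) (𝓝 (timeDeriv α 1)) :=
    ((continuousOn_timeDeriv h.contDiffOn_fst) 1 h1).mono_left
      (hle.trans (nhdsWithin_mono _ sdiff_subset))
  have hlim := (hd.div hsl hne).neg
  rw [div_self hne] at hlim
  refine hlim.congr' ?_
  filter_upwards [Ioo_mem_nhdsLT (zero_lt_one (α := ℝ))] with t ht
  have hα := h.fst_pos (Ioo_subset_Ico_self ht)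
  have ht1 : t - 1 ≠ 0 := by linarith [ht.2]
  simp only [Pi.div_apply]
  rw [orthRate_zero hα.ne', slope_def_field, h.fst_one, sub_zero]
  field_simp
  ring

theorem orthRate_zero_neg (h : IsSchedule α β) {t : ℝ} (ht : t ∈ Ico (0 : ℝ) 1) :
    orthRate α β 0 t < 0 := by
  have := h.fst_pos ht
  rw [orthRate_zero this.ne']
  exact div_neg_of_neg_of_pos (h.timeDeriv_fst_neg t (Ico_subset_Icc_self ht)) this

theorem natCast_div_mem_Ico {k N : ℕ} (hk : k < N) : (k : ℝ) / N ∈ Ico (0 : ℝ) 1 :=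
  ⟨by positivity, (div_lt_one (by exact_mod_cast (by omega : 0 < N))).2 (by exact_mod_cast hk)⟩

/-- Near 1 one has (1 − t) A > −2, and i + 2 ≤ N means 1 − i/N ≥ 2/N, so Δτ A ≥ −1. Away from 1 the
rate is bounded. Only the last step is excluded. -/
theorem eventually_step_mem_Icc (h : IsSchedule α β) :
    ∀ᶠ N : ℕ in atTop, ∀ i : ℕ, i + 2 ≤ N →
      1 / (N : ℝ) * orthRate α β 0 ((i : ℝ) / N) ∈ Icc (-1 : ℝ) 0 := by
  have h1 := h.tendsto_one_sub_mul_orthRate.eventually_const_lt (show (-2 : ℝ) < -1 by norm_num)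
  obtain ⟨t₀, ht₀, hsub⟩ := (mem_nhdsLT_iff_exists_mem_Ico_Ioo_subset (zero_lt_one (α := ℝ))).1 h1
  obtain ⟨C, hC⟩ := isCompact_Icc.exists_bound_of_continuousOn (h.continuousOn_orthRate ht₀.2)
  obtain ⟨N₀, hN₀⟩ := exists_nat_gt C
  filter_upwards [eventually_ge_atTop N₀] with N hN i hi
  have hN0 : (0 : ℝ) < N := by exact_mod_cast (by omega : 0 < N)
  have hNC : C ≤ N := hN₀.le.trans (by exact_mod_cast hN)
  have hmem := natCast_div_mem_Ico (show i < N by omega)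
  have hneg := h.orthRate_zero_neg hmem
  refine ⟨?_, mul_nonpos_of_nonneg_of_nonpos (by positivity) hneg.le⟩
  rw [one_div_mul_eq_div, le_div_iff₀ hN0]
  rcases le_or_gt ((i : ℝ) / N) t₀ with hlt | hge
  · have := (abs_le.1 (hC _ ⟨hmem.1, hlt⟩)).1
    linarith
  · have h2 : -2 < (1 - (i : ℝ) / N) * orthRate α β 0 ((i : ℝ) / N) := hsub ⟨hge, hmem.2⟩
    have h3 : (2 : ℝ) ≤ N - i := by
      have : ((i + 2 : ℕ) : ℝ) ≤ N := by exact_mod_cast hi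
      push_cast at this
      linarith
    have h4 : (1 - (i : ℝ) / N) * N = N - i := by field_simp
    nlinarith

theorem tendsto_last_time : Tendsto (fun N : ℕ => (N : ℝ) / ((N + 1 : ℕ) : ℝ)) atTop (𝓝[<] 1) := by
  refine tendsto_nhdsWithin_iff.2 ⟨?_, Eventually.of_forall fun N => ?_⟩
  · simpa using tendsto_natCast_div_add_atTop (1 : ℝ)
  · exact (natCast_div_mem_Ico (Nat.lt_succ_self N)).2

/-- At the last grid time before 1 the remaining time is the step itself, so Δτ A = (1 − t) A. -/
theorem tendsto_last_step (h : IsSchedule α β) :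
    Tendsto (fun N : ℕ => 1 / ((N + 1 : ℕ) : ℝ) * orthRate α β 0 ((N : ℝ) / ((N + 1 : ℕ) : ℝ)))
      atTop (𝓝 (-1)) := by
  refine (h.tendsto_one_sub_mul_orthRate.comp tendsto_last_time).congr fun N => ?_
  have : (1 : ℝ) - (N : ℝ) / ((N + 1 : ℕ) : ℝ) = 1 / ((N + 1 : ℕ) : ℝ) := by
    push_cast
    have : (N : ℝ) + 1 ≠ 0 := by positivity
    field_simp
    ring
  simp only [Function.comp, this]

/-- For small steps all factors but the last lie in [0,1], and the last tends to 0. -/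
theorem tendsto_orthFactor_zero (h : IsSchedule α β) :
    Tendsto (fun N : ℕ => orthFactor α β 0 N N) atTop (𝓝 0) := by
  rw [← tendsto_add_atTop_iff_nat 1]
  have hlast := (h.tendsto_last_step.const_add 1).abs
  rw [add_neg_cancel, abs_zero] at hlast
  refine squeeze_zero_norm' ?_ hlast
  have hev := (tendsto_add_atTop_nat 1).eventually h.eventually_step_mem_Icc
  filter_upwards [hev] with N hN
  rw [Real.norm_eq_abs, orthFactor, Finset.prod_range_succ, abs_mul, Finset.abs_prod]
  refine mul_le_of_le_one_left (abs_nonneg _) (Finset.prod_le_one (fun _ _ => abs_nonneg _) ?_)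
  intro i hi
  have := hN i (by have := Finset.mem_range.1 hi; omega)
  rw [abs_le]
  constructor <;> linarith [this.1, this.2]

end IsSchedule

end LimitDrift

/-! ### The limiting path, and the Euler scheme up to the final time. -/

section LimitPath

variable {α β : ℝ → ℝ} {p : ℝ}

/-- The limiting magnetization: the flow `y` of `dy/dρ = T(ρ y)`, run for the time `ρ = β/α`, in the
units in which the noise has standard deviation `α`. -/
noncomputable def limitPath (α β y : ℝ → ℝ) (τ : ℝ) : ℝ := α τ * y (β τ / α τ)

namespace IsSchedule

/-- The clock ρ = β/α has derivative (α β̇ − α̇ β)/α², and differentiating the prefactor α gives the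
linear term. -/
theorem hasDerivWithinAt_limitPath (h : IsSchedule α β) {T y : ℝ → ℝ}
    (hy : ∀ t, HasDerivAt y (T (t * y t)) t) {τ : ℝ} (hτ : τ ∈ Ico (0 : ℝ) 1) {s : Set ℝ}
    (hs : s ⊆ Icc 0 1) :
    HasDerivWithinAt (limitPath α β y) (magDrift α β T 0 τ (limitPath α β y τ)) s τ := by
  have hα := (h.fst_pos hτ).ne'
  have hτ' := Ico_subset_Icc_self hτ
  have h1 := (hasDerivWithinAt_timeDeriv h.contDiffOn_fst hτ').mono hs
  have h2 := (hasDerivWithinAt_timeDeriv h.contDiffOn_snd hτ').mono hs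
  have h3 := (hy (β τ / α τ)).comp_hasDerivWithinAt τ (h2.div h1 hα)
  refine (h1.mul h3).congr_deriv ?_
  have e : β τ * limitPath α β y τ / α τ ^ 2 = β τ / α τ * y (β τ / α τ) := by
    rw [limitPath]; field_simp
  rw [magDrift_zero T hα, e, limitPath]
  simp only [Function.comp, Pi.div_apply]
  field_simp

theorem limitPath_zero (h : IsSchedule α β) (y : ℝ → ℝ) : limitPath α β y 0 = y 0 := by
  simp [limitPath, h.fst_zero, h.snd_zero]

theorem tendsto_fst (h : IsSchedule α β) : Tendsto α (𝓝[<] 1) (𝓝[>] 0) := by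
  have hle : 𝓝[<] (1 : ℝ) ≤ 𝓝[Icc 0 1] 1 := by
    rw [← nhdsWithin_Ico_eq_nhdsLT zero_lt_one]
    exact nhdsWithin_mono _ Ico_subset_Icc_self
  refine tendsto_nhdsWithin_iff.2 ⟨?_, ?_⟩
  · have := (h.contDiffOn_fst.continuousOn 1 (by simp)).mono_left hle
    rwa [h.fst_one] at this
  · filter_upwards [Ioo_mem_nhdsLT (zero_lt_one (α := ℝ))] with t ht
    exact h.fst_pos (Ioo_subset_Ico_self ht)

theorem tendsto_snd (h : IsSchedule α β) : Tendsto β (𝓝[<] 1) (𝓝 1) := by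
  have hle : 𝓝[<] (1 : ℝ) ≤ 𝓝[Icc 0 1] 1 := by
    rw [← nhdsWithin_Ico_eq_nhdsLT zero_lt_one]
    exact nhdsWithin_mono _ Ico_subset_Icc_self
  have := (h.contDiffOn_snd.continuousOn 1 (by simp)).mono_left hle
  rwa [h.snd_one] at this

theorem tendsto_ratio (h : IsSchedule α β) : Tendsto (fun t => β t / α t) (𝓝[<] 1) atTop := by
  simp_rw [div_eq_mul_inv]
  exact h.tendsto_snd.pos_mul_atTop one_pos (tendsto_inv_nhdsGT_zero.comp h.tendsto_fst)

theorem tendsto_signal (h : IsSchedule α β) :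
    Tendsto (fun t => β t / (α t ^ 2 + 0 * β t ^ 2)) (𝓝[<] 1) atTop := by
  have h1 := h.tendsto_ratio.atTop_mul_atTop₀ (tendsto_inv_nhdsGT_zero.comp h.tendsto_fst)
  refine h1.congr fun t => ?_
  rw [zero_mul, add_zero, Function.comp, sq, ← div_div, div_eq_mul_inv (β t / α t)]

/-- With ρ = β/α the path is β · y(ρ)/ρ, and ρ → ∞ as the time tends to 1. -/
theorem tendsto_limitPath (h : IsSchedule α β) {y : ℝ → ℝ} {l : ℝ}
    (hy : Tendsto (fun t => y t / t) atTop (𝓝 l)) :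
    Tendsto (limitPath α β y) (𝓝[<] 1) (𝓝 l) := by
  have h1 := h.tendsto_snd.mul (hy.comp h.tendsto_ratio)
  rw [one_mul] at h1
  refine h1.congr' ?_
  filter_upwards [Ioo_mem_nhdsLT (zero_lt_one (α := ℝ))] with t ht
  have h2 := (h.fst_pos (Ioo_subset_Ico_self ht)).ne'
  have h3 := (h.snd_pos (Ioo_subset_Ioc_self ht)).ne'
  simp only [Function.comp, limitPath]
  field_simp

theorem scalarEulerPath_limitPath_uniform (h : IsSchedule α β) {T y : ℝ → ℝ}
    (hT : ∀ u v, |T u - T v| ≤ |u - v|) (hTc : Continuous T)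
    (hy : ∀ t, HasDerivAt y (T (t * y t)) t) {S : ℝ} (hS : S ∈ Ico (0 : ℝ) 1) {ε : ℝ}
    (hε : 0 < ε) :
    ∀ᶠ N : ℕ in atTop, ∀ t ∈ Icc (0 : ℝ) S,
      |scalarEulerPath (magDrift α β T 0) N t (y 0) - limitPath α β y t| ≤ ε := by
  obtain ⟨L, hL, hLip⟩ := h.exists_lipschitz_magDrift hT hS.2
  have hM : ∀ t ∈ Icc (0 : ℝ) S, HasDerivWithinAt (limitPath α β y)
      (magDrift α β T 0 t (limitPath α β y t)) (Icc 0 S) t := fun t ht =>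
    h.hasDerivWithinAt_limitPath hy ⟨ht.1, ht.2.trans_lt hS.2⟩ (Icc_subset_Icc_right hS.2.le)
  have := scalarEulerPath_uniform hS.1 hL hLip hM
    (h.continuousOn_magDrift_comp hTc hS.2 fun t ht => (hM t ht).continuousWithinAt) hε
  rwa [h.limitPath_zero] at this

theorem tendsto_scalarEulerPath (h : IsSchedule α β) {T y : ℝ → ℝ}
    (hT : ∀ u v, |T u - T v| ≤ |u - v|) (hTc : Continuous T)
    (hy : ∀ t, HasDerivAt y (T (t * y t)) t) {τ : ℝ} (hτ : τ ∈ Ico (0 : ℝ) 1) :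
    Tendsto (fun N => scalarEulerPath (magDrift α β T 0) N τ (y 0)) atTop
      (𝓝 (limitPath α β y τ)) := by
  rw [Metric.tendsto_atTop']
  intro ε hε
  obtain ⟨N, hN⟩ := eventually_atTop.1
    (h.scalarEulerPath_limitPath_uniform hT hTc hy hτ (half_pos hε))
  refine ⟨N, fun n hn => ?_⟩
  rw [Real.dist_eq]
  have := hN n (le_of_lt hn) τ ⟨hτ.1, le_rfl⟩
  linarith

/-- If the limiting path ends at `1`, then so does the Euler scheme, as its step tends to zero. -/
theorem tendsto_scalarEulerGrid_last (h : IsSchedule α β) {T y : ℝ → ℝ}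
    (hT : ∀ u v, |T u - T v| ≤ |u - v|) (hTc : Continuous T) (hT1 : ∀ u, |T u| ≤ 1)
    (hTlim : Tendsto T atTop (𝓝 1)) (hy : ∀ t, HasDerivAt y (T (t * y t)) t)
    (hM : Tendsto (limitPath α β y) (𝓝[<] 1) (𝓝 1)) :
    Tendsto (fun N => scalarEulerGrid (magDrift α β T 0) N N (y 0)) atTop (𝓝 1) := by
  set w := magDrift α β T 0 with hw
  have hU : ∀ᶠ u in atTop, (1 / 2 : ℝ) ≤ T u :=
    hTlim.eventually_const_le (by norm_num)
  obtain ⟨U, hU⟩ := eventually_atTop.1 hU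
  -- After t₀ a state at least 1/4 makes the argument of T at least |U|, hence T ≥ 1/2.
  have hev := ((hM.eventually_const_le (show (1 / 2 : ℝ) < 1 by norm_num)).and
    (hM.eventually_le_const (show (1 : ℝ) < 2 by norm_num))).and
    ((h.tendsto_snd.eventually_const_le (show (1 / 2 : ℝ) < 1 by norm_num)).and
      (h.tendsto_signal.eventually_ge_atTop (4 * |U|)))
  obtain ⟨t₀, ht₀, hsub⟩ := (mem_nhdsLT_iff_exists_mem_Ico_Ioo_subset (zero_lt_one (α := ℝ))).1 hev
  obtain ⟨C', hC'⟩ := isCompact_Icc.exists_bound_of_continuousOn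
    (continuousOn_timeDeriv h.contDiffOn_snd)
  set C := |C'| with hCdef
  have hC : ∀ t ∈ Icc (0 : ℝ) 1, timeDeriv β t ≤ C := fun t ht =>
    (le_abs_self _).trans ((hC' t ht).trans (le_abs_self _))
  -- For steps shorter than S − t₀, the first grid time after t₀ still lies below S. There uniform
  -- convergence on [0,S] puts the scheme within 1/4 of a path with values in [1/2, 2].
  set S := (t₀ + 1) / 2 with hSdef
  have hS0 : t₀ < S := by rw [hSdef]; linarith [ht₀.2]
  have hS1 : S < 1 := by rw [hSdef]; linarith [ht₀.2]
  have hS : S ∈ Ico (0 : ℝ) 1 := ⟨ht₀.1.trans hS0.le, hS1⟩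
  -- With a = Δτ A in [-1,0], a step is (1 + a) x + (−a β + Δτ β̇) T, almost an average of x and β
  -- T.
  have hstep : ∀ (N k : ℕ) (x : ℝ), x + 1 / (N : ℝ) * w ((k : ℝ) / N) x
      = (1 + 1 / (N : ℝ) * orthRate α β 0 ((k : ℝ) / N)) * x
        + (-(1 / (N : ℝ) * orthRate α β 0 ((k : ℝ) / N)) * β ((k : ℝ) / N)
            + 1 / (N : ℝ) * timeDeriv β ((k : ℝ) / N))
          * T (β ((k : ℝ) / N) * x / (α ((k : ℝ) / N) ^ 2 + 0 * β ((k : ℝ) / N) ^ 2)) := by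
    intro N k x
    rw [hw, magDrift]; ring
  -- the Euler scheme stays positive and bounded on `(t₀, 1)`
  have hinv : ∀ᶠ N : ℕ in atTop, ∀ k : ℕ, t₀ < (k : ℝ) / N → k + 1 ≤ N →
      S ≤ (k : ℝ) / N → scalarEulerGrid w N k (y 0) ∈ Icc (1 / 4 : ℝ) (3 + C) := by
    have hsmall : ∀ᶠ N : ℕ in atTop, 1 / (N : ℝ) < S - t₀ :=
      tendsto_one_div_atTop_nhds_zero_nat.eventually_lt_const (by linarith)
    filter_upwards [hsmall, eventually_ge_atTop 1, h.eventually_step_mem_Icc,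
      h.scalarEulerPath_limitPath_uniform hT hTc hy hS (show (0 : ℝ) < 1 / 4 by norm_num)]
      with N hN hN1 hrate happrox
    have hN0 : (0 : ℝ) < N := by exact_mod_cast hN1
    -- The lower bound 1/4 is preserved because β and T are both at least 1/2. The upper bound grows
    -- by C/N per step to absorb the term Δτ β̇.
    have key : ∀ k : ℕ, t₀ < (k : ℝ) / N → k + 1 ≤ N →
        1 / 4 ≤ scalarEulerGrid w N k (y 0) ∧
        scalarEulerGrid w N k (y 0) ≤ 3 + C * ((k : ℝ) / N) := by
      intro k
      induction k with
      | zero => intro h0; simp at h0; linarith [ht₀.1]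
      | succ k ih =>
        intro hk hkN
        have e : ((k + 1 : ℕ) : ℝ) / N = (k : ℝ) / N + 1 / N := by push_cast; ring
        have hmem := natCast_div_mem_Ico (show k < N by omega)
        rcases le_or_gt ((k : ℝ) / N) t₀ with hle | hgt
        · have hkS : ((k + 1 : ℕ) : ℝ) / N ∈ Icc 0 S := ⟨by positivity, by rw [e]; linarith⟩
          have h1 := abs_le.1 (happrox _ hkS)
          rw [scalarEulerPath_natCast_div hN1] at h1
          have h2 := hsub ⟨hk, hkS.2.trans_lt hS1⟩
          have h3 := h2.1.1
          have h4 := h2.1.2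
          have h5 : 0 ≤ C * (((k + 1 : ℕ) : ℝ) / N) := by positivity
          constructor <;> linarith [h1.1, h1.2]
        · obtain ⟨ih1, ih2⟩ := ih hgt (by omega)
          have hr := hrate k (by omega)
          have h2 := hsub ⟨hgt, hmem.2⟩
          have hβ : 1 / 2 ≤ β ((k : ℝ) / N) := h2.2.1
          have hsig : 4 * |U| ≤ β ((k : ℝ) / N) / (α ((k : ℝ) / N) ^ 2 + 0 * β ((k : ℝ) / N) ^ 2) :=
            h2.2.2
          have hβ1 := h.snd_le_one (Ico_subset_Icc_self hmem)
          have hβ' := h.timeDeriv_snd_pos _ (Ico_subset_Icc_self hmem)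
          have hβC := hC _ (Ico_subset_Icc_self hmem)
          rw [scalarEulerGrid, hstep]
          set x := scalarEulerGrid w N k (y 0)
          have hTx : 1 / 2 ≤ T (β ((k : ℝ) / N) * x
              / (α ((k : ℝ) / N) ^ 2 + 0 * β ((k : ℝ) / N) ^ 2)) := by
            refine hU _ ?_
            rw [mul_div_right_comm]
            have : 4 * |U| * (1 / 4) ≤ β ((k : ℝ) / N)
                / (α ((k : ℝ) / N) ^ 2 + 0 * β ((k : ℝ) / N) ^ 2) * x :=
              mul_le_mul hsig ih1 (by norm_num) ((by positivity : (0 : ℝ) ≤ 4 * |U|).trans hsig)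
            linarith [le_abs_self U]
          have hTx1 := (abs_le.1 (hT1 (β ((k : ℝ) / N) * x
              / (α ((k : ℝ) / N) ^ 2 + 0 * β ((k : ℝ) / N) ^ 2)))).2
          generalize T (β ((k : ℝ) / N) * x
              / (α ((k : ℝ) / N) ^ 2 + 0 * β ((k : ℝ) / N) ^ 2)) = Tx at hTx hTx1 ⊢
          generalize 1 / (N : ℝ) * orthRate α β 0 ((k : ℝ) / N) = a at hr ⊢
          generalize β ((k : ℝ) / N) = b at hβ hβ1 ⊢
          have hg : 0 < 1 / (N : ℝ) * timeDeriv β ((k : ℝ) / N) := by positivity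
          have hgC : 1 / (N : ℝ) * timeDeriv β ((k : ℝ) / N) ≤ C * (1 / N) := by
            rw [mul_comm C]; gcongr
          rw [e, mul_add]
          generalize 1 / (N : ℝ) * timeDeriv β ((k : ℝ) / N) = g at hg hgC ⊢
          obtain ⟨hr1, hr2⟩ := hr
          have hCk : 0 ≤ C * ((k : ℝ) / N) := by positivity
          have hab : -a * b ≤ -a := by nlinarith
          have hab' : -a * (1 / 2) ≤ -a * b := by nlinarith
          have q1 : (1 + a) * (1 / 4) ≤ (1 + a) * x := by
            apply mul_le_mul_of_nonneg_left ih1; linarith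
          have q2 : (1 + a) * x ≤ (1 + a) * (3 + C * ((k : ℝ) / N)) := by
            apply mul_le_mul_of_nonneg_left ih2; linarith
          have q3 : 0 ≤ -a * b + g := by nlinarith
          constructor
          · have : (-a * b + g) * (1 / 2) ≤ (-a * b + g) * Tx :=
              mul_le_mul_of_nonneg_left hTx q3
            linarith
          · have : (-a * b + g) * Tx ≤ (-a * b + g) * 1 :=
              mul_le_mul_of_nonneg_left hTx1 q3
            nlinarith
    intro k hk hkN _
    obtain ⟨h1, h2⟩ := key k hk hkN
    refine ⟨h1, h2.trans ?_⟩
    have := (natCast_div_mem_Ico (show k < N by omega)).2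
    have hC0 : 0 ≤ C := abs_nonneg _
    nlinarith
  -- the last step
  rw [← tendsto_add_atTop_iff_nat 1]
  have htime := tendsto_last_time
  have hx : ∀ᶠ N : ℕ in atTop,
      scalarEulerGrid w (N + 1) N (y 0) ∈ Icc (1 / 4 : ℝ) (3 + C) := by
    filter_upwards [(tendsto_add_atTop_nat 1).eventually hinv,
      htime.eventually (Ioo_mem_nhdsLT hS1)] with N h1 h2
    exact h1 N (hS0.trans h2.1) le_rfl h2.1.le
  -- The state before the last step need not be known: it is bounded and its coefficient tends to 0.
  have hbd : Tendsto (fun N : ℕ =>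
      (1 + 1 / ((N + 1 : ℕ) : ℝ) * orthRate α β 0 ((N : ℝ) / ((N + 1 : ℕ) : ℝ)))
        * scalarEulerGrid w (N + 1) N (y 0)) atTop (𝓝 0) := by
    have h0 := h.tendsto_last_step.const_add 1
    rw [add_neg_cancel] at h0
    refine h0.zero_mul_isBoundedUnder_le ?_
    refine isBoundedUnder_of_eventually_le (a := 3 + C) ?_
    filter_upwards [hx] with N hN
    rw [Function.comp, Real.norm_eq_abs, abs_of_nonneg (by linarith [hN.1])]
    exact hN.2
  have hTl : Tendsto (fun N : ℕ => T (β ((N : ℝ) / ((N + 1 : ℕ) : ℝ))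
      * scalarEulerGrid w (N + 1) N (y 0) / (α ((N : ℝ) / ((N + 1 : ℕ) : ℝ)) ^ 2
        + 0 * β ((N : ℝ) / ((N + 1 : ℕ) : ℝ)) ^ 2))) atTop (𝓝 1) := by
    refine hTlim.comp ?_
    have h1 := (h.tendsto_signal.comp htime).atTop_mul_const (show (0 : ℝ) < 1 / 4 by norm_num)
    refine tendsto_atTop_mono' _ ?_ h1
    filter_upwards [hx, (h.tendsto_signal.comp htime).eventually_ge_atTop 0] with N hN hs
    rw [mul_div_right_comm]
    exact mul_le_mul_of_nonneg_left hN.1 hs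
  have hβl := h.tendsto_snd.comp htime
  have hgl : Tendsto (fun N : ℕ => 1 / ((N + 1 : ℕ) : ℝ)
      * timeDeriv β ((N : ℝ) / ((N + 1 : ℕ) : ℝ))) atTop (𝓝 0) := by
    have h0 : Tendsto (fun N : ℕ => 1 / ((N + 1 : ℕ) : ℝ)) atTop (𝓝 0) :=
      tendsto_one_div_atTop_nhds_zero_nat.comp (tendsto_add_atTop_nat 1)
    refine h0.zero_mul_isBoundedUnder_le (isBoundedUnder_of_eventually_le (a := C') ?_)
    exact Eventually.of_forall fun N =>
      hC' _ (Ico_subset_Icc_self (natCast_div_mem_Ico (Nat.lt_succ_self N)))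
  -- What remains is the coefficient −a β + Δτ β̇ → 1 times T at an argument tending to +∞.
  have hfin := hbd.add (((h.tendsto_last_step.neg.mul hβl).add hgl).mul hTl)
  simp only [neg_neg, mul_one, add_zero, zero_add] at hfin
  refine hfin.congr fun N => ?_
  rw [scalarEulerGrid, hstep]
  simp only [Function.comp]

end IsSchedule

/-- The exchange of the modes commutes with the Euler scheme, so endings at −1 reduce to endings at
1. -/
theorem scalarEulerGrid_neg (α β T : ℝ → ℝ) (q : ℝ) (N k : ℕ) (m : ℝ) :
    scalarEulerGrid (magDrift α β (fun u => -T (-u)) q) N k (-m)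
      = -scalarEulerGrid (magDrift α β T q) N k m := by
  induction k with
  | zero => rfl
  | succ k ih =>
    have e : ∀ b x V : ℝ, -(b * -x / V) = b * x / V := fun b x V => by ring
    rw [scalarEulerGrid, scalarEulerGrid, ih, magDrift, magDrift, e]
    ring

end LimitPath

/-! ### The limit d → ∞ at a fixed step. -/

section LargeDimension

variable {α β : ℝ → ℝ}

theorem tendsto_state_var (α β : ℝ → ℝ) {q : ℕ → ℝ} (hq : Tendsto q atTop (𝓝 0)) (τ : ℝ) :
    Tendsto (fun d => α τ ^ 2 + q d * β τ ^ 2) atTop (𝓝 (α τ ^ 2 + 0 * β τ ^ 2)) :=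
  (hq.mul_const _).const_add _

theorem tendsto_orthRate {q : ℕ → ℝ} (hq : Tendsto q atTop (𝓝 0)) {τ : ℝ} (hτ : α τ ≠ 0) :
    Tendsto (fun d => orthRate α β (q d) τ) atTop (𝓝 (orthRate α β 0 τ)) :=
  ((hq.mul_const _).const_add _).div (tendsto_state_var α β hq τ) (by simpa using hτ)

theorem tendsto_magDrift {T : ℝ → ℝ} (hT : Continuous T) {q x : ℕ → ℝ}
    (hq : Tendsto q atTop (𝓝 0)) {τ : ℝ} (hτ : α τ ≠ 0) {y : ℝ} (hx : Tendsto x atTop (𝓝 y)) :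
    Tendsto (fun d => magDrift α β T (q d) τ (x d)) atTop (𝓝 (magDrift α β T 0 τ y)) := by
  have hA := tendsto_orthRate (β := β) hq hτ
  exact (hA.mul hx).add (((hA.mul_const _).const_sub _).mul
    ((hT.tendsto _).comp ((hx.const_mul _).div (tendsto_state_var α β hq τ) (by simpa using hτ))))

namespace IsSchedule

/-- Every drift used is evaluated before time 1, where α > 0 and the drift is continuous at q = 0.
-/
theorem tendsto_scalarEulerGrid_magDrift (h : IsSchedule α β) {T : ℝ → ℝ} (hT : Continuous T)
    {q : ℕ → ℝ} (hq : Tendsto q atTop (𝓝 0)) (N : ℕ) (m : ℝ) {k : ℕ} (hk : k ≤ N) :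
    Tendsto (fun d => scalarEulerGrid (magDrift α β T (q d)) N k m) atTop
      (𝓝 (scalarEulerGrid (magDrift α β T 0) N k m)) := by
  induction k with
  | zero => exact tendsto_const_nhds
  | succ k ih =>
    exact (ih (by omega)).add ((tendsto_magDrift hT hq
      (h.fst_pos (natCast_div_mem_Ico (by omega))).ne' (ih (by omega))).const_mul _)

theorem tendsto_scalarEulerPath_magDrift (h : IsSchedule α β) {T : ℝ → ℝ} (hT : Continuous T)
    {q : ℕ → ℝ} (hq : Tendsto q atTop (𝓝 0)) {N : ℕ} (hN : 1 ≤ N) {τ : ℝ}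
    (hτ : τ ∈ Icc (0 : ℝ) 1) (m : ℝ) :
    Tendsto (fun d => scalarEulerPath (magDrift α β T (q d)) N τ m) atTop
      (𝓝 (scalarEulerPath (magDrift α β T 0) N τ m)) := by
  have hN0 : (0 : ℝ) < N := by exact_mod_cast hN
  have hfl : ⌊τ * N⌋₊ ≤ N := floor_mul_le hτ.2
  have hg := h.tendsto_scalarEulerGrid_magDrift hT hq N m hfl
  rcases hfl.lt_or_eq with hlt | heq
  · exact hg.add ((tendsto_magDrift hT hq (h.fst_pos (natCast_div_mem_Ico hlt)).ne' hg).const_mul _)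
  · have h1 : τ - (⌊τ * N⌋₊ : ℝ) / N = 0 := by
      have h2 := Nat.floor_le (mul_nonneg hτ.1 hN0.le)
      rw [heq] at h2 ⊢
      have h3 : 1 ≤ τ := le_of_mul_le_mul_right (by simpa using h2) hN0
      rw [div_self hN0.ne', le_antisymm hτ.2 h3, sub_self]
    simp only [scalarEulerPath, h1, zero_mul, add_zero]
    exact hg

theorem tendsto_orthFactor (h : IsSchedule α β) {q : ℕ → ℝ} (hq : Tendsto q atTop (𝓝 0)) (N : ℕ) :
    Tendsto (fun d => orthFactor α β (q d) N N) atTop (𝓝 (orthFactor α β 0 N N)) := by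
  refine tendsto_finsetProd _ fun i hi => ?_
  exact ((tendsto_orthRate hq
    (h.fst_pos (natCast_div_mem_Ico (Finset.mem_range.1 hi))).ne').const_mul _).const_add _

/-- The difference of the rates is q times a convergent quantity. -/
theorem tendsto_mul_orthRate_sub (h : IsSchedule α β) {q c : ℕ → ℝ}
    (hq : Tendsto q atTop (𝓝 0)) (hq0 : ∀ d, 0 ≤ q d) (hcq : Tendsto (fun d => c d * q d) atTop (𝓝 0))
    {τ : ℝ} (hτ : τ ∈ Ico (0 : ℝ) 1) :
    Tendsto (fun d => c d * (orthRate α β (q d) τ - orthRate α β 0 τ)) atTop (𝓝 0) := by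
  have hα := h.fst_pos hτ
  have hv : Tendsto (fun d => β τ * (α τ * timeDeriv β τ - timeDeriv α τ * β τ) / α τ
      / (α τ ^ 2 + q d * β τ ^ 2)) atTop
      (𝓝 (β τ * (α τ * timeDeriv β τ - timeDeriv α τ * β τ) / α τ
        / (α τ ^ 2 + 0 * β τ ^ 2))) :=
    tendsto_const_nhds.div (tendsto_state_var α β hq τ) (by simpa using hα.ne')
  have hlim := hcq.mul hv
  rw [zero_mul] at hlim
  refine hlim.congr fun d => ?_
  have hV : α τ ^ 2 + q d * β τ ^ 2 ≠ 0 := by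
    have := hq0 d
    positivity
  rw [orthRate_zero hα.ne', orthRate]
  field_simp
  ring

/-- If the limit of the contraction factor vanishes, then the factor is of the order of `q`. -/
theorem tendsto_mul_abs_orthFactor (h : IsSchedule α β) {q c : ℕ → ℝ}
    (hq : Tendsto q atTop (𝓝 0)) (hq0 : ∀ d, 0 ≤ q d)
    (hcq : Tendsto (fun d => c d * q d) atTop (𝓝 0)) {N : ℕ} (hN : orthFactor α β 0 N N = 0) :
    Tendsto (fun d => c d * |orthFactor α β (q d) N N|) atTop (𝓝 0) := by
  -- One factor vanishes at q = 0, hence is of order q; the other factors converge.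
  obtain ⟨i, hi, hi0⟩ := Finset.prod_eq_zero_iff.1 hN
  have hmem := natCast_div_mem_Ico (Finset.mem_range.1 hi)
  have h1 : Tendsto (fun d => c d * (1 + 1 / (N : ℝ) * orthRate α β (q d) ((i : ℝ) / N))) atTop
      (𝓝 0) := by
    have := (h.tendsto_mul_orthRate_sub hq hq0 hcq hmem).const_mul (1 / (N : ℝ))
    rw [mul_zero] at this
    refine this.congr fun d => ?_
    linear_combination (-c d) * hi0
  have h2 : Tendsto (fun d => ∏ j ∈ (Finset.range N).erase i,
      (1 + 1 / (N : ℝ) * orthRate α β (q d) ((j : ℝ) / N))) atTop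
      (𝓝 (∏ j ∈ (Finset.range N).erase i, (1 + 1 / (N : ℝ) * orthRate α β 0 ((j : ℝ) / N)))) := by
    refine tendsto_finsetProd _ fun j hj => ?_
    exact ((tendsto_orthRate hq (h.fst_pos (natCast_div_mem_Ico
      (Finset.mem_range.1 (Finset.mem_of_mem_erase hj)))).ne').const_mul _).const_add _
  have h3 := (h1.mul h2).abs
  rw [zero_mul, abs_zero] at h3
  have h4 : Tendsto (fun d => abs (c d * |orthFactor α β (q d) N N|)) atTop (𝓝 0) := by
    refine h3.congr fun d => ?_
    rw [orthFactor, ← Finset.mul_prod_erase _ _ hi]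
    simp only [abs_mul, abs_abs]
    ring
  exact (tendsto_zero_iff_abs_tendsto_zero _).2 h4

end IsSchedule

end LargeDimension

/-! ### Uncertainty of the mode and the speciation time. -/

section Speciation

variable {α β : ℝ → ℝ} {p : ℝ}

/-- The minimal mean square error in the estimation of a sign `s`, equal to `1` with probability
`p`, from `η s + g` with `g` standard Gaussian. -/
noncomputable def signMMSE (p η : ℝ) : ℝ :=
  p * (∫ g, (1 - mixtureTanh p (η ^ 2 + η * g)) ^ 2 ∂(gaussianReal 0 1))
    + (1 - p) * (∫ g, (-1 - mixtureTanh p (-η ^ 2 + η * g)) ^ 2 ∂(gaussianReal 0 1))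

theorem sq_sign_sub_mixtureTanh_le (hp : p ∈ Icc (0 : ℝ) 1) {s : ℝ} (hs : |s| ≤ 1) (u : ℝ) :
    ‖(s - mixtureTanh p u) ^ 2‖ ≤ 4 := by
  have h1 := abs_le.1 (abs_mixtureTanh_le_one hp u)
  have h2 := abs_le.1 hs
  rw [Real.norm_eq_abs, abs_of_nonneg (sq_nonneg _)]
  nlinarith

theorem continuous_signMMSE (hp : p ∈ Icc (0 : ℝ) 1) : Continuous (signMMSE p) := by
  have hT := continuous_mixtureTanh hp
  refine (continuous_const.mul ?_).add (continuous_const.mul ?_)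
  · refine continuous_of_dominated (bound := fun _ => 4)
      (fun η => (by fun_prop : Continuous _).aestronglyMeasurable)
      (fun η => ae_of_all _ fun g => sq_sign_sub_mixtureTanh_le hp (by simp) _)
      (integrable_const _) (ae_of_all _ fun g => by fun_prop)
  · refine continuous_of_dominated (bound := fun _ => 4)
      (fun η => (by fun_prop : Continuous _).aestronglyMeasurable)
      (fun η => ae_of_all _ fun g => sq_sign_sub_mixtureTanh_le hp (by simp) _)
      (integrable_const _) (ae_of_all _ fun g => by fun_prop)

theorem signMMSE_zero (p : ℝ) : signMMSE p 0 = 4 * p * (1 - p) := by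
  have : mixtureTanh p 0 = 2 * p - 1 := by
    rw [mixtureTanh]
    simp only [neg_zero, Real.exp_zero, mul_one, add_sub_cancel, div_one]
    ring
  simp only [signMMSE, ne_eq, OfNat.ofNat_ne_zero, not_false_eq_true, zero_pow, neg_zero, zero_mul,
    add_zero, this, integral_const, probReal_univ, one_smul]
  ring

theorem tendsto_sq_add_mul_atTop (g : ℝ) : Tendsto (fun η : ℝ => η ^ 2 + η * g) atTop atTop := by
  have := tendsto_id.atTop_mul_atTop₀ (tendsto_atTop_add_const_right atTop g tendsto_id)
  refine this.congr fun η => ?_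
  simp only [id]
  ring

theorem tendsto_signMMSE_atTop (hp : p ∈ Icc (0 : ℝ) 1) (h0 : 0 < p) (h1 : p < 1) :
    Tendsto (signMMSE p) atTop (𝓝 0) := by
  have hT := continuous_mixtureTanh hp
  have hbot : Tendsto (fun u => mixtureTanh p (-u)) atTop (𝓝 (-1)) := by
    have := (tendsto_mixtureTanh_atTop (p := 1 - p) (by linarith)).neg
    refine this.congr fun u => ?_
    rw [mixtureTanh_one_sub, neg_neg]
  have l1 : Tendsto (fun η : ℝ => ∫ g, (1 - mixtureTanh p (η ^ 2 + η * g)) ^ 2 ∂(gaussianReal 0 1))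
      atTop (𝓝 (∫ _, 0 ∂(gaussianReal 0 1))) := by
    refine tendsto_integral_filter_of_dominated_convergence (fun _ => 4)
      (Eventually.of_forall fun η => (by fun_prop : Continuous _).aestronglyMeasurable)
      (Eventually.of_forall fun η => ae_of_all _ fun g =>
        sq_sign_sub_mixtureTanh_le hp (by simp) _) (integrable_const _) (ae_of_all _ fun g => ?_)
    have := (((tendsto_mixtureTanh_atTop h0).comp (tendsto_sq_add_mul_atTop g)).const_sub 1).pow 2
    simpa using this
  have l2 : Tendsto (fun η : ℝ => ∫ g, (-1 - mixtureTanh p (-η ^ 2 + η * g)) ^ 2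
      ∂(gaussianReal 0 1)) atTop (𝓝 (∫ _, 0 ∂(gaussianReal 0 1))) := by
    refine tendsto_integral_filter_of_dominated_convergence (fun _ => 4)
      (Eventually.of_forall fun η => (by fun_prop : Continuous _).aestronglyMeasurable)
      (Eventually.of_forall fun η => ae_of_all _ fun g =>
        sq_sign_sub_mixtureTanh_le hp (by simp) _) (integrable_const _) (ae_of_all _ fun g => ?_)
    have := ((hbot.comp (tendsto_sq_add_mul_atTop (-g))).const_sub (-1)).pow 2
    simp only [sub_self, ne_eq, OfNat.ofNat_ne_zero, not_false_eq_true, zero_pow] at this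
    refine this.congr fun η => ?_
    simp only [Function.comp]
    congr 3
    ring
  have := (l1.const_mul p).add (l2.const_mul (1 - p))
  simp only [integral_zero, mul_zero, add_zero] at this
  exact this

/-- The distance of the modes of the interpolant, in units of its standard deviation. -/
noncomputable def signalRatio (α β : ℝ → ℝ) (q τ : ℝ) : ℝ := β τ / √(α τ ^ 2 + q * β τ ^ 2)

theorem integral_inner_stdGaussian {d : ℕ} {u : EuclideanSpace ℝ (Fin d)} {η : ℝ}
    (hu : ‖u‖ ^ 2 = η ^ 2) {f : ℝ → ℝ} (hf : Measurable f) :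
    ∫ g, f ⟪u, g⟫ ∂(stdGaussian (EuclideanSpace ℝ (Fin d)))
      = ∫ x, f (η * x) ∂(gaussianReal 0 1) := by
  rw [← integral_map (φ := fun g => ⟪u, g⟫) (by fun_prop) hf.aestronglyMeasurable,
    map_inner_stdGaussian, ← integral_map (φ := fun x => η * x) (by fun_prop)
    hf.aestronglyMeasurable, gaussianReal_map_const_mul]
  congr
  · simp
  · rw [hu, mul_one]
    ext
    simp [sq_nonneg]

/-- The posterior mean sees only the projection of the state on r. Given the sign s, its argument is
distributed as s η² + η g, with η the signal ratio and g standard Gaussian. -/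
theorem modeUncertainty_eq_signMMSE (h : IsSchedule α β) (hp : p ∈ Icc (0 : ℝ) 1) {d : ℕ}
    (hd : 1 ≤ d) {r : EuclideanSpace ℝ (Fin d)} (hr : ‖r‖ ^ 2 = d) {σ : ℝ} (hσ : 0 < σ) {τ : ℝ}
    (hτ : τ ∈ Icc (0 : ℝ) 1) :
    modeUncertainty (√d) α β p r σ τ = signMMSE p (signalRatio α β (σ ^ 2 / d) τ) := by
  have hd0 : (0 : ℝ) < d := by exact_mod_cast hd
  have hV := h.state_var_pos (c := √d) (Real.sqrt_pos.2 hd0) hσ hτ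
  have hT := (continuous_mixtureTanh hp).measurable
  have hq : 0 < σ ^ 2 / d := by positivity
  have hVq := h.var_pos hq hτ
  have eV : (√(d : ℝ) * α τ) ^ 2 + (β τ * σ) ^ 2 = d * (α τ ^ 2 + σ ^ 2 / d * β τ ^ 2) := by
    field_simp
    linear_combination (α τ ^ 2) * Real.sq_sqrt hd0.le
  set η := signalRatio α β (σ ^ 2 / d) τ with hη
  have hη2 : η ^ 2 = β τ ^ 2 / (α τ ^ 2 + σ ^ 2 / d * β τ ^ 2) := by
    rw [hη, signalRatio, div_pow, Real.sq_sqrt hVq.le]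
  have hcond := mixtureTanh_ae_eq_condExp hp r hV
  set V := (√(d : ℝ) * α τ) ^ 2 + (β τ * σ) ^ 2 with hVdef
  set v := √V with hvdef
  have hv : 0 < v := Real.sqrt_pos.2 hV
  have hv2 : v ^ 2 = V := Real.sq_sqrt hV.le
  have hsig : β τ ^ 2 * d / V = η ^ 2 := by
    rw [hη2, eV]
    field_simp
  have hcongr : modeUncertainty (√d) α β p r σ τ
      = ∫ ω, (ω.2.1 - mixtureTanh p (⟪β τ • r, (√d * α τ) • ω.1 + β τ • ω.2.2⟫ / V)) ^ 2
        ∂((stdGaussian (EuclideanSpace ℝ (Fin d))).prod (labelledMixture p r σ)) := by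
    refine integral_congr_ae ?_
    filter_upwards [hcond] with ω hω
    rw [hω]
    rfl
  have hcomp : ∀ s : ℝ, s * s = 1 → ∫ w, (s - mixtureTanh p (⟪β τ • r,
        (√d * α τ) • w.1 + β τ • (s • r + σ • w.2)⟫ / V)) ^ 2
        ∂((stdGaussian (EuclideanSpace ℝ (Fin d))).prod (stdGaussian (EuclideanSpace ℝ (Fin d))))
      = ∫ g, (s - mixtureTanh p (s * η ^ 2 + η * g)) ^ 2 ∂(gaussianReal 0 1) := by
    intro s hs
    have e1 : ∀ w : EuclideanSpace ℝ (Fin d) × EuclideanSpace ℝ (Fin d),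
        ⟪β τ • r, (√d * α τ) • w.1 + β τ • (s • r + σ • w.2)⟫ / V
          = s * η ^ 2 + ⟪(β τ / V) • r, (√d * α τ) • w.1 + (β τ * σ) • w.2⟫ := by
      intro w
      rw [← hsig, ← hr, ← real_inner_self_eq_norm_sq]
      simp only [inner_add_right, real_inner_smul_left, real_inner_smul_right]
      ring
    simp_rw [e1]
    rw [integral_gaussian_comb (a := √d * α τ) (b := β τ * σ) hv hv2.symm
      (f := fun y => (s - mixtureTanh p (s * η ^ 2 + ⟪(β τ / V) • r, y⟫)) ^ 2)
      (Measurable.stronglyMeasurable (by fun_prop))]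
    have e2 : ∀ g : EuclideanSpace ℝ (Fin d), ⟪(β τ / V) • r, v • g⟫ = ⟪(v * (β τ / V)) • r, g⟫ := by
      intro g
      rw [real_inner_smul_right, mul_smul]
      exact (real_inner_smul_left _ _ _).symm
    simp_rw [e2]
    refine integral_inner_stdGaussian (u := (v * (β τ / V)) • r)
      (f := fun x => (s - mixtureTanh p (s * η ^ 2 + x)) ^ 2) ?_ (by fun_prop)
    rw [norm_smul, mul_pow, hr, Real.norm_eq_abs, sq_abs, mul_pow, hv2, ← hsig]
    field_simp
  rw [hcongr, prod_labelledMixture, integral_two_point_mixture hp (by fun_prop) (by fun_prop)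
    (Measurable.stronglyMeasurable (by fun_prop))]
  · have c1 := hcomp 1 (by norm_num)
    have c2 := hcomp (-1) (by norm_num)
    rw [one_smul, one_mul] at c1
    rw [neg_one_smul, neg_one_mul] at c2
    rw [smul_eq_mul, smul_eq_mul, c1, c2, signMMSE]
  · exact Integrable.of_bound (Measurable.aestronglyMeasurable (by fun_prop)) 4
      (ae_of_all _ fun w => sq_sign_sub_mixtureTanh_le hp (by simp) _)
  · exact Integrable.of_bound (Measurable.aestronglyMeasurable (by fun_prop)) 4
      (ae_of_all _ fun w => sq_sign_sub_mixtureTanh_le hp (by simp) _)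

namespace IsSchedule

theorem signalRatio_zero (h : IsSchedule α β) {τ : ℝ} (hτ : τ ∈ Icc (0 : ℝ) 1) :
    signalRatio α β 0 τ = β τ / α τ := by
  rw [signalRatio, zero_mul, add_zero, Real.sqrt_sq (h.fst_nonneg hτ)]

theorem continuousOn_signalRatio (h : IsSchedule α β) {q : ℝ} (hq : 0 < q) :
    ContinuousOn (signalRatio α β q) (Icc 0 1) := by
  have h1 := h.contDiffOn_fst.continuousOn
  have h2 := h.contDiffOn_snd.continuousOn
  have hne : ∀ t ∈ Icc (0 : ℝ) 1, √(α t ^ 2 + q * β t ^ 2) ≠ 0 := fun t ht =>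
    (Real.sqrt_pos.2 (h.var_pos hq ht)).ne'
  unfold signalRatio
  fun_prop (disch := assumption)

/-- After squaring and cross-multiplying, the terms in q coincide and β(s) α(t) ≤ β(t) α(s) remains.
-/
theorem monotoneOn_signalRatio (h : IsSchedule α β) {q : ℝ} (hq : 0 < q) :
    MonotoneOn (signalRatio α β q) (Icc 0 1) := by
  intro s hs t ht hst
  have h1 := h.strictAntiOn.antitoneOn hs ht hst
  have h2 := h.strictMonoOn.monotoneOn hs ht hst
  have h3 := h.fst_nonneg ht
  have h4 := h.snd_nonneg hs
  have h5 := h.var_pos hq hs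
  have h6 := h.var_pos hq ht
  have h7 : 0 ≤ β t := h4.trans h2
  rw [signalRatio, signalRatio, div_le_div_iff₀ (Real.sqrt_pos.2 h5) (Real.sqrt_pos.2 h6)]
  refine le_of_sq_le_sq ?_ (by positivity)
  rw [mul_pow, mul_pow, Real.sq_sqrt h5.le, Real.sq_sqrt h6.le]
  have : β s * α t ≤ β t * α s := mul_le_mul h2 h1 h3 h7
  have h8 : 0 ≤ β s * α t := by positivity
  nlinarith

theorem signalRatio_le (h : IsSchedule α β) {q : ℝ} (hq : 0 ≤ q) {τ : ℝ} (hτ : τ ∈ Ico (0 : ℝ) 1) :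
    signalRatio α β q τ ≤ β τ / α τ := by
  have h1 := h.fst_pos hτ
  refine div_le_div_of_nonneg_left (h.snd_nonneg (Ico_subset_Icc_self hτ)) h1 ?_
  refine Real.le_sqrt_of_sq_le ?_
  have : 0 ≤ q * β τ ^ 2 := by positivity
  linarith

theorem tendsto_signalRatio (h : IsSchedule α β) {q : ℕ → ℝ} (hq : Tendsto q atTop (𝓝 0)) {τ : ℝ}
    (hτ : τ ∈ Ico (0 : ℝ) 1) :
    Tendsto (fun d => signalRatio α β (q d) τ) atTop (𝓝 (β τ / α τ)) := by
  rw [← h.signalRatio_zero (Ico_subset_Icc_self hτ)]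
  refine tendsto_const_nhds.div ((tendsto_state_var α β hq τ).sqrt) ?_
  rw [zero_mul, add_zero, Real.sqrt_sq (h.fst_pos hτ).le]
  exact (h.fst_pos hτ).ne'

/-- At the final time α vanishes and the ratio is 1/√q. -/
theorem tendsto_signalRatio_one (h : IsSchedule α β) {q : ℕ → ℝ} (hq : Tendsto q atTop (𝓝 0))
    (hq0 : ∀ᶠ d in atTop, 0 < q d) :
    Tendsto (fun d => signalRatio α β (q d) 1) atTop atTop := by
  have h1 : Tendsto (fun d => √(q d)) atTop (𝓝[>] 0) := by
    refine tendsto_nhdsWithin_iff.2 ⟨by simpa using hq.sqrt, ?_⟩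
    filter_upwards [hq0] with d hd
    exact Real.sqrt_pos.2 hd
  refine (tendsto_inv_nhdsGT_zero.comp h1).congr fun d => ?_
  simp [signalRatio, h.fst_one, h.snd_one]

/-- The last time at which a function of the signal ratio exceeds a given level converges. -/
theorem exists_tendsto_sInf (h : IsSchedule α β) {U : ℝ → ℝ} {ε : ℝ} (hU : ContinuousAt U 0)
    (hU0 : ε < U 0) (hUlim : ∀ᶠ η in atTop, U η ≤ ε) {q : ℕ → ℝ} (hq : Tendsto q atTop (𝓝 0))
    (hq0 : ∀ᶠ d in atTop, 0 < q d) :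
    ∃ τs ∈ Ioo (0 : ℝ) 1, Tendsto (fun d => sInf {τ ∈ Icc (0 : ℝ) 1 |
      ∀ t ∈ Icc τ 1, U (signalRatio α β (q d) t) ≤ ε}) atTop (𝓝 τs) := by
  -- Monotonicity of `U` is not needed: the supremum ηs of this set is the threshold, and τs is the
  -- time at which β/α reaches it.
  set E := {η : ℝ | ε < U η} with hE
  obtain ⟨B, hB⟩ := eventually_atTop.1 hUlim
  have hbdd : BddAbove E := ⟨B, fun η hη => le_of_not_gt fun hlt =>
    absurd (hB η hlt.le) (not_le.2 hη)⟩
  set ηs := sSup E with hηs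
  have hηs0 : 0 < ηs := by
    obtain ⟨δ, hδ, hball⟩ := Metric.eventually_nhds_iff.1 (hU.eventually_const_lt hU0)
    have hmem : δ / 2 ∈ E := hball (by
      rw [Real.dist_eq, sub_zero, abs_of_pos (half_pos hδ)]; linarith)
    exact (half_pos hδ).trans_le (le_csSup hbdd hmem)
  have habove : ∀ η, ηs < η → U η ≤ ε := fun η hη =>
    not_lt.1 fun hlt => absurd (le_csSup hbdd hlt) (not_le.2 hη)
  have hcont : ∀ t₁ < 1, ContinuousOn (fun t => β t / α t) (Icc 0 t₁) := fun t₁ ht₁ => by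
    have hsub : Icc 0 t₁ ⊆ Icc (0 : ℝ) 1 := Icc_subset_Icc_right ht₁.le
    exact (h.contDiffOn_snd.continuousOn.mono hsub).div (h.contDiffOn_fst.continuousOn.mono hsub)
      fun t ht => (h.fst_pos ⟨ht.1, ht.2.trans_lt ht₁⟩).ne'
  have hmono : ∀ s ∈ Ico (0 : ℝ) 1, ∀ t ∈ Ico (0 : ℝ) 1, s < t → β s / α s < β t / α t := by
    intro s hs t ht hst
    rw [div_lt_div_iff₀ (h.fst_pos hs) (h.fst_pos ht)]
    have h1 := h.strictAntiOn (Ico_subset_Icc_self hs) (Ico_subset_Icc_self ht) hst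
    have h2 := h.strictMonoOn (Ico_subset_Icc_self hs) (Ico_subset_Icc_self ht) hst
    have h3 := h.snd_nonneg (Ico_subset_Icc_self hs)
    exact mul_lt_mul'' h2 h1 h3 (h.fst_pos ht).le
  obtain ⟨τs, hτs, hτsη⟩ : ∃ τs ∈ Ioo (0 : ℝ) 1, β τs / α τs = ηs := by
    obtain ⟨t₁, h1, h2⟩ := ((h.tendsto_ratio.eventually_gt_atTop ηs).and
      (Ioo_mem_nhdsLT (zero_lt_one (α := ℝ)))).exists
    obtain ⟨τs, hτs, he⟩ := intermediate_value_Icc h2.1.le (hcont t₁ h2.2)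
      (show ηs ∈ Icc (β 0 / α 0) (β t₁ / α t₁) from
        ⟨by rw [h.snd_zero, zero_div]; exact hηs0.le, h1.le⟩)
    refine ⟨τs, ⟨hτs.1.lt_of_ne ?_, hτs.2.trans_lt h2.2⟩, he⟩
    rintro rfl
    simp only [h.snd_zero, zero_div] at he
    exact hηs0.ne he
  have hτs' := Ioo_subset_Ico_self hτs
  refine ⟨τs, hτs, tendsto_order.2 ⟨fun a ha => ?_, fun a ha => ?_⟩⟩
  · obtain ⟨τ, hτ1, hτ2⟩ := exists_between (max_lt ha hτs.1)
    have hτ : τ ∈ Ico (0 : ℝ) 1 := ⟨((le_max_right _ _).trans_lt hτ1).le, hτ2.trans hτs.2⟩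
    have hlt : β τ / α τ < ηs := by
      rw [← hτsη]; exact hmono τ hτ τs hτs' hτ2
    -- For a time τ < τs, pick a bad ratio η above β/α at τ. At finite q the ratio is below η at τ
    -- and above η at time 1, so it takes the value η after τ.
    obtain ⟨η, hηE, hη⟩ := exists_lt_of_lt_csSup ⟨0, hU0⟩ hlt
    have hone := h.tendsto_signalRatio_one hq hq0
    filter_upwards [hone.eventually_ge_atTop η, hone.eventually_gt_atTop ηs, hq0]
      with d hd1 hd2 hd3
    -- The set must be shown nonempty, since the infimum of the empty set is 0 by convention; it
    -- contains 1.
    refine ((le_max_left _ _).trans_lt hτ1).trans_le (le_csInf ⟨1, by simp, ?_⟩ ?_)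
    · intro t ht
      rw [le_antisymm ht.2 ht.1]
      exact habove _ hd2
    · rintro τ' ⟨-, hτ'⟩
      obtain ⟨t, ht, he⟩ := intermediate_value_Icc hτ.2.le
        ((h.continuousOn_signalRatio hd3).mono (Icc_subset_Icc_left hτ.1))
        (show η ∈ Icc (signalRatio α β (q d) τ) (signalRatio α β (q d) 1) from
          ⟨(h.signalRatio_le hd3.le hτ).trans hη.le, hd1⟩)
      by_contra! hlt'
      have := hτ' t ⟨hlt'.le.trans ht.1, ht.2⟩
      rw [he] at this
      exact absurd this (not_le.2 hηE)
  · obtain ⟨τ, hτ1, hτ2⟩ := exists_between (lt_min ha hτs.2)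
    have hτ : τ ∈ Ico (0 : ℝ) 1 := ⟨(hτs.1.trans hτ1).le, hτ2.trans_le (min_le_right _ _)⟩
    have hlt : ηs < β τ / α τ := by
      rw [← hτsη]; exact hmono τs hτs' τ hτ hτ1
    -- Past τs the ratio at τ eventually exceeds ηs, and by monotonicity it stays above.
    filter_upwards [(h.tendsto_signalRatio hq hτ).eventually_const_lt hlt, hq0] with d hd1 hd2
    refine lt_of_le_of_lt (csInf_le ?_ ?_) (hτ2.trans_le (min_le_left _ _))
    · exact ⟨0, fun x hx => hx.1.1⟩
    · exact ⟨Ico_subset_Icc_self hτ, fun t ht => habove _ (hd1.trans_le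
        (h.monotoneOn_signalRatio hd2 (Ico_subset_Icc_self hτ) ⟨hτ.1.trans ht.1, ht.2⟩ ht.1))⟩

end IsSchedule

end Speciation

/-! ### The limit magnetization and its terminal law. -/

section LimitMagnetization

variable {α β : ℝ → ℝ} {p : ℝ}

theorem continuous_magDrift {T : ℝ → ℝ} (hT : Continuous T) (q τ : ℝ) :
    Continuous (magDrift α β T q τ) := by
  unfold magDrift
  fun_prop

theorem continuous_scalarEulerGrid {w : ℝ → ℝ → ℝ} (hw : ∀ τ, Continuous (w τ)) (N k : ℕ) :
    Continuous (scalarEulerGrid w N k) := by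
  induction k with
  | zero => exact continuous_id
  | succ k ih => exact ih.add (((hw _).comp ih).const_mul _)

theorem continuous_scalarEulerPath {w : ℝ → ℝ → ℝ} (hw : ∀ τ, Continuous (w τ)) (N : ℕ) (τ : ℝ) :
    Continuous (scalarEulerPath w N τ) :=
  (continuous_scalarEulerGrid hw N _).add
    (((hw _).comp (continuous_scalarEulerGrid hw N _)).const_mul _)

theorem continuous_eulerGrid {d : ℕ}
    {b : ℝ → EuclideanSpace ℝ (Fin d) → EuclideanSpace ℝ (Fin d)}
    (hb : ∀ τ ∈ Icc (0 : ℝ) 1, Continuous (b τ)) {N k : ℕ} (hk : k ≤ N) :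
    Continuous (eulerGrid b N k) := by
  induction k with
  | zero => exact continuous_id
  | succ k ih =>
    have h1 := ih (by omega)
    have h2 := hb ((k : ℝ) / N) (natCast_div_mem_Icc (by omega))
    change Continuous fun x => eulerGrid b N k x + (1 / (N : ℝ)) • b ((k : ℝ) / N) (eulerGrid b N k x)
    fun_prop

theorem continuous_eulerPath {d : ℕ}
    {b : ℝ → EuclideanSpace ℝ (Fin d) → EuclideanSpace ℝ (Fin d)}
    (hb : ∀ τ ∈ Icc (0 : ℝ) 1, Continuous (b τ)) (N : ℕ) {τ : ℝ} (hτ : τ ≤ 1) :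
    Continuous (eulerPath b N τ) := by
  have h1 := continuous_eulerGrid hb (floor_mul_le (N := N) hτ)
  have h2 := hb _ (natCast_div_mem_Icc (floor_mul_le (N := N) hτ))
  unfold eulerPath
  fun_prop

/-- The flow of `dy/dρ = T(ρ y)` started from `m`. -/
noncomputable def mixtureFlow (hp : p ∈ Icc (0 : ℝ) 1) (m : ℝ) : ℝ → ℝ :=
  (exists_mixtureTanh_flow hp m).choose

theorem mixtureFlow_zero (hp : p ∈ Icc (0 : ℝ) 1) (m : ℝ) : mixtureFlow hp m 0 = m :=
  (exists_mixtureTanh_flow hp m).choose_spec.1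

theorem hasDerivAt_mixtureFlow (hp : p ∈ Icc (0 : ℝ) 1) (m t : ℝ) :
    HasDerivAt (mixtureFlow hp m) (mixtureTanh p (t * mixtureFlow hp m t)) t :=
  (exists_mixtureTanh_flow hp m).choose_spec.2 t

open Classical in
/-- The mode reached at the final time from the initial magnetization `m`. -/
noncomputable def terminalMode (p m : ℝ) : ℝ :=
  if 1 - p < cdf (gaussianReal 0 1) m then 1 else -1

open Classical in
/-- The limiting magnetization, with its limit at the final time. -/
noncomputable def limitMagnetization (hp : p ∈ Icc (0 : ℝ) 1) (α β : ℝ → ℝ) (τ m : ℝ) : ℝ :=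
  if τ < 1 then limitPath α β (mixtureFlow hp m) τ else terminalMode p m

theorem measurableSet_lt_cdf (p : ℝ) :
    MeasurableSet {m | 1 - p < cdf (gaussianReal 0 1) m} :=
  (isOpen_lt continuous_const continuous_cdf_gaussianReal).measurableSet

theorem measurable_terminalMode (p : ℝ) : Measurable (terminalMode p) :=
  Measurable.ite (measurableSet_lt_cdf p) measurable_const measurable_const

theorem map_terminalMode (hp : p ∈ Icc (0 : ℝ) 1) :
    (gaussianReal 0 1).map (terminalMode p)
      = ENNReal.ofReal p • Measure.dirac (1 : ℝ)
        + ENNReal.ofReal (1 - p) • Measure.dirac (-1 : ℝ) := by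
  set A := {m | 1 - p < cdf (gaussianReal 0 1) m} with hA
  have hμ : gaussianReal 0 1 A = ENNReal.ofReal p := gaussianReal_setOf_lt_cdf hp
  have hμ' : gaussianReal 0 1 Aᶜ = ENNReal.ofReal (1 - p) := by
    rw [prob_compl_eq_one_sub (measurableSet_lt_cdf p), hμ, ← ENNReal.ofReal_one,
      ← ENNReal.ofReal_sub _ hp.1]
  ext B hB
  have hpre : terminalMode p ⁻¹' B = (A ∩ {_m | (1 : ℝ) ∈ B}) ∪ (Aᶜ ∩ {_m | (-1 : ℝ) ∈ B}) := by
    ext m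
    by_cases hm : m ∈ A
    · have : terminalMode p m = 1 := if_pos hm
      simp [this, hm]
    · have : terminalMode p m = -1 := if_neg hm
      simp [this, hm]
  rw [Measure.map_apply (measurable_terminalMode p) hB, hpre]
  by_cases h1 : (1 : ℝ) ∈ B <;> by_cases h2 : (-1 : ℝ) ∈ B <;>
    simp [h1, h2, hB, hμ, hμ', ofReal_add_ofReal_one_sub hp]

namespace IsSchedule

theorem tendsto_limitPath_mixtureFlow (h : IsSchedule α β) (hp : p ∈ Icc (0 : ℝ) 1) {m : ℝ}
    (hm : cdf (gaussianReal 0 1) m ≠ 1 - p) :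
    Tendsto (limitPath α β (mixtureFlow hp m)) (𝓝[<] 1) (𝓝 (terminalMode p m)) := by
  rcases hm.lt_or_gt with hlt | hgt
  · rw [terminalMode, if_neg hlt.not_gt]
    exact h.tendsto_limitPath (tendsto_mixtureTanh_flow_div_neg hp (hasDerivAt_mixtureFlow hp m)
      (by rwa [mixtureFlow_zero]))
  · rw [terminalMode, if_pos hgt]
    exact h.tendsto_limitPath (tendsto_mixtureTanh_flow_div hp (hasDerivAt_mixtureFlow hp m)
      (by rwa [mixtureFlow_zero]))

/-- The case of the mode −1 is the case of the mode 1 for −m and 1 − p. -/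
theorem tendsto_scalarEulerPath_one (h : IsSchedule α β) (hp : p ∈ Icc (0 : ℝ) 1) {m : ℝ}
    (hm : cdf (gaussianReal 0 1) m ≠ 1 - p) :
    Tendsto (fun N => scalarEulerPath (magDrift α β (mixtureTanh p) 0) N 1 m) atTop
      (𝓝 (terminalMode p m)) := by
  have hgrid : Tendsto (fun N => scalarEulerGrid (magDrift α β (mixtureTanh p) 0) N N m) atTop
      (𝓝 (terminalMode p m)) := by
    rcases hm.lt_or_gt with hlt | hgt
    · have hp' := one_sub_mem_Icc hp
      have h0 : 0 < 1 - p := (cdf_gaussianReal_pos m).trans hlt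
      have hy := mixtureTanh_flow_neg (hasDerivAt_mixtureFlow hp m)
      have hlim := h.tendsto_limitPath (tendsto_mixtureTanh_flow_div hp' hy (by
        rw [mixtureFlow_zero, cdf_gaussianReal_neg]; linarith))
      have := h.tendsto_scalarEulerGrid_last (lipschitz_mixtureTanh hp')
        (continuous_mixtureTanh hp') (abs_mixtureTanh_le_one hp') (tendsto_mixtureTanh_atTop h0)
        hy hlim
      rw [mixtureFlow_zero, (funext mixtureTanh_one_sub :
        mixtureTanh (1 - p) = fun u => -mixtureTanh p (-u))] at this
      simp_rw [scalarEulerGrid_neg] at this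
      rw [terminalMode, if_neg hlt.not_gt]
      simpa using this.neg
    · have h0 : 0 < p := by linarith [cdf_gaussianReal_lt_one m]
      have hy := hasDerivAt_mixtureFlow hp m
      have hlim := h.tendsto_limitPath (tendsto_mixtureTanh_flow_div hp hy (by
        rwa [mixtureFlow_zero]))
      have := h.tendsto_scalarEulerGrid_last (lipschitz_mixtureTanh hp)
        (continuous_mixtureTanh hp) (abs_mixtureTanh_le_one hp) (tendsto_mixtureTanh_atTop h0)
        hy hlim
      rw [mixtureFlow_zero] at this
      rwa [terminalMode, if_pos hgt]
  refine hgrid.congr' ?_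
  filter_upwards [eventually_ge_atTop 1] with N hN
  have hN0 : (N : ℝ) ≠ 0 := by exact_mod_cast (by omega : N ≠ 0)
  rw [← scalarEulerPath_natCast_div hN, div_self hN0]

theorem tendsto_scalarEulerPath_limitMagnetization (h : IsSchedule α β) (hp : p ∈ Icc (0 : ℝ) 1)
    {τ : ℝ} (hτ : τ ∈ Ico (0 : ℝ) 1) (m : ℝ) :
    Tendsto (fun N => scalarEulerPath (magDrift α β (mixtureTanh p) 0) N τ m) atTop
      (𝓝 (limitMagnetization hp α β τ m)) := by
  have := h.tendsto_scalarEulerPath (lipschitz_mixtureTanh hp) (continuous_mixtureTanh hp)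
    (hasDerivAt_mixtureFlow hp m) hτ
  have e : limitMagnetization hp α β τ m = limitPath α β (mixtureFlow hp m) τ := if_pos hτ.2
  rwa [mixtureFlow_zero, ← e] at this

theorem limitMagnetization_one (hp : p ∈ Icc (0 : ℝ) 1) (α β : ℝ → ℝ) :
    limitMagnetization hp α β 1 = terminalMode p :=
  funext fun _ => if_neg (lt_irrefl _)

theorem ae_tendsto_scalarEulerPath (h : IsSchedule α β) (hp : p ∈ Icc (0 : ℝ) 1)
    {τ : ℝ} (hτ : τ ∈ Icc (0 : ℝ) 1) :
    ∀ᵐ m ∂(gaussianReal 0 1),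
      Tendsto (fun N => scalarEulerPath (magDrift α β (mixtureTanh p) 0) N τ m) atTop
        (𝓝 (limitMagnetization hp α β τ m)) := by
  rcases hτ.2.lt_or_eq with hlt | rfl
  · exact ae_of_all _ fun m => h.tendsto_scalarEulerPath_limitMagnetization hp ⟨hτ.1, hlt⟩ m
  · filter_upwards [ae_cdf_gaussianReal_ne (1 - p)] with m hm
    rw [limitMagnetization_one]
    exact h.tendsto_scalarEulerPath_one hp hm

theorem tendstoInDistribution_scalarEulerPath (h : IsSchedule α β) (hp : p ∈ Icc (0 : ℝ) 1)
    {τ : ℝ} (hτ : τ ∈ Icc (0 : ℝ) 1) :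
    TendstoInDistribution
      (fun (N : ℕ) (m : ℝ) => scalarEulerPath (magDrift α β (mixtureTanh p) 0) N τ m) atTop
      (limitMagnetization hp α β τ) (fun _ => gaussianReal 0 1) (gaussianReal 0 1) := by
  have hmeas : ∀ N : ℕ, AEMeasurable (scalarEulerPath (magDrift α β (mixtureTanh p) 0) N τ)
      (gaussianReal 0 1) := fun N =>
    (continuous_scalarEulerPath (fun t => continuous_magDrift (continuous_mixtureTanh hp) 0 t)
      N τ).aemeasurable
  have hae := h.ae_tendsto_scalarEulerPath hp hτ
  -- The flow is chosen separately for each m, so measurability of the limit in m comes from its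
  -- being an almost everywhere limit of continuous functions.
  exact tendstoInDistribution_of_ae_tendsto hmeas
    (aemeasurable_of_tendsto_metrizable_ae atTop hmeas hae) hae

theorem hasDerivWithinAt_limitMagnetization (h : IsSchedule α β) (hp : p ∈ Icc (0 : ℝ) 1) (m : ℝ) :
    SolvesLimitODE α β (mixtureTanh p) (fun τ => limitMagnetization hp α β τ m) := by
  intro τ hτ
  have heq : ∀ t ∈ Ico (0 : ℝ) 1, limitMagnetization hp α β t m
      = limitPath α β (mixtureFlow hp m) t := fun t ht => if_pos ht.2
  have := h.hasDerivWithinAt_limitPath (hasDerivAt_mixtureFlow hp m) hτ Ico_subset_Icc_self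
  rw [magDrift_zero _ (h.fst_pos hτ).ne', ← heq τ hτ] at this
  exact this.congr heq (heq τ hτ)

theorem ae_tendsto_limitMagnetization (h : IsSchedule α β) (hp : p ∈ Icc (0 : ℝ) 1) :
    ∀ᵐ m ∂(gaussianReal 0 1), Tendsto (fun τ => limitMagnetization hp α β τ m) (𝓝[<] 1)
      (𝓝 (limitMagnetization hp α β 1 m)) := by
  filter_upwards [ae_cdf_gaussianReal_ne (1 - p)] with m hm
  rw [limitMagnetization_one]
  refine (h.tendsto_limitPath_mixtureFlow hp hm).congr' ?_
  filter_upwards [self_mem_nhdsWithin] with t ht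
  exact (if_pos ht).symm

theorem limitMagnetization_zero (h : IsSchedule α β) (hp : p ∈ Icc (0 : ℝ) 1) (m : ℝ) :
    limitMagnetization hp α β 0 m = m := by
  rw [limitMagnetization, if_pos zero_lt_one, h.limitPath_zero, mixtureFlow_zero]

/-- At the last grid time before 1 one has α = 1/N and α̇ = −1, so the rate is −N and the last
factor vanishes exactly. -/
theorem orthFactor_eq_zero_of_linear (h : IsSchedule α β)
    (hlin : ∀ τ ∈ Icc (0 : ℝ) 1, α τ = 1 - τ) {N : ℕ} (hN : 1 ≤ N) :
    orthFactor α β 0 N N = 0 := by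
  have hN0 : (0 : ℝ) < N := by exact_mod_cast hN
  refine Finset.prod_eq_zero (i := N - 1) (Finset.mem_range.2 (by omega)) ?_
  have hmem := natCast_div_mem_Ico (show N - 1 < N by omega)
  have hα := hlin _ (Ico_subset_Icc_self hmem)
  have hd : timeDeriv α (((N - 1 : ℕ) : ℝ) / N) = -1 := by
    have h1 : HasDerivWithinAt α (-1) (Icc 0 1) (((N - 1 : ℕ) : ℝ) / N) :=
      (((hasDerivAt_id _).const_sub 1).hasDerivWithinAt).congr hlin hα
    exact h1.derivWithin (uniqueDiffOn_Icc zero_lt_one _ (Ico_subset_Icc_self hmem))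
  have hα' : α (((N - 1 : ℕ) : ℝ) / N) = 1 / N := by
    rw [hα, Nat.cast_sub hN]
    field_simp
    push_cast
    ring
  rw [orthRate_zero (h.fst_pos hmem).ne', hd, hα']
  field_simp
  ring

end IsSchedule

end LimitMagnetization

/-! ### The size of q = σ²/d. -/

section RelativeVariance

variable {σ : ℕ → ℝ}

theorem tendsto_relative_variance
    (hσ : (fun d : ℕ => σ d ^ 2) =Θ[atTop] (fun _ : ℕ => (1 : ℝ))) :
    Tendsto (fun d : ℕ => σ d ^ 2 / d) atTop (𝓝 0) := by
  have h := tendsto_one_div_atTop_nhds_zero_nat (𝕜 := ℝ) |>.zero_mul_isBoundedUnder_le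
    ((isBigO_one_iff ℝ).1 hσ.1)
  exact h.congr fun d => one_div_mul_eq_div _ _

theorem tendsto_sqrt_mul_relative_variance
    (hσ : (fun d : ℕ => σ d ^ 2) =Θ[atTop] (fun _ : ℕ => (1 : ℝ))) :
    Tendsto (fun d : ℕ => √(d : ℝ) * (σ d ^ 2 / d)) atTop (𝓝 0) := by
  have h0 : Tendsto (fun d : ℕ => (√(d : ℝ))⁻¹) atTop (𝓝 0) :=
    tendsto_inv_atTop_zero.comp (Real.tendsto_sqrt_atTop.comp tendsto_natCast_atTop_atTop)
  have h := h0.zero_mul_isBoundedUnder_le ((isBigO_one_iff ℝ).1 hσ.1)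
  refine h.congr fun d => ?_
  rw [mul_div_left_comm, Real.sqrt_div_self', mul_comm, one_div]

end RelativeVariance

/-! ### Assembly of the proposition. -/

theorem proposition2
    (α β : ℝ → ℝ)
    (hα : ContDiffOn ℝ 2 α (Icc 0 1)) (hβ : ContDiffOn ℝ 2 β (Icc 0 1))
    (hα0 : α 0 = 1) (hα1 : α 1 = 0) (hβ0 : β 0 = 0) (hβ1 : β 1 = 1)
    (hα' : ∀ τ ∈ Icc (0 : ℝ) 1, timeDeriv α τ < 0)
    (hβ' : ∀ τ ∈ Icc (0 : ℝ) 1, 0 < timeDeriv β τ)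
    (p : ℝ) (hp : p ∈ Icc (0 : ℝ) 1)
    (σ : ℕ → ℝ) (hσ : ∀ d, 0 < σ d)
    (hσΘ : (fun d : ℕ => σ d ^ 2) =Θ[atTop] (fun _ : ℕ => (1 : ℝ)))
    (r : ∀ d : ℕ, EuclideanSpace ℝ (Fin d)) (hr : ∀ d : ℕ, ‖r d‖ ^ 2 = d) :
    -- the velocity field of the VE interpolant exists in each dimension
    (∀ d : ℕ, ∃ b : ℝ → EuclideanSpace ℝ (Fin d) → EuclideanSpace ℝ (Fin d),
      IsProbabilityFlowVelocity (√d) α β (gaussianMixture p (r d) (σ d)) b) ∧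
    -- the speciation time has a limit inside `(0,1)`
    (∀ ε ∈ Ioo (0 : ℝ) (4 * p * (1 - p)), ∃ τs ∈ Ioo (0 : ℝ) 1,
      Tendsto (fun d : ℕ => speciationTime (√d) α β p (r d) (σ d) ε) atTop (𝓝 τs)) ∧
    ∀ b : (d : ℕ) → ℝ → EuclideanSpace ℝ (Fin d) → EuclideanSpace ℝ (Fin d),
      (∀ d : ℕ, IsProbabilityFlowVelocity (√d) α β (gaussianMixture p (r d) (σ d)) (b d)) →
      -- the magnetization
      ((∀ d : ℕ, 1 ≤ d →
          (gaussianIso (0 : EuclideanSpace ℝ (Fin d)) (√d)).map (magnetization (r d))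
            = gaussianReal 0 1) ∧
        ∃ (MN : ℕ → ℝ → ℝ → ℝ) (M : ℝ → ℝ → ℝ),
          -- limit `d → ∞` at fixed step `1/N`, then `N → ∞`, as functions of the value at time 0
          (∀ N : ℕ, 1 ≤ N → ∀ τ ∈ Icc (0 : ℝ) 1, ∀ (m : ℝ)
            (x : (d : ℕ) → EuclideanSpace ℝ (Fin d)),
            (∀ d : ℕ, 1 ≤ d → magnetization (r d) (x d) = m) →
            Tendsto (fun d : ℕ => magnetization (r d) (eulerPath (b d) N τ (x d))) atTop
              (𝓝 (MN N τ m))) ∧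
          (∀ τ ∈ Ico (0 : ℝ) 1, ∀ m : ℝ, Tendsto (fun N => MN N τ m) atTop (𝓝 (M τ m))) ∧
          (∀ᵐ m ∂(gaussianReal 0 1), Tendsto (fun N => MN N 1 m) atTop (𝓝 (M 1 m))) ∧
          -- the same two limits in distribution
          (∀ N : ℕ, 1 ≤ N → ∀ τ ∈ Icc (0 : ℝ) 1,
            TendstoInDistribution
              (fun (d : ℕ) (x : EuclideanSpace ℝ (Fin d)) =>
                magnetization (r d) (eulerPath (b d) N τ x))
              atTop (MN N τ) (fun d : ℕ => gaussianIso 0 (√d)) (gaussianReal 0 1)) ∧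
          (∀ τ ∈ Icc (0 : ℝ) 1,
            TendstoInDistribution (fun (N : ℕ) (m : ℝ) => MN N τ m) atTop (M τ)
              (fun _ => gaussianReal 0 1) (gaussianReal 0 1)) ∧
          -- the limiting equation
          (∀ m : ℝ, M 0 m = m) ∧
          (∀ h : ℝ, Real.exp h / (Real.exp h + Real.exp (-h)) = p →
            ∀ m : ℝ, SolvesLimitODE α β (fun u => Real.tanh (h + u)) (fun τ => M τ m)) ∧
          (p = 1 → ∀ m : ℝ, SolvesLimitODE α β (fun _ => 1) (fun τ => M τ m)) ∧
          (p = 0 → ∀ m : ℝ, SolvesLimitODE α β (fun _ => -1) (fun τ => M τ m)) ∧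
          -- the terminal law
          (∀ᵐ m ∂(gaussianReal 0 1), Tendsto (fun τ => M τ m) (𝓝[<] 1) (𝓝 (M 1 m))) ∧
          (gaussianReal 0 1).map (M 1)
            = ENNReal.ofReal p • Measure.dirac (1 : ℝ)
              + ENNReal.ofReal (1 - p) • Measure.dirac (-1 : ℝ)) ∧
      -- the orthogonal part
      (∃ s : ℕ → ℕ → ℕ → ℝ,
        (∀ N d l, 0 ≤ s N d l) ∧
        (∀ N d l : ℕ, 1 ≤ N → 1 ≤ d → l ≤ N →
          (gaussianIso (0 : EuclideanSpace ℝ (Fin d)) (√d)).map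
              (fun x => orthPart (r d) (eulerPath (b d) N ((l : ℝ) / N) x))
            = (stdGaussian ((Submodule.span ℝ {r d})ᗮ)).map
              (fun w : (Submodule.span ℝ {r d})ᗮ => s N d l • (w : EuclideanSpace ℝ (Fin d)))) ∧
        -- in units of the initial standard deviation it tends to zero
        (∃ L : ℕ → ℝ,
          (∀ N : ℕ, 1 ≤ N → Tendsto (fun d : ℕ => s N d N / √d) atTop (𝓝 (L N))) ∧
          Tendsto L atTop (𝓝 0)) ∧
        -- at a fixed step it tends to `0` or to `∞`, so that `σ` is lost
        (∀ N : ℕ, 1 ≤ N →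
          Tendsto (fun d : ℕ => s N d N) atTop (𝓝 0) ∨
          Tendsto (fun d : ℕ => s N d N) atTop atTop) ∧
        -- for the linear schedule it tends to `0`
        ((∀ τ ∈ Icc (0 : ℝ) 1, α τ = 1 - τ) →
          ∀ N : ℕ, 1 ≤ N → Tendsto (fun d : ℕ => s N d N) atTop (𝓝 0))) := by
  have h : IsSchedule α β := ⟨hα, hβ, hα0, hα1, hβ0, hβ1, hα', hβ'⟩
  have hT := continuous_mixtureTanh hp
  have hsqrt : ∀ d : ℕ, 1 ≤ d → 0 < √(d : ℝ) := fun d hd =>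
    Real.sqrt_pos.2 (by exact_mod_cast hd)
  have hq : Tendsto (fun d : ℕ => σ d ^ 2 / d) atTop (𝓝 0) := tendsto_relative_variance hσΘ
  have hq0 : ∀ d : ℕ, 0 ≤ σ d ^ 2 / (d : ℝ) := fun d => by positivity
  have hqpos : ∀ᶠ d : ℕ in atTop, 0 < σ d ^ 2 / (d : ℝ) := by
    filter_upwards [eventually_ge_atTop 1] with d hd
    have h1 : (0 : ℝ) < d := by exact_mod_cast hd
    have h2 := hσ d
    positivity
  refine ⟨fun d => ?_, fun ε hε => ?_, fun b hb => ⟨⟨fun d hd =>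
    map_magnetization_gaussianIso hd (hr d), fun N τ m =>
      scalarEulerPath (magDrift α β (mixtureTanh p) 0) N τ m, limitMagnetization hp α β,
      fun N hN τ hτ m x hx => ?_, fun τ hτ m => h.tendsto_scalarEulerPath_limitMagnetization hp hτ m,
      h.ae_tendsto_scalarEulerPath hp (by simp), fun N hN τ hτ => ?_,
      fun τ hτ => h.tendstoInDistribution_scalarEulerPath hp hτ, h.limitMagnetization_zero hp,
      fun t ht m => ?_, fun hp1 m => ?_, fun hp0 m => ?_, h.ae_tendsto_limitMagnetization hp, ?_⟩,
      fun N d l => √(d : ℝ) * |orthFactor α β (σ d ^ 2 / d) N l|, fun N d l => by positivity,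
      fun N d l hN hd hl => ?_, ⟨fun N => |orthFactor α β 0 N N|, fun N hN => ?_, ?_⟩,
      fun N hN => ?_, fun hlin N hN => ?_⟩⟩
  · rcases Nat.eq_zero_or_pos d with rfl | hd
    · exact exists_isProbabilityFlowVelocity_of_subsingleton _ α β _
    · exact ⟨_, isProbabilityFlowVelocity_mixtureVelocity h hp (r d) (hsqrt d hd) (hσ d)⟩
  -- A tolerance in (0, 4p(1 − p)) excludes p = 0 and p = 1.
  · have hpp : 0 < p ∧ p < 1 := by
      have h1 := hε.1.trans hε.2
      constructor <;> by_contra! hc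
      · nlinarith [hp.1, hp.2]
      · nlinarith [hp.1, hp.2]
    obtain ⟨τs, hτs, hlim⟩ := h.exists_tendsto_sInf (continuous_signMMSE hp).continuousAt
      (by rw [signMMSE_zero]; exact hε.2)
      ((tendsto_signMMSE_atTop hp hpp.1 hpp.2).eventually_le_const hε.1) hq hqpos
    refine ⟨τs, hτs, hlim.congr' ?_⟩
    filter_upwards [eventually_ge_atTop 1] with d hd
    rw [speciationTime]
    congr 1
    ext τ
    refine and_congr_right fun hτ => forall₂_congr fun t ht => ?_
    rw [modeUncertainty_eq_signMMSE h hp hd (hr d) (hσ d) ⟨hτ.1.trans ht.1, ht.2⟩]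
  · have hbv : ∀ d : ℕ, 1 ≤ d → ∀ τ ∈ Icc (0 : ℝ) 1, b d τ = mixtureVelocity p (r d) (√d) α β (σ d) τ :=
      fun d hd τ hτ => (hb d).eq_mixtureVelocity h hp (hsqrt d hd) (hσ d) hτ
    refine (h.tendsto_scalarEulerPath_magDrift hT hq hN hτ m).congr' ?_
    filter_upwards [eventually_ge_atTop 1] with d hd
    rw [magnetization_eulerPath hd (hr d) (hbv d hd) N hτ, hx d hd]
  · have hbv : ∀ d : ℕ, 1 ≤ d → ∀ τ ∈ Icc (0 : ℝ) 1, b d τ = mixtureVelocity p (r d) (√d) α β (σ d) τ :=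
      fun d hd τ hτ => (hb d).eq_mixtureVelocity h hp (hsqrt d hd) (hσ d) hτ
    have hcont : ∀ q : ℝ, Continuous (scalarEulerPath (magDrift α β (mixtureTanh p) q) N τ) :=
      fun q => continuous_scalarEulerPath (fun t => continuous_magDrift hT q t) N τ
    have hX : ∀ d : ℕ, Continuous fun x => magnetization (r d) (eulerPath (b d) N τ x) := fun d =>
      (continuous_magnetization (r d)).comp
        (continuous_eulerPath (fun t ht => (hb d t ht).1) N hτ.2)
    -- All dimensions d ≥ 1 share the initial law N(0,1) of the magnetization, so convergence is
    -- first obtained pointwise on the line. It is then transferred by equality of laws.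
    have hdist := tendstoInDistribution_of_ae_tendsto (μ' := gaussianReal 0 1) (l := atTop)
      (X := fun d : ℕ => scalarEulerPath (magDrift α β (mixtureTanh p) (σ d ^ 2 / d)) N τ)
      (Z := scalarEulerPath (magDrift α β (mixtureTanh p) 0) N τ)
      (fun d => (hcont _).aemeasurable) (hcont 0).aemeasurable
      (ae_of_all _ fun m => h.tendsto_scalarEulerPath_magDrift hT hq hN hτ m)
    refine ⟨fun d => (hX d).aemeasurable, (hcont 0).aemeasurable, hdist.tendsto.congr' ?_⟩
    filter_upwards [eventually_ge_atTop 1] with d hd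
    refine Subtype.ext ?_
    change (gaussianReal 0 1).map _ = (gaussianIso 0 √d).map _
    rw [← map_magnetization_gaussianIso hd (hr d), Measure.map_map (hcont _).measurable
      (continuous_magnetization _).measurable]
    congr 1
    ext x
    exact (magnetization_eulerPath hd (hr d) (hbv d hd) N hτ x).symm
  · have := h.hasDerivWithinAt_limitMagnetization hp m
    rwa [(funext (mixtureTanh_eq_tanh ht) : mixtureTanh p = fun u => Real.tanh (t + u))] at this
  · have := h.hasDerivWithinAt_limitMagnetization hp m
    subst hp1
    rwa [(funext mixtureTanh_one : mixtureTanh 1 = fun _ => 1)] at this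
  · have := h.hasDerivWithinAt_limitMagnetization hp m
    subst hp0
    rwa [(funext mixtureTanh_zero : mixtureTanh 0 = fun _ => -1)] at this
  · rw [IsSchedule.limitMagnetization_one, map_terminalMode hp]
  · have hbv : ∀ τ ∈ Icc (0 : ℝ) 1, b d τ = mixtureVelocity p (r d) (√d) α β (σ d) τ :=
      fun τ hτ => (hb d).eq_mixtureVelocity h hp (hsqrt d hd) (hσ d) hτ
    rw [← map_smul_orthPart_gaussianIso (hr d) (c := orthFactor α β (σ d ^ 2 / d) N l) (k := √(d : ℝ))
      (by rw [mul_pow, mul_pow, sq_abs, mul_comm])]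
    congr 1
    ext1 x
    rw [eulerPath_natCast_div hN, orthPart_eulerGrid hd (hr d) hbv N x hl]
  · refine (h.tendsto_orthFactor hq N).abs.congr' ?_
    filter_upwards [eventually_ge_atTop 1] with d hd
    rw [mul_div_cancel_left₀ _ (hsqrt d hd).ne']
  · simpa using h.tendsto_orthFactor_zero.abs
  -- Either the limiting factor vanishes and the true one is of order 1/d, which beats √d, or the
  -- factor √d wins.
  · by_cases hN0 : orthFactor α β 0 N N = 0
    · exact Or.inl (h.tendsto_mul_abs_orthFactor hq hq0 (tendsto_sqrt_mul_relative_variance hσΘ) hN0)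
    · exact Or.inr ((Real.tendsto_sqrt_atTop.comp tendsto_natCast_atTop_atTop).atTop_mul_pos
        (abs_pos.2 hN0) (h.tendsto_orthFactor hq N).abs)
  · exact h.tendsto_mul_abs_orthFactor hq hq0 (tendsto_sqrt_mul_relative_variance hσΘ)
      (h.orthFactor_eq_zero_of_linear hlin hN)
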